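/- Consider the focusing cubic nonlinear Schr\"odinger equation on the line, $$ i u_t + u_{xx} + 2|u|^2 u = 0, \qquad u=u(t,x)\in\mathbb{C},\ (t,x)\in\mathbb{R}^2. \tag{NLS} $$ There is $\varepsilon_0>0$ such that for every $\varepsilon\in(0,\varepsilon_0)$ there is a constant $C>0$, depending only on $\varepsilon$, with the following property. Let $q\in C(\mathbb{R};H^3(\mathbb{R}))$ be a solution of (NLS) with $\|q(0,\cdot)\|_{L^2}<\varepsilon$. Let $\boldsymbol\varphi=(\varphi_1,\varphi_2)$ and $\boldsymbol\chi=(\chi_1,\chi_2)$ be complex vector functions of $(t,x)$ which both solve, for all $t,x\in\mathbb{R}$, the linear equation $$ \partial_t \begin{bmatrix} v_1\\ v_2\end{bmatrix} = i\begin{bmatrix} \tfrac12+|q|^2 & \partial_x q+q\\ \partial_x\bar q-\bar q & -\tfrac12-|q|^2\end{bmatrix}\begin{bmatrix} v_1\\ v_2\end{bmatrix} $$ and which at $t=0$ solve the boundary value problems $$ \varphi_1'=q\varphi_2,\quad \varphi_2'=-\bar q\varphi_1-\varphi_2,\quad \lim_{x\to\infty}\varphi_1(x)=1,\quad \lim_{x\to-\infty}e^{x}\varphi_2(x)=0,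 $$ $$ \chi_1'=\chi_1+q\chi_2,\quad \chi_2'=-\bar q\chi_1,\quad \lim_{x\to\infty}e^{-x}\chi_1(x)=0,\quad \lim_{x\to-\infty}\chi_2(x)=-1, $$ with $q=q(0,x)$. Let $a\in\mathbb{C}\setminus\{0\}$, $\gamma,\theta\in\mathbb{R}$, $c_1=ae^{(\gamma+i\theta)/2}$, $c_2=ae^{-(\gamma+i\theta)/2}$, and $$ \psi_j(t,x)=c_1e^{x/2}\varphi_j(t,x)+c_2e^{-x/2}\chi_j(t,x)\qquad (j=1,2). $$ Then $|\psi_1|^2+|\psi_2|^2$ vanishes nowhere, the function $$ Q(t,x)=-q(t,x)-\frac{2\psi_1(t,x)\overline{\psi_2(t,x)}}{|\psi_1(t,x)|^2+|\psi_2(t,x)|^2} $$ belongs to $C(\mathbb{R};H^3(\mathbb{R}))$ and is a solution of (NLS), and $$ \sup_{t\in\mathbb{R}}\bigl\|Q(t,\cdot)-e^{i(t+\theta)}\operatorname{sech}(\cdot+\gamma)\bigr\|_{L^2}\le C\,\|q(0,\cdot)\|_{L^2}. $$ -/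

import Mathlib

open MeasureTheory Filter Topology
open scoped ContDiff ComplexConjugate

noncomputable section

namespace BacklundNLS

/-- `g` is the weak derivative of `f` on the real line. -/
def IsWeakDeriv (f g : ℝ → ℂ) : Prop :=
  LocallyIntegrable f volume ∧ LocallyIntegrable g volume ∧
    ∀ ζ : ℝ → ℝ, ContDiff ℝ ∞ ζ → HasCompactSupport ζ →
      ∫ x, f x * ((deriv ζ x : ℝ) : ℂ) = -∫ x, g x * (ζ x : ℂ)

/-- `u ∈ C(ℝ; H^m(ℝ))`, where `u t x` is a function of time `t` and position `x`: for each `t` the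
function `u t` has weak derivatives `D k t` of order `k ≤ m`, all of them in `L²(ℝ)`, and
`t ↦ D k t` is continuous in `L²(ℝ)` for `k ≤ m`.  As usual for `m ≥ 1`, an element of
`H^m(ℝ)` is identified with its continuous representative. -/
def ContinuousInSobolev (m : ℕ) (u : ℝ → ℝ → ℂ) : Prop :=
  (∀ t, Continuous (u t)) ∧
    ∃ D : ℕ → ℝ → ℝ → ℂ, D 0 = u ∧
      (∀ k < m, ∀ t, IsWeakDeriv (D k t) (D (k + 1) t)) ∧
      (∀ k ≤ m, ∀ t, MemLp (D k t) 2 volume) ∧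
      ∀ k ≤ m, ∀ t₀, Tendsto (fun t => eLpNorm (D k t - D k t₀) 2 volume) (𝓝 t₀) (𝓝 0)

/-- `u ∈ C(ℝ; H³(ℝ))` solves `i u_t + u_xx + 2 |u|² u = 0`.  Since `H³(ℝ) ⊂ C²(ℝ)`, the second
derivative in `x` is a classical one; `u_xx + 2 |u|² u` is then continuous in time with values in
`H¹(ℝ)`, so the equation in `H¹(ℝ)` is the same as the equation at every point `(t, x)`. -/
structure IsH3SolutionNLS (u : ℝ → ℝ → ℂ) : Prop where
  continuousInSobolev : ContinuousInSobolev 3 u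
  differentiableAt_time : ∀ t x, DifferentiableAt ℝ (fun s => u s x) t
  equation : ∀ t x, Complex.I * deriv (fun s => u s x) t + deriv (deriv (u t)) x
    + 2 * (‖u t x‖ : ℂ) ^ 2 * u t x = 0

/-- `(φ₁, φ₂)` solves the boundary value problem
`φ₁' = q φ₂`, `φ₂' = -q̄ φ₁ - φ₂`, `φ₁(x) → 1` as `x → ∞`, `e^x φ₂(x) → 0` as `x → -∞`. -/
structure IsJostPhi (q φ₁ φ₂ : ℝ → ℂ) : Prop where
  hasDerivAt_fst : ∀ x, HasDerivAt φ₁ (q x * φ₂ x) x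
  hasDerivAt_snd : ∀ x, HasDerivAt φ₂ (-conj (q x) * φ₁ x - φ₂ x) x
  tendsto_fst : Tendsto φ₁ atTop (𝓝 1)
  tendsto_snd : Tendsto (fun x : ℝ => (Real.exp x : ℂ) * φ₂ x) atBot (𝓝 0)

/-- `(χ₁, χ₂)` solves the boundary value problem
`χ₁' = χ₁ + q χ₂`, `χ₂' = -q̄ χ₁`, `e^{-x} χ₁(x) → 0` as `x → ∞`, `χ₂(x) → -1` as `x → -∞`. -/
structure IsJostChi (q χ₁ χ₂ : ℝ → ℂ) : Prop where
  hasDerivAt_fst : ∀ x, HasDerivAt χ₁ (χ₁ x + q x * χ₂ x) x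
  hasDerivAt_snd : ∀ x, HasDerivAt χ₂ (-conj (q x) * χ₁ x) x
  tendsto_fst : Tendsto (fun x : ℝ => (Real.exp (-x) : ℂ) * χ₁ x) atTop (𝓝 0)
  tendsto_snd : Tendsto χ₂ atBot (𝓝 (-1))

/-- The time equation of the Lax pair with spectral parameter `η = 1/2`, for every `(t, x)`. -/
structure SolvesLaxTime (q v₁ v₂ : ℝ → ℝ → ℂ) : Prop where
  hasDerivAt_fst : ∀ t x, HasDerivAt (fun s => v₁ s x)
    (Complex.I * ((1 / 2 + (‖q t x‖ : ℂ) ^ 2) * v₁ t x + (deriv (q t) x + q t x) * v₂ t x)) t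
  hasDerivAt_snd : ∀ t x, HasDerivAt (fun s => v₂ s x)
    (Complex.I * ((conj (deriv (q t) x) - conj (q t x)) * v₁ t x
      - (1 / 2 + (‖q t x‖ : ℂ) ^ 2) * v₂ t x)) t

/-- `c₁ e^{x/2} φ(t,x) + c₂ e^{-x/2} χ(t,x)` with `c₁ = a e^{(γ+iθ)/2}`, `c₂ = a e^{-(γ+iθ)/2}`,
for one component `φ`, `χ` of the two vector functions. -/
def superpose (a : ℂ) (γ θ : ℝ) (φ χ : ℝ → ℝ → ℂ) (t x : ℝ) : ℂ :=
  a * Complex.exp ((γ + Complex.I * θ) / 2) * Real.exp (x / 2) * φ t x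
    + a * Complex.exp (-(γ + Complex.I * θ) / 2) * Real.exp (-x / 2) * χ t x

/-- The Bäcklund transform `Q = -q - 2 ψ₁ ψ̄₂ / (|ψ₁|² + |ψ₂|²)`. -/
def backlund (q ψ₁ ψ₂ : ℝ → ℝ → ℂ) (t x : ℝ) : ℂ :=
  -q t x - 2 * ψ₁ t x * conj (ψ₂ t x) / ((‖ψ₁ t x‖ ^ 2 + ‖ψ₂ t x‖ ^ 2 : ℝ) : ℂ)

/-- The soliton profile `sech`. -/
def sech (x : ℝ) : ℝ := 1 / Real.cosh x

end BacklundNLS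

end

noncomputable section

namespace BacklundNLS

/-! ### Weak derivatives on the line -/

/-! The map from q to Q is a Darboux transform. Let U and A be the space and time matrices of the
Lax pair; the cubic equation is the zero-curvature identity U_t - A_x + [U, A] = 0. If ψ solves both
linear systems, then p = ψ₁ψ̄₂/|ψ|² and k = (|ψ₁|² - |ψ₂|²)/|ψ|² obey a system in which ψ no longer
occurs, with k² = 1 - 4|p|² (`isDarboux_of_lax`), and this system makes Q = -q - 2p a solution
(`IsDarboux.equation`).

For q = 0 the normalised Jost functions are (1, 0) and (0, -1), and -2p is exactly the soliton
e^{i(t+θ)} sech(x+γ). For small q the deviation is estimated at each fixed time, with δ the L² norm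
of q. An energy estimate for the damped equation of φ₂ and Cauchy–Schwarz for φ₁ give φ₁ = 1 +
O(δ²), and φ₂ = O(δ) both in L^∞ and in L²; reflection gives the same for χ. Then |ψ|² is comparable
to cosh(x+γ), and -2p differs from the soliton by at most a multiple of |φ₂| + |χ₁| + δ sech(x+γ)
(`norm_backlund_sub_soliton_le`), which is O(δ) in L².

The bound is uniform in time for two reasons. Mass is conserved
(`RegularSolution.integral_normSq_eq`), so δ does not change. And φ(t), χ(t) remain, up to the
phases e^{∓it/2}, the Jost functions of q(t) (`RegularSolution.isJostPhi`,
`RegularSolution.isJostChi`): zero curvature propagates the space equation, and Grönwall controls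
the limits at infinity. Multiplying the phases into the superposition produces the rotation e^{it}
of the soliton.

Regularity of Q follows from the Darboux system: derivatives of p up to third order are bounded
coefficients times q, q', q'' and p, while p itself is continuous in L² because p_t is locally
bounded there. -/

lemma exists_forall_eq_zero_of_hasCompactSupport {ζ : ℝ → ℝ} (hc : HasCompactSupport ζ) :
    ∃ R : ℝ, 0 < R ∧ ∀ x, R ≤ |x| → ζ x = 0 := by
  obtain ⟨R, hR, h⟩ := hc.isCompact.isBounded.exists_pos_norm_lt
  refine ⟨R, hR, fun x hx => image_eq_zero_of_notMem_tsupport fun hmem => ?_⟩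
  have := h x hmem
  rw [Real.norm_eq_abs] at this
  linarith

lemma support_subset_Ioc_of_abs {E : Type*} [Zero E] {f : ℝ → E} {R : ℝ}
    (h : ∀ x, R ≤ |x| → f x = 0) : Function.support f ⊆ Set.Ioc (-R) R := by
  intro x hx
  have : |x| < R := by
    by_contra hcon
    exact hx (h x (not_lt.1 hcon))
  exact ⟨(abs_lt.1 this).1, (abs_lt.1 this).2.le⟩

lemma deriv_eq_zero_of_abs {ζ : ℝ → ℝ} {R : ℝ} (h : ∀ x, R ≤ |x| → ζ x = 0) (x : ℝ)
    (hx : R + 1 ≤ |x|) : deriv ζ x = 0 := by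
  -- The margin 1 places a whole neighbourhood of x in the region where ζ vanishes.
  have : ζ =ᶠ[𝓝 x] fun _ => 0 := by
    have : ∀ᶠ y in 𝓝 x, R < |y| :=
      continuous_abs.continuousAt.eventually (lt_mem_nhds (by linarith : R < |x|))
    filter_upwards [this] with y hy using h y hy.le
  rw [this.deriv_eq]
  simp

lemma intervalIntegrable_of_locallyIntegrable {E : Type*} [NormedAddCommGroup E] {g : ℝ → E}
    (hg : LocallyIntegrable g volume) (a b : ℝ) : IntervalIntegrable g volume a b :=
  intervalIntegrable_iff.mpr <|
    (hg.integrableOn_isCompact isCompact_uIcc).mono_set Set.uIoc_subset_uIcc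

/-- The primitive is only absolutely continuous; that is enough to integrate by parts on an interval
at whose ends ζ vanishes. -/
lemma integral_primitive_mul_deriv_real {g ζ : ℝ → ℝ} (hg : LocallyIntegrable g volume)
    (hζ : ContDiff ℝ ∞ ζ) (hc : HasCompactSupport ζ) :
    ∫ x, (∫ s in (0 : ℝ)..x, g s) * deriv ζ x = -∫ x, g x * ζ x := by
  obtain ⟨R, hR, h0⟩ := exists_forall_eq_zero_of_hasCompactSupport hc
  have h0' : ∀ x, R + 1 ≤ |x| → ζ x = 0 := fun x hx => h0 x (by linarith)
  have hd := deriv_eq_zero_of_abs h0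
  have hgi : ∀ a b, IntervalIntegrable g volume a b := intervalIntegrable_of_locallyIntegrable hg
  have hG := (hgi (-(R+1)) (R+1)).absolutelyContinuousOnInterval_intervalIntegral (c := 0)
    (by rw [Set.uIcc_of_le (by linarith)]; constructor <;> linarith)
  have hZ : AbsolutelyContinuousOnInterval ζ (-(R+1)) (R+1) :=
    (hζ.of_le (by exact_mod_cast le_top : (1 : WithTop ℕ∞) ≤ ∞)).contDiffOn.absolutelyContinuousOnInterval
  have key := hG.integral_mul_deriv_eq_deriv_mul hZ
  rw [h0' (R+1) (le_abs_self _), h0' (-(R+1)) (by rw [abs_neg]; exact le_abs_self _)] at key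
  rw [← intervalIntegral.integral_eq_integral_of_support_subset (a := -(R+1)) (b := R+1)
      (support_subset_Ioc_of_abs fun x hx => by rw [hd x hx, mul_zero]),
    ← intervalIntegral.integral_eq_integral_of_support_subset (a := -(R+1)) (b := R+1)
      (support_subset_Ioc_of_abs fun x hx => by rw [h0' x hx, mul_zero]), key]
  simp only [mul_zero, sub_zero, zero_sub, neg_inj]
  refine intervalIntegral.integral_congr_ae ?_
  filter_upwards [LocallyIntegrable.ae_hasDerivAt_integral hg] with x hx _
  rw [(hx 0).deriv]

lemma LocallyIntegrable.mul_test {f : ℝ → ℂ} (hf : LocallyIntegrable f volume) {ζ : ℝ → ℝ}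
    (hζ : Continuous ζ) (hc : HasCompactSupport ζ) :
    Integrable (fun x => f x * (ζ x : ℂ)) volume := by
  have := hf.integrable_smul_left_of_hasCompactSupport hζ hc
  refine this.congr (ae_of_all _ fun x => ?_)
  simp [mul_comm]

lemma continuous_primitive_of_locallyIntegrable {g : ℝ → ℂ} (hg : LocallyIntegrable g volume) :
    Continuous fun x => ∫ s in (0 : ℝ)..x, g s :=
  intervalIntegral.continuous_primitive (intervalIntegrable_of_locallyIntegrable hg) 0

lemma continuous_deriv_test {ζ : ℝ → ℝ} (hζ : ContDiff ℝ ∞ ζ) : Continuous (deriv ζ) :=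
  (contDiff_infty_iff_deriv.1 hζ).2.continuous

lemma integral_primitive_mul_deriv {g : ℝ → ℂ} {ζ : ℝ → ℝ} (hg : LocallyIntegrable g volume)
    (hζ : ContDiff ℝ ∞ ζ) (hc : HasCompactSupport ζ) :
    ∫ x, (∫ s in (0 : ℝ)..x, g s) * ((deriv ζ x : ℝ) : ℂ) = -∫ x, g x * (ζ x : ℂ) := by
  have hI : Integrable (fun x => (∫ s in (0 : ℝ)..x, g s) * ((deriv ζ x : ℝ) : ℂ)) :=
    LocallyIntegrable.mul_test (continuous_primitive_of_locallyIntegrable hg).locallyIntegrable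
      (continuous_deriv_test hζ) hc.deriv
  have hI' := LocallyIntegrable.mul_test hg hζ.continuous hc
  have hi : ∀ x, IntervalIntegrable g volume 0 x := intervalIntegrable_of_locallyIntegrable hg 0
  have hre : LocallyIntegrable (fun x => (g x).re) volume := fun x => by
    obtain ⟨s, hs, h⟩ := hg x
    exact ⟨s, hs, h.re⟩
  have him : LocallyIntegrable (fun x => (g x).im) volume := fun x => by
    obtain ⟨s, hs, h⟩ := hg x
    exact ⟨s, hs, h.im⟩
  have cre : ∀ x, (∫ s in (0 : ℝ)..x, g s).re = ∫ s in (0 : ℝ)..x, (g s).re := fun x =>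
    (Complex.reCLM.intervalIntegral_comp_comm (hi x)).symm
  have cim : ∀ x, (∫ s in (0 : ℝ)..x, g s).im = ∫ s in (0 : ℝ)..x, (g s).im := fun x =>
    (Complex.imCLM.intervalIntegral_comp_comm (hi x)).symm
  have tre : ∀ {F : ℝ → ℂ}, Integrable F → (∫ x, F x).re = ∫ x, (F x).re := fun h =>
    (Complex.reCLM.integral_comp_comm h).symm
  have tim : ∀ {F : ℝ → ℂ}, Integrable F → (∫ x, F x).im = ∫ x, (F x).im := fun h =>
    (Complex.imCLM.integral_comp_comm h).symm
  apply Complex.ext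
  · rw [Complex.neg_re, tre hI, tre hI']
    simp only [Complex.re_mul_ofReal, cre]
    exact integral_primitive_mul_deriv_real hre hζ hc
  · rw [Complex.neg_im, tim hI, tim hI']
    simp only [Complex.im_mul_ofReal, cim]
    exact integral_primitive_mul_deriv_real him hζ hc

/-- A test function of integral zero has a test function as primitive. -/
lemma exists_test_primitive {θ : ℝ → ℝ} (hθ : ContDiff ℝ ∞ θ) (hc : HasCompactSupport θ)
    (h0 : ∫ x, θ x = 0) :
    ∃ ζ : ℝ → ℝ, ContDiff ℝ ∞ ζ ∧ HasCompactSupport ζ ∧ deriv ζ = θ := by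
  obtain ⟨R, hR, hz⟩ := exists_forall_eq_zero_of_hasCompactSupport hc
  have hder : ∀ x, HasDerivAt (fun x => ∫ s in (-R)..x, θ s) (θ x) x := fun x =>
    hθ.continuous.integral_hasStrictDerivAt _ x |>.hasDerivAt
  have hd : deriv (fun x => ∫ s in (-R)..x, θ s) = θ := funext fun x => (hder x).deriv
  refine ⟨fun x => ∫ s in (-R)..x, θ s, ?_, ?_, hd⟩
  · rw [contDiff_infty_iff_deriv, hd]
    exact ⟨fun x => (hder x).differentiableAt, hθ⟩
  · refine HasCompactSupport.intro (isCompact_Icc (a := -R) (b := R)) fun x hx => ?_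
    rw [Set.mem_Icc, not_and_or, not_le, not_le] at hx
    rcases hx with hx | hx
    · refine (intervalIntegral.integral_congr (g := fun _ => 0) fun s hs => ?_).trans (by simp)
      rw [Set.uIcc_of_ge hx.le] at hs
      exact hz s (by rw [le_abs]; right; linarith [hs.2])
    · rw [← h0]
      refine intervalIntegral.integral_eq_integral_of_support_subset fun s hs => ?_
      have := support_subset_Ioc_of_abs hz hs
      exact ⟨this.1, this.2.trans hx.le⟩

/-- The lemma of du Bois-Reymond. -/
lemma ae_eq_const_of_integral_mul_deriv_eq_zero {h : ℝ → ℂ} (hh : LocallyIntegrable h volume)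
    (H : ∀ ζ : ℝ → ℝ, ContDiff ℝ ∞ ζ → HasCompactSupport ζ →
      ∫ x, h x * ((deriv ζ x : ℝ) : ℂ) = 0) :
    ∃ c : ℂ, ∀ᵐ x, h x = c := by
  let b : ContDiffBump (0 : ℝ) := ⟨1, 2, by norm_num, by norm_num⟩
  let ρ : ℝ → ℝ := b.normed volume
  have hρ : ContDiff ℝ ∞ ρ := b.contDiff_normed
  have hρc : HasCompactSupport ρ := b.hasCompactSupport_normed
  have hρ1 : ∫ x, ρ x = 1 := b.integral_normed
  refine ⟨∫ x, h x * (ρ x : ℂ), ?_⟩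
  set c := ∫ x, h x * (ρ x : ℂ) with hcdef
  have hloc : LocallyIntegrable (fun x => h x - c) volume := hh.sub (locallyIntegrable_const c)
  have := ae_eq_zero_of_integral_contDiff_smul_eq_zero hloc (fun η hη hηc => ?_)
  · filter_upwards [this] with x hx using sub_eq_zero.1 hx
  -- For an arbitrary test function η, the function η - mρ has integral zero and so is some ζ'. The
  -- hypothesis at ζ reads ∫ hη = m ∫ hρ = mc.
  set m := ∫ x, η x with hm
  have hθ : ContDiff ℝ ∞ (fun x => η x - m * ρ x) := hη.sub (contDiff_const.mul hρ)
  have hθc : HasCompactSupport (fun x => η x - m * ρ x) := hηc.sub (hρc.mul_left)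
  have iη : Integrable η := hη.continuous.integrable_of_hasCompactSupport hηc
  have iρ : Integrable ρ := hρ.continuous.integrable_of_hasCompactSupport hρc
  have hθ0 : ∫ x, (η x - m * ρ x) = 0 := by
    rw [integral_sub iη (iρ.const_mul m), integral_const_mul, hρ1, mul_one, sub_self]
  obtain ⟨ζ, hζ, hζc, hζd⟩ := exists_test_primitive hθ hθc hθ0
  have h1 := H ζ hζ hζc
  rw [hζd] at h1
  have i1 := LocallyIntegrable.mul_test hh hη.continuous hηc
  have i2 := LocallyIntegrable.mul_test hh hρ.continuous hρc
  have h2 : ∫ x, h x * (((η x - m * ρ x : ℝ)) : ℂ) = (∫ x, h x * (η x : ℂ)) - m * c := by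
    rw [hcdef, ← integral_const_mul, ← integral_sub i1 (i2.const_mul _)]
    congr 1; ext x; push_cast; ring
  have h3 : ∫ x, η x • (h x - c) = (∫ x, h x * (η x : ℂ)) - m * c := by
    have iη' : Integrable (fun x => (η x : ℂ) * c) := iη.ofReal.mul_const c
    rw [hm, ← integral_complex_ofReal, ← integral_mul_const, ← integral_sub i1 iη']
    congr 1; ext x; simp only [Complex.real_smul]; ring
  rw [h3, ← h2, h1]

/-- f and the primitive of g have the same weak derivative, so du Bois-Reymond applies to their
difference. -/
lemma IsWeakDeriv.ae_eq_primitive {f g : ℝ → ℂ} (h : IsWeakDeriv f g) :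
    ∃ c : ℂ, ∀ᵐ x, f x = c + ∫ s in (0 : ℝ)..x, g s := by
  obtain ⟨hf, hg, H⟩ := h
  have hG := continuous_primitive_of_locallyIntegrable hg
  obtain ⟨c, hc⟩ := ae_eq_const_of_integral_mul_deriv_eq_zero
    (h := fun x => f x - ∫ s in (0 : ℝ)..x, g s) (hf.sub hG.locallyIntegrable)
    (fun ζ hζ hζc => by
      have i1 := LocallyIntegrable.mul_test hf (continuous_deriv_test hζ) hζc.deriv
      have i2 := LocallyIntegrable.mul_test hG.locallyIntegrable (continuous_deriv_test hζ) hζc.deriv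
      simp only [sub_mul]
      rw [integral_sub i1 i2, H ζ hζ hζc, integral_primitive_mul_deriv hg hζ hζc, sub_self])
  exact ⟨c, by filter_upwards [hc] with x hx; rw [← hx]; ring⟩

lemma IsWeakDeriv.congr_left {f f' g : ℝ → ℂ} (h : IsWeakDeriv f g) (hf : f =ᵐ[volume] f') :
    IsWeakDeriv f' g := by
  refine ⟨fun x => ?_, h.2.1, fun ζ hζ hc => ?_⟩
  · obtain ⟨s, hs, hi⟩ := h.1 x
    exact ⟨s, hs, hi.congr_fun_ae (ae_restrict_of_ae hf)⟩
  · rw [← h.2.2 ζ hζ hc]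
    refine integral_congr_ae ?_
    filter_upwards [hf] with x hx using by rw [hx]

lemma IsWeakDeriv.sub_eq_integral {f g : ℝ → ℂ} (h : IsWeakDeriv f g) (hf : Continuous f)
    (x y : ℝ) : f y - f x = ∫ s in x..y, g s := by
  obtain ⟨c, hc⟩ := h.ae_eq_primitive
  have hG := continuous_primitive_of_locallyIntegrable h.2.1
  have heq : f = fun x => c + ∫ s in (0 : ℝ)..x, g s :=
    Continuous.ae_eq_iff_eq volume hf (continuous_const.add hG) |>.1 hc
  rw [heq]
  simp only
  rw [add_sub_add_left_eq_sub]
  exact intervalIntegral.integral_interval_sub_left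
    (intervalIntegrable_of_locallyIntegrable h.2.1 _ _)
    (intervalIntegrable_of_locallyIntegrable h.2.1 _ _)

lemma IsWeakDeriv.exists_continuous {f g : ℝ → ℂ} (h : IsWeakDeriv f g) :
    ∃ f' : ℝ → ℂ, Continuous f' ∧ f =ᵐ[volume] f' := by
  obtain ⟨c, hc⟩ := h.ae_eq_primitive
  exact ⟨_, continuous_const.add (continuous_primitive_of_locallyIntegrable h.2.1), hc⟩

lemma IsWeakDeriv.hasDerivAt {f g g' : ℝ → ℂ} (h : IsWeakDeriv f g) (hf : Continuous f)
    (hg : Continuous g') (hgg : g =ᵐ[volume] g') (x : ℝ) : HasDerivAt f (g' x) x := by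
  have heq : f = fun y => f 0 + ∫ s in (0 : ℝ)..y, g' s := by
    ext y
    rw [← intervalIntegral.integral_congr_ae (f := g) (hgg.mono fun x hx _ => hx),
      ← h.sub_eq_integral hf]
    ring
  rw [heq]
  exact (hg.integral_hasStrictDerivAt 0 x).hasDerivAt.const_add _

lemma isWeakDeriv_of_hasDerivAt {f g : ℝ → ℂ} (h : ∀ x, HasDerivAt f (g x) x)
    (hg : Continuous g) : IsWeakDeriv f g := by
  have hf : Continuous f := continuous_iff_continuousAt.2 fun x => (h x).continuousAt
  refine ⟨hf.locallyIntegrable, hg.locallyIntegrable, fun ζ hζ hc => ?_⟩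
  refine integral_mul_deriv_eq_deriv_mul_of_integrable (u := f) (u' := g)
    (v := fun x => (ζ x : ℂ)) (v' := fun x => ((deriv ζ x : ℝ) : ℂ)) (fun x _ => h x)
    (fun x _ => ((hζ.differentiable (by simp)) x).hasDerivAt.ofReal_comp) ?_ ?_ ?_
  · exact LocallyIntegrable.mul_test hf.locallyIntegrable (continuous_deriv_test hζ) hc.deriv
  · exact LocallyIntegrable.mul_test hg.locallyIntegrable hζ.continuous hc
  · exact LocallyIntegrable.mul_test hf.locallyIntegrable hζ.continuous hc

lemma IsWeakDeriv.sub {f g f' g' : ℝ → ℂ} (h : IsWeakDeriv f g) (h' : IsWeakDeriv f' g') :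
    IsWeakDeriv (f - f') (g - g') := by
  refine ⟨h.1.sub h'.1, h.2.1.sub h'.2.1, fun ζ hζ hc => ?_⟩
  simp only [Pi.sub_apply, sub_mul]
  rw [integral_sub (LocallyIntegrable.mul_test h.1 (continuous_deriv_test hζ) hc.deriv)
      (LocallyIntegrable.mul_test h'.1 (continuous_deriv_test hζ) hc.deriv),
    integral_sub (LocallyIntegrable.mul_test h.2.1 hζ.continuous hc)
      (LocallyIntegrable.mul_test h'.2.1 hζ.continuous hc), h.2.2 ζ hζ hc, h'.2.2 ζ hζ hc]
  ring

lemma IsWeakDeriv.neg {f g : ℝ → ℂ} (h : IsWeakDeriv f g) : IsWeakDeriv (-f) (-g) := by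
  have h0 : IsWeakDeriv (0 : ℝ → ℂ) 0 :=
    isWeakDeriv_of_hasDerivAt (fun x => hasDerivAt_const x (0 : ℂ)) continuous_const
  simpa using h0.sub h

/-! ### Pointwise bounds for functions with one weak derivative -/

/-- The local form of the embedding `H¹ ⊂ L^∞`. -/
lemma enorm_le_of_sub_eq_integral {f g : ℝ → ℂ} (hf : Continuous f)
    (hg : AEStronglyMeasurable g volume)
    (h : ∀ x y, f y - f x = ∫ s in x..y, g s) (x : ℝ) :
    ‖f x‖ₑ ≤ eLpNorm f 2 (volume.restrict (Set.Ioc x (x + 1)))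
      + eLpNorm g 2 (volume.restrict (Set.Ioc x (x + 1))) := by
  set μ := volume.restrict (Set.Ioc x (x + 1)) with hμ
  have hμ1 : μ Set.univ = 1 := by simp [hμ]
  -- A window of length one has mass one, so averaging over it costs no constant and L¹ norms are
  -- bounded by L² norms.
  have : IsProbabilityMeasure μ := ⟨hμ1⟩
  have h1 : ∀ y ∈ Set.Ioc x (x + 1), ‖f x‖ₑ ≤ ‖f y‖ₑ + eLpNorm g 1 μ := by
    intro y hy
    have : f x = f y - ∫ s in x..y, g s := by rw [← h x y]; ring
    rw [this]
    refine (enorm_sub_le).trans ?_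
    gcongr
    rw [intervalIntegral.integral_of_le hy.1.le, eLpNorm_one_eq_lintegral_enorm]
    refine (enorm_integral_le_lintegral_enorm _).trans ?_
    exact lintegral_mono' (Measure.restrict_mono (Set.Ioc_subset_Ioc_right hy.2) le_rfl) le_rfl
  have h2 : ‖f x‖ₑ ≤ eLpNorm f 1 μ + eLpNorm g 1 μ := by
    calc ‖f x‖ₑ = ∫⁻ _, ‖f x‖ₑ ∂μ := by simp
      _ ≤ ∫⁻ y, (‖f y‖ₑ + eLpNorm g 1 μ) ∂μ := by
          refine lintegral_mono_ae ?_
          exact (ae_restrict_iff' measurableSet_Ioc).2 (ae_of_all _ h1)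
      _ = _ := by
          rw [lintegral_add_right _ measurable_const, eLpNorm_one_eq_lintegral_enorm (f := f)]
          simp
  refine h2.trans (add_le_add ?_ ?_)
  · exact eLpNorm_le_eLpNorm_of_exponent_le (by norm_num) hf.aestronglyMeasurable
  · exact eLpNorm_le_eLpNorm_of_exponent_le (by norm_num) hg.restrict

lemma enorm_le_eLpNorm_add {f g : ℝ → ℂ} (hf : Continuous f)
    (hg : AEStronglyMeasurable g volume)
    (h : ∀ x y, f y - f x = ∫ s in x..y, g s) (x : ℝ) :
    ‖f x‖ₑ ≤ eLpNorm f 2 volume + eLpNorm g 2 volume :=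
  (enorm_le_of_sub_eq_integral hf hg h x).trans
    (add_le_add (eLpNorm_restrict_le _ _ _ _) (eLpNorm_restrict_le _ _ _ _))

/-- Dominated convergence: each fixed point eventually lies outside the moving window. -/
lemma tendsto_eLpNorm_restrict_Ioc {f : ℝ → ℂ} (hf : MemLp f 2 volume) :
    Tendsto (fun x : ℝ => eLpNorm f 2 (volume.restrict (Set.Ioc x (x + 1)))) (cocompact ℝ)
      (𝓝 0) := by
  have hfin : ∫⁻ y, ‖f y‖ₑ ^ 2 ≠ ⊤ := by
    have := hf.2
    rw [eLpNorm_lt_top_iff_lintegral_rpow_enorm_lt_top (by norm_num) (by norm_num)] at this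
    simpa using this.ne
  have key : Tendsto (fun x : ℝ => ∫⁻ y in Set.Ioc x (x + 1), ‖f y‖ₑ ^ 2) (cocompact ℝ) (𝓝 0) := by
    have hm : AEMeasurable (fun y => ‖f y‖ₑ ^ 2) volume := hf.1.enorm.pow_const 2
    simp_rw [← lintegral_indicator measurableSet_Ioc]
    have : (0 : ENNReal) = ∫⁻ _ : ℝ, 0 := by simp
    rw [this]
    have : (cocompact ℝ).IsCountablyGenerated := by
      rw [cocompact_eq_atBot_atTop]; infer_instance
    refine tendsto_lintegral_filter_of_dominated_convergence' (fun y => ‖f y‖ₑ ^ 2)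
      (Eventually.of_forall fun x => hm.indicator measurableSet_Ioc)
      (Eventually.of_forall fun x => ae_of_all _ fun y => ?_) hfin (ae_of_all _ fun y => ?_)
    · exact Set.indicator_le_self _ _ _
    · refine tendsto_const_nhds.congr' ?_
      have : (Metric.closedBall y 2)ᶜ ∈ cocompact ℝ := (isCompact_closedBall y 2).compl_mem_cocompact
      filter_upwards [this] with x hx
      rw [Set.indicator_of_notMem]
      intro hy
      apply hx
      rw [Metric.mem_closedBall, Real.dist_eq, abs_le]
      constructor <;> linarith [hy.1, hy.2]
  have : ∀ x : ℝ, eLpNorm f 2 (volume.restrict (Set.Ioc x (x + 1)))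
      = (∫⁻ y in Set.Ioc x (x + 1), ‖f y‖ₑ ^ 2) ^ (1 / 2 : ℝ) := by
    intro x
    rw [eLpNorm_eq_lintegral_rpow_enorm_toReal (by norm_num) (by norm_num)]
    simp
  simp_rw [this]
  have h2 := (ENNReal.continuous_rpow_const (y := (1 / 2 : ℝ))).tendsto 0
  rw [ENNReal.zero_rpow_of_pos (by norm_num)] at h2
  exact h2.comp key

lemma tendsto_cocompact_zero_of_memLp {f g : ℝ → ℂ} (hf : Continuous f)
    (h : ∀ x y, f y - f x = ∫ s in x..y, g s) (hf2 : MemLp f 2 volume) (hg2 : MemLp g 2 volume) :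
    Tendsto f (cocompact ℝ) (𝓝 0) := by
  rw [tendsto_zero_iff_enorm_tendsto_zero]
  have h0 := (tendsto_eLpNorm_restrict_Ioc hf2).add (tendsto_eLpNorm_restrict_Ioc hg2)
  rw [add_zero] at h0
  exact tendsto_of_tendsto_of_tendsto_of_le_of_le tendsto_const_nhds h0 (fun _ => zero_le)
    (enorm_le_of_sub_eq_integral hf hg2.1 h)

/-! ### Curves in `C₀(ℝ)` and in `L²(ℝ)` -/

/-- `t ↦ f t` is a continuous curve in `C₀(ℝ)`. -/
structure ContinuousInC0 (f : ℝ → ℝ → ℂ) : Prop where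
  continuous : ∀ t, Continuous (f t)
  tendsto_zero : ∀ t, Tendsto (f t) (cocompact ℝ) (𝓝 0)
  uniform : ∀ t₀, TendstoUniformly f (f t₀) (𝓝 t₀)

/-- `t ↦ f t` is a continuous curve in `L²(ℝ)`. -/
structure ContinuousInL2 (f : ℝ → ℝ → ℂ) : Prop where
  memLp : ∀ t, MemLp (f t) 2 volume
  tendsto : ∀ t₀, Tendsto (fun t => eLpNorm (f t - f t₀) 2 volume) (𝓝 t₀) (𝓝 0)

namespace ContinuousInC0

variable {f : ℝ → ℝ → ℂ}

lemma continuous_uncurry (hf : ContinuousInC0 f) : Continuous (Function.uncurry f) := by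
  rw [continuous_iff_continuousAt]
  rintro ⟨t, x⟩
  rw [Metric.continuousAt_iff']
  intro ε hε
  have h1 := Metric.tendstoUniformly_iff.1 (hf.uniform t) (ε / 2) (half_pos hε)
  have h2 := Metric.continuousAt_iff'.1 ((hf.continuous t).continuousAt (x := x)) (ε / 2)
    (half_pos hε)
  rw [nhds_prod_eq]
  filter_upwards [h1.prod_mk h2] with p hp
  calc dist (Function.uncurry f p) (f t x)
      ≤ dist (f p.1 p.2) (f t p.2) + dist (f t p.2) (f t x) := dist_triangle _ _ _
    _ < ε := by
      have := hp.1 p.2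
      rw [dist_comm] at this
      linarith [hp.2]

lemma exists_bound_time (hf : ContinuousInC0 f) (t : ℝ) : ∃ K, ∀ x, ‖f t x‖ ≤ K := by
  have h := (hf.tendsto_zero t).norm
  rw [norm_zero] at h
  have h1 : {x | ‖f t x‖ < 1} ∈ cocompact ℝ := h.eventually (gt_mem_nhds one_pos)
  obtain ⟨S, hS, hSc⟩ := mem_cocompact.1 h1
  obtain ⟨K, hK⟩ := hS.exists_bound_of_continuousOn (hf.continuous t).continuousOn
  refine ⟨max K 1, fun x => ?_⟩
  by_cases hx : x ∈ S
  · exact (hK x hx).trans (le_max_left _ _)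
  · exact (hSc hx : ‖f t x‖ < 1).le.trans (le_max_right _ _)

/-- Uniform continuity in x makes a bound at one time hold at nearby times; compactness of [-T, T]
does the rest. The next lemma uses the same argument for the decay in x. -/
lemma exists_bound (hf : ContinuousInC0 f) (T : ℝ) :
    ∃ K, 0 ≤ K ∧ ∀ t, |t| ≤ T → ∀ x, ‖f t x‖ ≤ K := by
  have key : ∃ K, 0 ≤ K ∧ ∀ t ∈ Set.Icc (-T) T, ∀ x, ‖f t x‖ ≤ K := by
    refine (isCompact_Icc (a := -T) (b := T)).induction_on
      (p := fun s => ∃ K, 0 ≤ K ∧ ∀ t ∈ s, ∀ x, ‖f t x‖ ≤ K) ⟨0, le_rfl, by simp⟩ ?_ ?_ ?_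
    · rintro s s' hss ⟨K, h0, hK⟩
      exact ⟨K, h0, fun t ht => hK t (hss ht)⟩
    · rintro s s' ⟨K, h0, hK⟩ ⟨K', h0', hK'⟩
      refine ⟨max K K', h0.trans (le_max_left _ _), ?_⟩
      rintro t (ht | ht) x
      · exact (hK t ht x).trans (le_max_left _ _)
      · exact (hK' t ht x).trans (le_max_right _ _)
    · intro t _
      obtain ⟨K, hK⟩ := hf.exists_bound_time t
      refine ⟨_, mem_nhdsWithin_of_mem_nhds
        (Metric.tendstoUniformly_iff.1 (hf.uniform t) 1 one_pos), K + 1, ?_, ?_⟩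
      · linarith [(norm_nonneg _).trans (hK 0)]
      · intro s hs x
        have h1 := hs x
        rw [dist_comm, dist_eq_norm] at h1
        have h2 := norm_le_norm_add_norm_sub' (f s x) (f t x)
        linarith [hK x]
  obtain ⟨K, h0, hK⟩ := key
  exact ⟨K, h0, fun t ht => hK t (abs_le.1 ht)⟩

lemma exists_forall_norm_le (hf : ContinuousInC0 f) (T : ℝ) {ε : ℝ} (hε : 0 < ε) :
    ∃ R, ∀ t, |t| ≤ T → ∀ x, R ≤ |x| → ‖f t x‖ ≤ ε := by
  have key : ∃ R, ∀ t ∈ Set.Icc (-T) T, ∀ x, R ≤ |x| → ‖f t x‖ ≤ ε := by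
    refine (isCompact_Icc (a := -T) (b := T)).induction_on
      (p := fun s => ∃ R, ∀ t ∈ s, ∀ x, R ≤ |x| → ‖f t x‖ ≤ ε) ⟨0, by simp⟩ ?_ ?_ ?_
    · rintro s s' hss ⟨R, hR⟩
      exact ⟨R, fun t ht => hR t (hss ht)⟩
    · rintro s s' ⟨R, hR⟩ ⟨R', hR'⟩
      refine ⟨max R R', ?_⟩
      rintro t (ht | ht) x hx
      · exact hR t ht x ((le_max_left _ _).trans hx)
      · exact hR' t ht x ((le_max_right _ _).trans hx)
    · intro t _
      have h := (hf.tendsto_zero t).norm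
      rw [norm_zero] at h
      have h1 : ∀ᶠ x in cocompact ℝ, ‖f t x‖ < ε / 2 := h.eventually (gt_mem_nhds (half_pos hε))
      rw [← Metric.cobounded_eq_cocompact, ← comap_norm_atTop, eventually_comap] at h1
      obtain ⟨R, hR⟩ := eventually_atTop.1 h1
      refine ⟨_, mem_nhdsWithin_of_mem_nhds
        (Metric.tendstoUniformly_iff.1 (hf.uniform t) (ε / 2) (half_pos hε)), R, ?_⟩
      intro s hs x hx
      have h1 := hs x
      rw [dist_comm, dist_eq_norm] at h1
      have h2 := norm_le_norm_add_norm_sub' (f s x) (f t x)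
      have h3 := hR |x| hx x rfl
      linarith
  obtain ⟨R, hR⟩ := key
  exact ⟨R, fun t ht => hR t (abs_le.1 ht)⟩

/-- A curve in `H¹(ℝ)` is a curve in `C₀(ℝ)`. -/
lemma of_continuousInL2 {g : ℝ → ℝ → ℂ} (hf : ContinuousInL2 f) (hg : ContinuousInL2 g)
    (hc : ∀ t, Continuous (f t)) (h : ∀ t x y, f t y - f t x = ∫ s in x..y, g t s) :
    ContinuousInC0 f := by
  refine ⟨hc, fun t => tendsto_cocompact_zero_of_memLp (hc t) (h t) (hf.memLp t) (hg.memLp t),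
    fun t₀ => ?_⟩
  rw [Metric.tendstoUniformly_iff]
  intro ε hε
  have h0 := (hf.tendsto t₀).add (hg.tendsto t₀)
  rw [add_zero] at h0
  have h1 : ∀ᶠ t in 𝓝 t₀, eLpNorm (f t - f t₀) 2 volume + eLpNorm (g t - g t₀) 2 volume
      < ENNReal.ofReal ε := h0.eventually (gt_mem_nhds (by simpa using hε))
  filter_upwards [h1] with t ht x
  have hi : ∀ t, LocallyIntegrable (g t) volume := fun t =>
    (hg.memLp t).locallyIntegrable (by norm_num)
  have h2 := enorm_le_eLpNorm_add (f := f t - f t₀) (g := g t - g t₀) ((hc t).sub (hc t₀))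
    ((hg.memLp t).1.sub (hg.memLp t₀).1) (fun x y => by
      simp only [Pi.sub_apply]
      rw [intervalIntegral.integral_sub (intervalIntegrable_of_locallyIntegrable (hi t) _ _)
        (intervalIntegrable_of_locallyIntegrable (hi t₀) _ _), ← h, ← h]
      ring) x
  have h3 := h2.trans_lt ht
  rw [← ofReal_norm, ENNReal.ofReal_lt_ofReal_iff hε] at h3
  rwa [dist_comm, dist_eq_norm]

end ContinuousInC0

/-! ### Classical regularity of solutions -/

/-- A solution `q` of the cubic equation, with its derivatives `q'` and `q''` in `x`, that is a
continuous curve in `C₀ ∩ L²` together with these derivatives. -/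
structure RegularSolution (q q' q'' : ℝ → ℝ → ℂ) : Prop where
  hasDerivAt : ∀ t x, HasDerivAt (q t) (q' t x) x
  hasDerivAt' : ∀ t x, HasDerivAt (q' t) (q'' t x) x
  c0 : ContinuousInC0 q
  c0' : ContinuousInC0 q'
  c0'' : ContinuousInC0 q''
  l2 : ContinuousInL2 q
  l2' : ContinuousInL2 q'
  l2'' : ContinuousInL2 q''
  time : ∀ t x, HasDerivAt (fun s => q s x)
    (Complex.I * (q'' t x + 2 * (‖q t x‖ : ℂ) ^ 2 * q t x)) t

lemma ContinuousInL2.congr {f g : ℝ → ℝ → ℂ} (hf : ContinuousInL2 f)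
    (h : ∀ t, f t =ᵐ[volume] g t) : ContinuousInL2 g := by
  refine ⟨fun t => (hf.memLp t).ae_eq (h t), fun t₀ => (hf.tendsto t₀).congr fun t => ?_⟩
  exact eLpNorm_congr_ae ((h t).sub (h t₀))

/-- The first two weak derivatives have continuous representatives, which are then classical
derivatives and lie in C₀ by the embedding of H¹. The third remains a weak derivative and is needed
only for the H³ regularity of the transform. -/
lemma IsH3SolutionNLS.exists_regularSolution {q : ℝ → ℝ → ℂ} (hq : IsH3SolutionNLS q) :
    ∃ q' q'' q₃ : ℝ → ℝ → ℂ, RegularSolution q q' q'' ∧ ContinuousInL2 q₃ ∧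
      ∀ t, IsWeakDeriv (q'' t) (q₃ t) := by
  obtain ⟨hc, D, rfl, hw, hm, ht⟩ := hq.continuousInSobolev
  have e1 : ∀ t, ∃ f', Continuous f' ∧ D 1 t =ᵐ[volume] f' := fun t =>
    (hw 1 (by norm_num) t).exists_continuous
  have e2 : ∀ t, ∃ f', Continuous f' ∧ D 2 t =ᵐ[volume] f' := fun t =>
    (hw 2 (by norm_num) t).exists_continuous
  choose q' hq'c hq' using e1
  choose q'' hq''c hq'' using e2
  have hD : ∀ k ≤ 3, ContinuousInL2 (D k) := fun k hk => ⟨hm k hk, ht k hk⟩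
  have w0 := hw 0 (by norm_num)
  have w1 := fun t => (hw 1 (by norm_num) t).congr_left (hq' t)
  have w2 := fun t => (hw 2 (by norm_num) t).congr_left (hq'' t)
  have d0 : ∀ t x, HasDerivAt (D 0 t) (q' t x) x := fun t =>
    (w0 t).hasDerivAt (hc t) (hq'c t) (hq' t)
  have d1 : ∀ t x, HasDerivAt (q' t) (q'' t x) x := fun t =>
    (w1 t).hasDerivAt (hq'c t) (hq''c t) (hq'' t)
  have l0 := hD 0 (by norm_num)
  have l1 := (hD 1 (by norm_num)).congr hq'
  have l2 := (hD 2 (by norm_num)).congr hq''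
  have l3 := hD 3 le_rfl
  have hd : ∀ t, deriv (D 0 t) = q' t := fun t => funext fun x => (d0 t x).deriv
  refine ⟨q', q'', D 3, ⟨d0, d1, ?_, ?_, ?_, l0, l1, l2, fun t x => ?_⟩, l3, w2⟩
  · exact .of_continuousInL2 l0 (hD 1 (by norm_num)) hc fun t x y => (w0 t).sub_eq_integral (hc t) x y
  · exact .of_continuousInL2 l1 (hD 2 (by norm_num)) hq'c fun t x y =>
      (w1 t).sub_eq_integral (hq'c t) x y
  · exact .of_continuousInL2 l2 l3 hq''c fun t x y => (w2 t).sub_eq_integral (hq''c t) x y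
  · have h := hq.equation t x
    rw [hd, (d1 t x).deriv] at h
    have h' : deriv (fun s => D 0 s x) t
        = Complex.I * (q'' t x + 2 * (‖D 0 t x‖ : ℂ) ^ 2 * D 0 t x) := by
      linear_combination (-Complex.I) * h + (deriv (fun s => D 0 s x) t) * Complex.I_sq
    rw [← h']
    exact (hq.differentiableAt_time t x).hasDerivAt

/-! ### Conservation of mass -/

lemma integrable_normSq {f : ℝ → ℂ} (hf : MemLp f 2 volume) :
    Integrable (fun x => ‖f x‖ ^ 2) volume := hf.integrable_norm_pow (by norm_num)

lemma hasDerivAt_conj {f : ℝ → ℂ} {f' : ℂ} {x : ℝ} (h : HasDerivAt f f' x) :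
    HasDerivAt (fun y => conj (f y)) (conj f') x := h.star

lemma mul_conj_eq_norm (z : ℂ) : z * conj z = (‖z‖ : ℂ) ^ 2 := Complex.mul_conj' z

namespace RegularSolution

variable {q q' q'' : ℝ → ℝ → ℂ}

/-- The cubic term cancels in the time derivative of |q|², and i(q''q̄ - q q̄'') is the x-derivative
of the flux i(q'q̄ - q q̄'); only boundary values survive. -/
lemma hasDerivAt_integral_normSq (hq : RegularSolution q q' q'') (R t : ℝ) :
    HasDerivAt (fun s => ∫ x in (-R)..R, q s x * conj (q s x))
      (Complex.I * ((q' t R * conj (q t R) - q t R * conj (q' t R))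
        - (q' t (-R) * conj (q t (-R)) - q t (-R) * conj (q' t (-R))))) t := by
  obtain ⟨K, hK0, hK⟩ := hq.c0.exists_bound (|t| + 1)
  obtain ⟨K', hK0', hK'⟩ := hq.c0''.exists_bound (|t| + 1)
  have hc := fun s => hq.c0.continuous s
  have hc'' := fun s => hq.c0''.continuous s
  have hcc : ∀ s, Continuous fun x => conj (q s x) := fun s => Complex.continuous_conj.comp (hc s)
  have hcc'' : ∀ s, Continuous fun x => conj (q'' s x) := fun s =>
    Complex.continuous_conj.comp (hc'' s)
  have hF : ∀ s, Continuous fun x => q s x * conj (q s x) := fun s => (hc s).mul (hcc s)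
  have hF' : ∀ s, Continuous fun x =>
      Complex.I * (q'' s x * conj (q s x) - q s x * conj (q'' s x)) := fun s =>
    continuous_const.mul (((hc'' s).mul (hcc s)).sub ((hc s).mul (hcc'' s)))
  have h := (intervalIntegral.hasDerivAt_integral_of_dominated_loc_of_deriv_le (a := -R) (b := R)
    (μ := volume) (F := fun s x => q s x * conj (q s x))
    (F' := fun s x => Complex.I * (q'' s x * conj (q s x) - q s x * conj (q'' s x)))
    (bound := fun _ => K' * K + K * K') (x₀ := t) (Metric.ball_mem_nhds t one_pos)
    (Eventually.of_forall fun s => (hF s).aestronglyMeasurable) ((hF t).intervalIntegrable _ _)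
    (hF' t).aestronglyMeasurable ?_ intervalIntegrable_const ?_).2
  · refine h.congr_deriv ?_
    rw [intervalIntegral.integral_const_mul]
    congr 1
    refine (intervalIntegral.integral_eq_sub_of_hasDerivAt
      (f := fun x => q' t x * conj (q t x) - q t x * conj (q' t x)) (fun x _ => ?_)
      ((((hc'' t).mul (hcc t)).sub ((hc t).mul (hcc'' t))).intervalIntegrable _ _))
    have h1 := hq.hasDerivAt t x
    have h2 := hq.hasDerivAt' t x
    refine ((h2.mul (hasDerivAt_conj h1)).sub (h1.mul (hasDerivAt_conj h2))).congr_deriv ?_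
    ring
  · refine ae_of_all _ fun x _ s hs => ?_
    have hs' : |s| ≤ |t| + 1 := by
      rw [Metric.mem_ball, Real.dist_eq] at hs
      have := abs_sub_abs_le_abs_sub s t
      linarith
    rw [norm_mul, Complex.norm_I, one_mul]
    refine (norm_sub_le _ _).trans ?_
    rw [norm_mul, norm_mul, RCLike.norm_conj, RCLike.norm_conj]
    have := hK s hs' x
    have := hK' s hs' x
    gcongr
  · refine ae_of_all _ fun x _ s _ => ?_
    have h1 := hq.time s x
    refine (h1.mul (hasDerivAt_conj h1)).congr_deriv ?_
    simp only [map_mul, map_add, Complex.conj_I, Complex.conj_ofReal, map_pow,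
      map_ofNat]
    ring

lemma integral_normSq_eq (hq : RegularSolution q q' q'') (t : ℝ) :
    ∫ x, ‖q t x‖ ^ 2 = ∫ x, ‖q 0 x‖ ^ 2 := by
  have hint : ∀ t, Integrable (fun x => q t x * conj (q t x)) := fun t => by
    simp only [mul_conj_eq_norm]
    exact_mod_cast (integrable_normSq (hq.l2.memLp t)).ofReal
  have hval : ∀ t, ∫ x, q t x * conj (q t x) = ((∫ x, ‖q t x‖ ^ 2 : ℝ) : ℂ) := fun t => by
    rw [← integral_complex_ofReal]
    simp only [mul_conj_eq_norm, Complex.ofReal_pow]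
  have hlim : ∀ t, Tendsto (fun R : ℝ => ∫ x in (-R)..R, q t x * conj (q t x)) atTop
      (𝓝 (∫ x, q t x * conj (q t x))) := fun t =>
    intervalIntegral_tendsto_integral (hint t) tendsto_neg_atTop_atBot tendsto_id
  -- Far out, |q| and |q'| are at most ε for all times up to |t|. The flux has two products at each
  -- of two endpoints, whence 4ε².
  have hdiff : ∀ ε > 0, ‖(∫ x, q t x * conj (q t x)) - ∫ x, q 0 x * conj (q 0 x)‖
      ≤ 4 * ε ^ 2 * |t| := by
    intro ε hε
    obtain ⟨R, hR⟩ := hq.c0.exists_forall_norm_le |t| hε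
    obtain ⟨R', hR'⟩ := hq.c0'.exists_forall_norm_le |t| hε
    refine le_of_tendsto ((hlim t).sub (hlim 0)).norm ?_
    filter_upwards [eventually_ge_atTop R, eventually_ge_atTop R'] with r hr hr'
    have hmvt := (convex_uIcc 0 t).norm_image_sub_le_of_norm_hasDerivWithin_le
      (f := fun s => ∫ x in (-r)..r, q s x * conj (q s x)) (C := 4 * ε ^ 2)
      (fun s _ => (hq.hasDerivAt_integral_normSq r s).hasDerivWithinAt) (fun s hs => ?_)
      Set.left_mem_uIcc Set.right_mem_uIcc
    · rwa [Real.norm_eq_abs, sub_zero] at hmvt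
    · have hs' : |s| ≤ |t| := by
        have := Set.abs_sub_left_of_mem_uIcc hs
        simpa using this
      have b : ∀ x, r ≤ |x| → ‖q' s x * conj (q s x) - q s x * conj (q' s x)‖ ≤ 2 * ε ^ 2 := by
        intro x hx
        have h1 := hR s hs' x (hr.trans hx)
        have h2 := hR' s hs' x (hr'.trans hx)
        refine (norm_sub_le _ _).trans ?_
        rw [norm_mul, norm_mul, RCLike.norm_conj, RCLike.norm_conj]
        nlinarith [mul_le_mul h1 h2 (norm_nonneg _) hε.le]
      rw [norm_mul, Complex.norm_I, one_mul]
      refine (norm_sub_le _ _).trans ?_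
      linarith [b r (le_abs_self r), b (-r) (by rw [abs_neg]; exact le_abs_self r)]
  have h0 : ‖(∫ x, q t x * conj (q t x)) - ∫ x, q 0 x * conj (q 0 x)‖ ≤ 0 := by
    have hl : Tendsto (fun ε : ℝ => 4 * ε ^ 2 * |t|) (𝓝[>] 0) (𝓝 (4 * 0 ^ 2 * |t|)) :=
      ((by fun_prop : Continuous fun ε : ℝ => 4 * ε ^ 2 * |t|).tendsto 0).mono_left
        nhdsWithin_le_nhds
    have := ge_of_tendsto hl (eventually_nhdsWithin_of_forall fun ε hε => hdiff ε hε)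
    simpa using this
  have h1 := sub_eq_zero.1 (norm_le_zero_iff.1 h0)
  rw [hval, hval] at h1
  exact_mod_cast h1

end RegularSolution

/-! ### A damped linear system with square integrable coefficient -/

lemma intervalIntegral_norm_mul_norm_le {f g : ℝ → ℂ} (hf : Continuous f) (hg : Continuous g)
    {a b : ℝ} (hab : a ≤ b) :
    ∫ x in a..b, ‖f x‖ * ‖g x‖
      ≤ √(∫ x in a..b, ‖f x‖ ^ 2) * √(∫ x in a..b, ‖g x‖ ^ 2) := by
  have hm : ∀ h : ℝ → ℂ, Continuous h → MemLp (fun x => ‖h x‖) (ENNReal.ofReal 2)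
      (volume.restrict (Set.Ioc a b)) := fun h hh => by
    obtain ⟨C, hC⟩ := (isCompact_Icc (a := a) (b := b)).exists_bound_of_continuousOn hh.continuousOn
    refine MemLp.of_bound hh.norm.aestronglyMeasurable C ?_
    refine (ae_restrict_iff' measurableSet_Ioc).2 (ae_of_all _ fun x hx => ?_)
    rw [norm_norm]
    exact hC x (Set.Ioc_subset_Icc_self hx)
  have := integral_mul_le_Lp_mul_Lq_of_nonneg (μ := volume.restrict (Set.Ioc a b))
    Real.HolderConjugate.two_two (ae_of_all _ fun x => norm_nonneg (f x))
    (ae_of_all _ fun x => norm_nonneg (g x)) (hm f hf) (hm g hg)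
  simp only [intervalIntegral.integral_of_le hab, Real.sqrt_eq_rpow]
  simpa using this

/-- The linear system `m' = r v`, `v' = -r̄ m - v`. -/
structure IsDampedPair (r m v : ℝ → ℂ) : Prop where
  fst : ∀ x, HasDerivAt m (r x * v x) x
  snd : ∀ x, HasDerivAt v (-conj (r x) * m x - v x) x

/-- `r` is continuous and square integrable with norm at most `δ`. -/
structure HasL2Bound (r : ℝ → ℂ) (δ : ℝ) : Prop where
  continuous : Continuous r
  nonneg : 0 ≤ δ
  integrable : Integrable (fun x => ‖r x‖ ^ 2) volume
  integral_le : ∫ x, ‖r x‖ ^ 2 ≤ δ ^ 2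

lemma HasL2Bound.intervalIntegral_le {r : ℝ → ℂ} {δ : ℝ} (h : HasL2Bound r δ) {a b : ℝ}
    (hab : a ≤ b) : ∫ x in a..b, ‖r x‖ ^ 2 ≤ δ ^ 2 := by
  rw [intervalIntegral.integral_of_le hab]
  exact (setIntegral_le_integral h.integrable (ae_of_all _ fun x => by positivity)).trans
    h.integral_le

namespace IsDampedPair

variable {r m v : ℝ → ℂ} {δ : ℝ}

lemma continuous_fst (h : IsDampedPair r m v) : Continuous m :=
  continuous_iff_continuousAt.2 fun x => (h.fst x).continuousAt

lemma continuous_snd (h : IsDampedPair r m v) : Continuous v :=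
  continuous_iff_continuousAt.2 fun x => (h.snd x).continuousAt

/-- Young's inequality 2|v||r|M ≤ |v|² + M²|r|² uses up half of the damping -2|v|²; the other half
bounds the integral of |v|². -/
lemma energy (h : IsDampedPair r m v) (hr : HasL2Bound r δ) {A X M : ℝ} (hAX : A ≤ X)
    (hM : ∀ x, A ≤ x → x ≤ X → ‖m x‖ ≤ M) :
    ∫ x in A..X, ‖v x‖ ^ 2 ≤ ‖v A‖ ^ 2 + M ^ 2 * δ ^ 2 := by
  have hrc := hr.continuous
  have hmc := h.continuous_fst
  have hvc := h.continuous_snd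
  have hM0 : 0 ≤ M := (norm_nonneg _).trans (hM A le_rfl hAX)
  have hcr : Continuous fun x => conj (r x) := Complex.continuous_conj.comp hrc
  have hd : ∀ x, HasDerivAt (fun y => ‖v y‖ ^ 2)
      (2 * inner ℝ (v x) (-conj (r x) * m x - v x)) x := fun x => (h.snd x).norm_sq
  have hdc : Continuous fun x => 2 * inner ℝ (v x) (-conj (r x) * m x - v x) := by fun_prop
  have hftc := intervalIntegral.integral_eq_sub_of_hasDerivAt (a := A) (b := X)
    (fun x _ => hd x) (hdc.intervalIntegrable _ _)
  have hle : ∫ x in A..X, 2 * inner ℝ (v x) (-conj (r x) * m x - v x)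
      ≤ ∫ x in A..X, (M ^ 2 * ‖r x‖ ^ 2 - ‖v x‖ ^ 2) := by
    refine intervalIntegral.integral_mono_on hAX (hdc.intervalIntegrable _ _)
      (Continuous.intervalIntegrable (by fun_prop) _ _) fun x hx => ?_
    rw [inner_sub_right, real_inner_self_eq_norm_sq]
    have h1 : inner ℝ (v x) (-conj (r x) * m x) ≤ ‖v x‖ * (‖r x‖ * M) := by
      refine (real_inner_le_norm _ _).trans ?_
      rw [norm_mul, norm_neg, RCLike.norm_conj]
      have := hM x hx.1 hx.2
      gcongr
    nlinarith [sq_nonneg (‖v x‖ - ‖r x‖ * M)]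
  rw [hftc, intervalIntegral.integral_sub (Continuous.intervalIntegrable (by fun_prop) _ _)
    (Continuous.intervalIntegrable (by fun_prop) _ _), intervalIntegral.integral_const_mul] at hle
  have := mul_le_mul_of_nonneg_left (hr.intervalIntegral_le hAX) (sq_nonneg M)
  nlinarith [sq_nonneg ‖v X‖]

lemma norm_sub_le (h : IsDampedPair r m v) (hr : HasL2Bound r δ) {x X E : ℝ} (hx : x ≤ X)
    (hE : 0 ≤ E) (hv : ∫ y in x..X, ‖v y‖ ^ 2 ≤ E ^ 2) : ‖m X - m x‖ ≤ δ * E := by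
  have hrc := hr.continuous
  have hvc := h.continuous_snd
  rw [← intervalIntegral.integral_eq_sub_of_hasDerivAt (fun y _ => h.fst y)
    ((hrc.mul hvc).intervalIntegrable _ _)]
  refine (intervalIntegral.norm_integral_le_integral_norm hx).trans ?_
  simp only [norm_mul]
  refine (intervalIntegral_norm_mul_norm_le hrc hvc hx).trans ?_
  have h1 : √(∫ y in x..X, ‖r y‖ ^ 2) ≤ δ := Real.sqrt_le_iff.2 ⟨hr.nonneg, hr.intervalIntegral_le hx⟩
  have h2 : √(∫ y in x..X, ‖v y‖ ^ 2) ≤ E := Real.sqrt_le_iff.2 ⟨hE, hv⟩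
  exact mul_le_mul h1 h2 (Real.sqrt_nonneg _) hr.nonneg

lemma intervalIntegral_snd_mono (h : IsDampedPair r m v) {A x X : ℝ} (hA : A ≤ x) (hx : x ≤ X) :
    ∫ y in x..X, ‖v y‖ ^ 2 ≤ ∫ y in A..X, ‖v y‖ ^ 2 := by
  have hvc := h.continuous_snd
  exact intervalIntegral.integral_mono_interval hA hx le_rfl (ae_of_all _ fun y => by positivity)
    (Continuous.intervalIntegrable (by fun_prop) _ _)

/-- m(x) is compared with its limit at +∞ by Cauchy–Schwarz on r v. The energy |v(A)|² + M²δ² is at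
most (|v(A)| + δM)². -/
lemma norm_fst_le_of_bound (h : IsDampedPair r m v) (hr : HasL2Bound r δ) {A M : ℝ} {m₀ : ℂ}
    (hm : Tendsto m atTop (𝓝 m₀)) (hM : ∀ x, A ≤ x → ‖m x‖ ≤ M) (x : ℝ) (hx : A ≤ x) :
    ‖m x‖ ≤ ‖m₀‖ + δ * (‖v A‖ + δ * M) := by
  have hM0 : 0 ≤ M := (norm_nonneg _).trans (hM A le_rfl)
  have hδ := hr.nonneg
  have hev : ∀ᶠ X in atTop, ‖m x‖ ≤ ‖m X‖ + δ * (‖v A‖ + δ * M) := by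
    filter_upwards [eventually_ge_atTop x] with X hX
    have hE := (h.intervalIntegral_snd_mono hx hX).trans
      (h.energy hr (hx.trans hX) fun y hy _ => hM y hy)
    have h1 := h.norm_sub_le hr hX (E := ‖v A‖ + δ * M) (by positivity)
      (hE.trans (by nlinarith [mul_nonneg (norm_nonneg (v A)) (mul_nonneg hδ hM0)]))
    have h2 := norm_le_norm_add_norm_sub (m X) (m x)
    linarith
  exact ge_of_tendsto (hm.norm.add_const _) hev

lemma norm_fst_le (h : IsDampedPair r m v) (hr : HasL2Bound r δ) (hδ : δ ^ 2 ≤ 1 / 2) {m₀ : ℂ}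
    (hm : Tendsto m atTop (𝓝 m₀)) {A x : ℝ} (hx : A ≤ x) :
    ‖m x‖ ≤ 2 * (‖m₀‖ + δ * ‖v A‖) := by
  -- The supremum must be finite before δ²M can be absorbed into it; finiteness comes from the limit
  -- at +∞.
  have hbdd : BddAbove ((fun y => ‖m y‖) '' Set.Ici A) := by
    have h1 : ∀ᶠ y in atTop, ‖m y‖ < ‖m₀‖ + 1 := hm.norm.eventually (gt_mem_nhds (by linarith))
    obtain ⟨B, hB⟩ := eventually_atTop.1 h1
    obtain ⟨C, hC⟩ := (isCompact_Icc (a := A) (b := B)).exists_bound_of_continuousOn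
      h.continuous_fst.continuousOn
    refine ⟨max C (‖m₀‖ + 1), ?_⟩
    rintro _ ⟨y, hy, rfl⟩
    rcases le_total B y with hBy | hBy
    · exact (hB y hBy).le.trans (le_max_right _ _)
    · exact (hC y ⟨hy, hBy⟩).trans (le_max_left _ _)
  set M := sSup ((fun y => ‖m y‖) '' Set.Ici A) with hMdef
  have hM : ∀ y, A ≤ y → ‖m y‖ ≤ M := fun y hy => le_csSup hbdd ⟨y, hy, rfl⟩
  have hM0 : 0 ≤ M := (norm_nonneg _).trans (hM A le_rfl)
  have hle : M ≤ ‖m₀‖ + δ * (‖v A‖ + δ * M) := by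
    refine csSup_le ⟨_, A, Set.mem_Ici.2 le_rfl, rfl⟩ ?_
    rintro _ ⟨y, hy, rfl⟩
    exact h.norm_fst_le_of_bound hr hm hM y hy
  have := hM x hx
  nlinarith

end IsDampedPair

/-! ### Bounds for the Jost functions -/

lemma HasL2Bound.reflect {r : ℝ → ℂ} {δ : ℝ} (h : HasL2Bound r δ) :
    HasL2Bound (fun x => conj (r (-x))) δ := by
  refine ⟨Complex.continuous_conj.comp (h.continuous.comp continuous_neg), h.nonneg, ?_, ?_⟩
  · simp only [RCLike.norm_conj]
    exact h.integrable.comp_neg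
  · simp only [RCLike.norm_conj]
    rw [integral_neg_eq_self (fun x => ‖r x‖ ^ 2)]
    exact h.integral_le

lemma HasL2Bound.neg {r : ℝ → ℂ} {δ : ℝ} (h : HasL2Bound r δ) :
    HasL2Bound (fun x => -r x) δ := by
  refine ⟨h.continuous.neg, h.nonneg, ?_, ?_⟩
  · simpa only [norm_neg] using h.integrable
  · simpa only [norm_neg] using h.integral_le

namespace IsJostPhi

variable {q φ₁ φ₂ : ℝ → ℂ} {δ : ℝ}

lemma isDampedPair (h : IsJostPhi q φ₁ φ₂) : IsDampedPair q φ₁ φ₂ :=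
  ⟨h.hasDerivAt_fst, h.hasDerivAt_snd⟩

/-- After reflection and multiplication by e^{-y} the components change roles: e^{-y}φ₂(-y) is the
undamped one, with limit 0 at +∞, and e^{-y}φ₁(-y) the damped one. The exponential weights cancel in
the resulting bound at a single point. -/
lemma norm_snd_le_fst (h : IsJostPhi q φ₁ φ₂) (hq : HasL2Bound q δ) (hδ : δ ^ 2 ≤ 1 / 2) (x : ℝ) :
    ‖φ₂ x‖ ≤ 2 * (δ * ‖φ₁ x‖) := by
  have he : ∀ y : ℝ, HasDerivAt (fun y : ℝ => (Real.exp (-y) : ℂ)) (-(Real.exp (-y) : ℂ)) y := by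
    intro y
    have := ((hasDerivAt_neg y).exp).ofReal_comp
    simpa using this
  have hpair : IsDampedPair (fun y => conj (q (-y))) (fun y => (Real.exp (-y) : ℂ) * φ₂ (-y))
      (fun y => (Real.exp (-y) : ℂ) * φ₁ (-y)) := by
    constructor
    · intro y
      have h2 := (h.hasDerivAt_snd (-y)).scomp y (hasDerivAt_neg y)
      refine ((he y).mul h2).congr_deriv ?_
      simp only [Function.comp, neg_smul, one_smul]
      ring
    · intro y
      have h1 := (h.hasDerivAt_fst (-y)).scomp y (hasDerivAt_neg y)
      refine ((he y).mul h1).congr_deriv ?_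
      simp only [Function.comp, neg_smul, one_smul, Complex.conj_conj]
      ring
  have hlim : Tendsto (fun y : ℝ => (Real.exp (-y) : ℂ) * φ₂ (-y)) atTop (𝓝 0) :=
    h.tendsto_snd.comp tendsto_neg_atTop_atBot
  have := hpair.norm_fst_le hq.reflect hδ hlim (A := -x) (x := -x) le_rfl
  simp only [neg_neg, norm_mul, norm_zero, zero_add] at this
  have hpos : 0 < ‖(Real.exp x : ℂ)‖ := by simp [Real.exp_pos]
  refine le_of_mul_le_mul_left ?_ hpos
  linarith

/-- The bounds from the right and from the left meet at the same point: |φ₁| ≤ 2 + 2δ|φ₂| ≤ 2 +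
4δ²|φ₁| ≤ 2 + |φ₁|/2. -/
lemma norm_fst_le (h : IsJostPhi q φ₁ φ₂) (hq : HasL2Bound q δ) (hδ : δ ^ 2 ≤ 1 / 8) (x : ℝ) :
    ‖φ₁ x‖ ≤ 4 := by
  have h1 := h.isDampedPair.norm_fst_le hq (by linarith) h.tendsto_fst (le_refl x)
  have h2 := h.norm_snd_le_fst hq (by linarith) x
  have h3 := mul_le_mul_of_nonneg_left h2 hq.nonneg
  rw [norm_one] at h1
  nlinarith [mul_le_mul_of_nonneg_right hδ (norm_nonneg (φ₁ x))]

lemma norm_snd_le (h : IsJostPhi q φ₁ φ₂) (hq : HasL2Bound q δ) (hδ : δ ^ 2 ≤ 1 / 8) (x : ℝ) :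
    ‖φ₂ x‖ ≤ 8 * δ := by
  have h1 := h.norm_fst_le hq hδ x
  have h2 := h.norm_snd_le_fst hq (by linarith) x
  nlinarith [mul_le_mul_of_nonneg_left h1 hq.nonneg]

lemma intervalIntegral_snd_le (h : IsJostPhi q φ₁ φ₂) (hq : HasL2Bound q δ) (hδ : δ ^ 2 ≤ 1 / 8)
    {a b : ℝ} (hab : a ≤ b) : ∫ x in a..b, ‖φ₂ x‖ ^ 2 ≤ (9 * δ) ^ 2 := by
  -- The energy bound is (8δ)² + 4²δ² = 80δ², rounded up to 81δ².
  have h1 := h.isDampedPair.energy hq hab (M := 4) fun x _ _ => h.norm_fst_le hq hδ x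
  have h2 := h.norm_snd_le hq hδ a
  have h3 := pow_le_pow_left₀ (norm_nonneg _) h2 2
  nlinarith [sq_nonneg δ]

lemma norm_fst_sub_one_le (h : IsJostPhi q φ₁ φ₂) (hq : HasL2Bound q δ) (hδ : δ ^ 2 ≤ 1 / 8)
    (x : ℝ) : ‖φ₁ x - 1‖ ≤ 9 * δ ^ 2 := by
  have hδ0 := hq.nonneg
  have hev : ∀ᶠ X in atTop, ‖φ₁ X - φ₁ x‖ ≤ 9 * δ ^ 2 := by
    filter_upwards [eventually_ge_atTop x] with X hX
    have := h.isDampedPair.norm_sub_le hq hX (by positivity)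
      (h.intervalIntegral_snd_le hq hδ hX)
    linarith
  rw [norm_sub_rev]
  exact le_of_tendsto (h.tendsto_fst.sub_const _).norm hev

lemma continuous_snd (h : IsJostPhi q φ₁ φ₂) : Continuous φ₂ := h.isDampedPair.continuous_snd

lemma continuous_fst (h : IsJostPhi q φ₁ φ₂) : Continuous φ₁ := h.isDampedPair.continuous_fst

lemma hasL2Bound_snd (h : IsJostPhi q φ₁ φ₂) (hq : HasL2Bound q δ) (hδ : δ ^ 2 ≤ 1 / 8) :
    HasL2Bound φ₂ (9 * δ) := by
  have hc : Continuous fun x => ‖φ₂ x‖ ^ 2 := h.continuous_snd.norm.pow 2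
  have hi : Integrable (fun x => ‖φ₂ x‖ ^ 2) volume := by
    refine integrable_of_intervalIntegral_norm_bounded (a := fun n : ℕ => -(n : ℝ))
      (b := fun n : ℕ => (n : ℝ)) (l := atTop) ((9 * δ) ^ 2) (fun n => ?_)
      (tendsto_neg_atTop_atBot.comp tendsto_natCast_atTop_atTop) tendsto_natCast_atTop_atTop
      (Eventually.of_forall fun n => ?_)
    · exact hc.locallyIntegrable.integrableOn_isCompact isCompact_Icc |>.mono_set
        Set.Ioc_subset_Icc_self
    · simp only [norm_pow, norm_norm]
      exact h.intervalIntegral_snd_le hq hδ (by have : (0 : ℝ) ≤ n := n.cast_nonneg; linarith)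
  refine ⟨h.continuous_snd, by have := hq.nonneg; positivity, hi, ?_⟩
  refine le_of_tendsto (intervalIntegral_tendsto_integral hi tendsto_neg_atTop_atBot tendsto_id) ?_
  filter_upwards [eventually_ge_atTop 0] with R hR
  exact h.intervalIntegral_snd_le hq hδ (by simp only [id]; linarith)

end IsJostPhi

lemma HasL2Bound.memLp {r : ℝ → ℂ} {δ : ℝ} (h : HasL2Bound r δ) : MemLp r 2 volume :=
  (memLp_two_iff_integrable_sq_norm h.continuous.aestronglyMeasurable).2 h.integrable

/-- φ₂ and its derivative are in L². This limit is not prescribed by the boundary value problem, but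
it is the initial datum needed to follow the limit of φ₁ in time. -/
lemma IsJostPhi.tendsto_snd_atTop {q φ₁ φ₂ : ℝ → ℂ} {δ : ℝ} (h : IsJostPhi q φ₁ φ₂)
    (hq : HasL2Bound q δ) (hδ : δ ^ 2 ≤ 1 / 8) : Tendsto φ₂ atTop (𝓝 0) := by
  have h2 := (h.hasL2Bound_snd hq hδ).memLp
  have hc : Continuous fun x => -conj (q x) * φ₁ x - φ₂ x := by
    have h1 := h.continuous_fst
    have h2 := h.continuous_snd
    have h3 : Continuous fun x => conj (q x) := Complex.continuous_conj.comp hq.continuous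
    fun_prop
  have h3 : MemLp (fun x => -conj (q x) * φ₁ x - φ₂ x) 2 volume := by
    refine MemLp.sub ?_ h2
    refine MemLp.of_le_mul (c := 4) hq.memLp
      ((Complex.continuous_conj.comp hq.continuous).neg.mul h.continuous_fst).aestronglyMeasurable
      (ae_of_all _ fun x => ?_)
    rw [norm_mul, norm_neg, RCLike.norm_conj, mul_comm]
    exact mul_le_mul_of_nonneg_right (h.norm_fst_le hq hδ x) (norm_nonneg _)
  refine (tendsto_cocompact_zero_of_memLp h.continuous_snd (fun x y => ?_) h2 h3).mono_left
    atTop_le_cocompact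
  exact (intervalIntegral.integral_eq_sub_of_hasDerivAt (fun z _ => h.hasDerivAt_snd z)
    (hc.intervalIntegrable _ _)).symm

/-- Reflection exchanges the two boundary value problems. -/
lemma IsJostChi.isJostPhi_reflect {q χ₁ χ₂ : ℝ → ℂ} (h : IsJostChi q χ₁ χ₂) :
    IsJostPhi (fun x => -conj (q (-x))) (fun x => -χ₂ (-x)) (fun x => χ₁ (-x)) := by
  refine ⟨fun x => ?_, fun x => ?_, ?_, ?_⟩
  · refine (((h.hasDerivAt_snd (-x)).scomp x (hasDerivAt_neg x)).neg).congr_deriv ?_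
    simp
  · refine ((h.hasDerivAt_fst (-x)).scomp x (hasDerivAt_neg x)).congr_deriv ?_
    simp
    ring
  · simpa using (h.tendsto_snd.comp tendsto_neg_atTop_atBot).neg
  · simpa [Function.comp_def] using h.tendsto_fst.comp tendsto_neg_atBot_atTop

lemma IsJostPhi.isJostChi_reflect {q χ₁ χ₂ : ℝ → ℂ}
    (h : IsJostPhi (fun x => -conj (q (-x))) (fun x => -χ₂ (-x)) (fun x => χ₁ (-x))) :
    IsJostChi q χ₁ χ₂ := by
  refine ⟨fun x => ?_, fun x => ?_, ?_, ?_⟩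
  · have := (h.hasDerivAt_snd (-x)).scomp x (hasDerivAt_neg x)
    simp only [Function.comp_def, neg_neg] at this
    refine this.congr_deriv ?_
    simp
  · have := ((h.hasDerivAt_fst (-x)).scomp x (hasDerivAt_neg x)).neg
    simp only [Function.comp_def, neg_neg] at this
    refine HasDerivAt.congr_deriv (by simpa [Pi.neg_def] using this) ?_
    simp
  · simpa [Function.comp_def] using h.tendsto_snd.comp tendsto_neg_atTop_atBot
  · simpa [Function.comp_def] using (h.tendsto_fst.comp tendsto_neg_atBot_atTop).neg

/-! ### Grönwall estimates for pairs -/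

lemma gronwallBound_le {δ K η x : ℝ} (hK : 1 ≤ K) (hη : 0 ≤ η) :
    gronwallBound δ K η x ≤ (δ + η) * Real.exp (K * x) := by
  rw [gronwallBound_of_K_ne_0 (by positivity)]
  have h1 : η / K ≤ η := div_le_self hη hK
  have h2 : η / K * (Real.exp (K * x) - 1) ≤ η * Real.exp (K * x) := by
    have h3 := Real.exp_pos (K * x)
    have h4 : 0 ≤ η / K := by positivity
    nlinarith
  simp only
  linarith

lemma norm_le_of_hasDerivAt_le {E : Type*} [NormedAddCommGroup E] [NormedSpace ℝ E]
    {f f' : ℝ → E} {K η T : ℝ} (hf : ∀ s, HasDerivAt f (f' s) s) (hK : 1 ≤ K) (hη : 0 ≤ η)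
    (hb : ∀ s, |s| ≤ T → ‖f' s‖ ≤ K * ‖f s‖ + η) {t : ℝ} (ht : |t| ≤ T) :
    ‖f t‖ ≤ (‖f 0‖ + η) * Real.exp (K * T) := by
  have main : ∀ g g' : ℝ → E, (∀ s, HasDerivAt g (g' s) s) →
      (∀ s, |s| ≤ T → ‖g' s‖ ≤ K * ‖g s‖ + η) → ∀ u, 0 ≤ u → u ≤ T →
      ‖g u‖ ≤ (‖g 0‖ + η) * Real.exp (K * T) := by
    intro g g' hg hgb u hu huT
    have h := norm_le_gronwallBound_of_norm_deriv_right_le (f := g) (f' := g') (a := 0) (b := T)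
      (δ := ‖g 0‖) (K := K) (ε := η)
      (fun s _ => (hg s).continuousAt.continuousWithinAt) (fun s _ => (hg s).hasDerivWithinAt)
      le_rfl (fun s hs => hgb s (abs_le.2 ⟨by linarith [hs.1, hs.2], hs.2.le⟩)) u ⟨hu, huT⟩
    rw [sub_zero] at h
    refine (h.trans (gronwallBound_le hK hη)).trans ?_
    have : 0 ≤ K := by linarith
    gcongr
  rcases le_total 0 t with h0 | h0
  · exact main f f' hf hb t h0 ((le_abs_self t).trans ht)
  · have := main (fun s => f (-s)) (fun s => -f' (-s)) (fun s => by
      simpa [Function.comp_def] using (hf (-s)).scomp s (hasDerivAt_neg s)) (fun s hs => by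
        rw [norm_neg]; exact hb (-s) (by rwa [abs_neg])) (-t) (by linarith)
        ((neg_le_abs t).trans ht)
    simpa using this

lemma norm_pair_le_of_hasDerivAt_le {w₁ w₂ d₁ d₂ : ℝ → ℂ} {K η T : ℝ}
    (h₁ : ∀ s, HasDerivAt w₁ (d₁ s) s) (h₂ : ∀ s, HasDerivAt w₂ (d₂ s) s) (hK : 1 ≤ K)
    (hη : 0 ≤ η) (hb₁ : ∀ s, |s| ≤ T → ‖d₁ s‖ ≤ K * (‖w₁ s‖ + ‖w₂ s‖) + η)
    (hb₂ : ∀ s, |s| ≤ T → ‖d₂ s‖ ≤ K * (‖w₁ s‖ + ‖w₂ s‖) + η) {t : ℝ} (ht : |t| ≤ T) :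
    ‖w₁ t‖ ≤ (‖w₁ 0‖ + ‖w₂ 0‖ + η) * Real.exp (2 * K * T) ∧
    ‖w₂ t‖ ≤ (‖w₁ 0‖ + ‖w₂ 0‖ + η) * Real.exp (2 * K * T) := by
  -- The pair carries the maximum norm; this produces the factor 2 in the exponent.
  have hsum : ∀ s, ‖w₁ s‖ + ‖w₂ s‖ ≤ 2 * ‖(w₁ s, w₂ s)‖ := fun s => by
    have h1 := norm_fst_le (w₁ s, w₂ s)
    have h2 := norm_snd_le (w₁ s, w₂ s)
    simp only at h1 h2
    linarith
  have h := norm_le_of_hasDerivAt_le (f := fun s => (w₁ s, w₂ s)) (f' := fun s => (d₁ s, d₂ s))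
    (K := 2 * K) (fun s => (h₁ s).prodMk (h₂ s)) (by linarith) hη (fun s hs => by
      have h3 := mul_le_mul_of_nonneg_left (hsum s) (by linarith : 0 ≤ K)
      rw [Prod.norm_mk]
      exact max_le (by linarith [hb₁ s hs]) (by linarith [hb₂ s hs])) ht
  have h0 : ‖(w₁ 0, w₂ 0)‖ ≤ ‖w₁ 0‖ + ‖w₂ 0‖ := by
    rw [Prod.norm_mk]
    exact max_le_add_of_nonneg (norm_nonneg _) (norm_nonneg _)
  have h' : ‖(w₁ t, w₂ t)‖ ≤ (‖w₁ 0‖ + ‖w₂ 0‖ + η) * Real.exp (2 * K * T) :=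
    h.trans (by gcongr)
  exact ⟨(norm_fst_le (w₁ t, w₂ t)).trans h', (norm_snd_le (w₁ t, w₂ t)).trans h'⟩

/-! ### The space equation of the Lax pair is propagated by the time equation -/

lemma exists_forall_norm_le_of_continuous {f : ℝ → ℂ} (hf : Continuous f) (T : ℝ) :
    ∃ K, 0 ≤ K ∧ ∀ s, |s| ≤ T → ‖f s‖ ≤ K := by
  obtain ⟨K, hK⟩ := (isCompact_Icc (a := -T) (b := T)).exists_bound_of_continuousOn hf.continuousOn
  exact ⟨max K 0, le_max_right _ _, fun s hs => (hK s (abs_le.1 hs)).trans (le_max_left _ _)⟩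

lemma eventually_forall_norm_sub_le {f : ℝ → ℝ → ℂ} (hf : Continuous (Function.uncurry f))
    (T x : ℝ) {ε : ℝ} (hε : 0 < ε) :
    ∀ᶠ h in 𝓝 (0 : ℝ), ∀ s, |s| ≤ T → ‖f s (x + h) - f s x‖ ≤ ε := by
  have hc : IsCompact (Set.Icc (-T) T ×ˢ Set.Icc (x - 1) (x + 1)) :=
    isCompact_Icc.prod isCompact_Icc
  have hu := hc.uniformContinuousOn_of_continuous hf.continuousOn
  rw [Metric.uniformContinuousOn_iff] at hu
  obtain ⟨d, hd, H⟩ := hu ε hε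
  filter_upwards [Metric.ball_mem_nhds (0 : ℝ) (lt_min hd one_pos)] with h hh s hs
  rw [Metric.mem_ball, dist_zero_right, Real.norm_eq_abs, lt_min_iff] at hh
  have h1 := abs_lt.1 hh.2
  have := H (s, x + h) ⟨abs_le.1 hs, by constructor <;> simp only <;> linarith⟩ (s, x)
    ⟨abs_le.1 hs, by constructor <;> simp only <;> linarith⟩ (by
      rw [Prod.dist_eq, dist_self, Real.dist_eq]
      simpa using hh.1)
  rw [dist_eq_norm] at this
  exact this.le

lemma eventually_forall_norm_sub_sub_le {f f' : ℝ → ℝ → ℂ}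
    (hf : ∀ s y, HasDerivAt (f s) (f' s y) y) (hf' : Continuous (Function.uncurry f'))
    (T x : ℝ) {ε : ℝ} (hε : 0 < ε) :
    ∀ᶠ h in 𝓝 (0 : ℝ), ∀ s, |s| ≤ T → ‖f s (x + h) - f s x - h * f' s x‖ ≤ ε * |h| := by
  obtain ⟨d, hd, H⟩ := Metric.eventually_nhds_iff.1 (eventually_forall_norm_sub_le hf' T x hε)
  refine Metric.eventually_nhds_iff.2 ⟨d, hd, fun h hh s hs => ?_⟩
  have hmvt := (convex_uIcc x (x + h)).norm_image_sub_le_of_norm_hasDerivWithin_le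
    (f := fun y => f s y - (y : ℂ) * f' s x) (f' := fun y => f' s y - f' s x) (C := ε)
    (fun y _ => by
      have h2 := ((hasDerivAt_id y).ofReal_comp).mul_const (f' s x)
      refine (((hf s y).sub h2).congr_deriv ?_).hasDerivWithinAt
      simp)
    (fun y hy => by
      have hy' : |y - x| ≤ |h| := by simpa using Set.abs_sub_left_of_mem_uIcc hy
      have := H (y := y - x) (by
        rw [Real.dist_eq, sub_zero] at hh ⊢
        exact hy'.trans_lt hh) s hs
      simpa using this)
    Set.left_mem_uIcc Set.right_mem_uIcc
  rw [add_sub_cancel_left, Real.norm_eq_abs] at hmvt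
  refine le_trans (le_of_eq ?_) hmvt
  congr 1
  push_cast
  ring

/-- If `v_t = A v` for a matrix `A` of class `C¹` in `x`, and `β_t = A_x v + A β` at the point `x`,
then `v_x = β` at `x` for all times as soon as it holds at time zero. -/
lemma hasDerivAt_space_of_time {a b c d a' b' c' d' v₁ v₂ : ℝ → ℝ → ℂ} {β₁ β₂ : ℝ → ℂ} {x : ℝ}
    (hac : Continuous (Function.uncurry a)) (hbc : Continuous (Function.uncurry b))
    (hcc : Continuous (Function.uncurry c)) (hdc : Continuous (Function.uncurry d))
    (hac' : Continuous (Function.uncurry a')) (hbc' : Continuous (Function.uncurry b'))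
    (hcc' : Continuous (Function.uncurry c')) (hdc' : Continuous (Function.uncurry d'))
    (ha : ∀ s y, HasDerivAt (a s) (a' s y) y) (hb : ∀ s y, HasDerivAt (b s) (b' s y) y)
    (hc : ∀ s y, HasDerivAt (c s) (c' s y) y) (hd : ∀ s y, HasDerivAt (d s) (d' s y) y)
    (hv₁ : ∀ s y, HasDerivAt (fun s => v₁ s y) (a s y * v₁ s y + b s y * v₂ s y) s)
    (hv₂ : ∀ s y, HasDerivAt (fun s => v₂ s y) (c s y * v₁ s y + d s y * v₂ s y) s)
    (hβ₁ : ∀ s, HasDerivAt β₁ (a' s x * v₁ s x + b' s x * v₂ s x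
      + (a s x * β₁ s + b s x * β₂ s)) s)
    (hβ₂ : ∀ s, HasDerivAt β₂ (c' s x * v₁ s x + d' s x * v₂ s x
      + (c s x * β₁ s + d s x * β₂ s)) s)
    (h₁ : HasDerivAt (v₁ 0) (β₁ 0) x) (h₂ : HasDerivAt (v₂ 0) (β₂ 0) x) (t : ℝ) :
    HasDerivAt (v₁ t) (β₁ t) x ∧ HasDerivAt (v₂ t) (β₂ t) x := by
  set T := |t| with hT
  have cont : ∀ {f f' : ℝ → ℂ}, (∀ s, HasDerivAt f (f' s) s) → Continuous f := fun h =>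
    continuous_iff_continuousAt.2 fun s => (h s).continuousAt
  have slice : ∀ {f : ℝ → ℝ → ℂ}, Continuous (Function.uncurry f) → Continuous fun s => f s x :=
    fun h => h.comp (by fun_prop : Continuous fun s : ℝ => (s, x))
  obtain ⟨L₁, hL₁0, hL₁⟩ := exists_forall_norm_le_of_continuous (cont fun s => hv₁ s x) T
  obtain ⟨L₂, hL₂0, hL₂⟩ := exists_forall_norm_le_of_continuous (cont fun s => hv₂ s x) T
  obtain ⟨L₃, hL₃0, hL₃⟩ := exists_forall_norm_le_of_continuous (cont hβ₁) T
  obtain ⟨L₄, hL₄0, hL₄⟩ := exists_forall_norm_le_of_continuous (cont hβ₂) T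
  obtain ⟨Ka, hKa0, hKa⟩ := exists_forall_norm_le_of_continuous (slice hac) T
  obtain ⟨Kb, hKb0, hKb⟩ := exists_forall_norm_le_of_continuous (slice hbc) T
  obtain ⟨Kc, hKc0, hKc⟩ := exists_forall_norm_le_of_continuous (slice hcc) T
  obtain ⟨Kd, hKd0, hKd⟩ := exists_forall_norm_le_of_continuous (slice hdc) T
  set L := L₁ + L₂ + L₃ + L₄ with hL
  -- The summand 1 allows for the change of the coefficients between x and x + h, and gives K ≥ 1.
  set K := Ka + Kb + Kc + Kd + 1 with hK
  -- The remainder w = v(x+h) - v(x) - hβ solves w_t = A(x+h)w + (A(x+h) - A(x) - hA_x)v + h(A(x+h)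
  -- - A(x))β. The inhomogeneity is at most ε|h|L, the initial values together at most 2ε|h|, so
  -- Grönwall gives w = o(h).
  have key : ∀ ε > 0, ∀ᶠ h in 𝓝 (0 : ℝ),
      ‖v₁ t (x + h) - v₁ t x - h * β₁ t‖ ≤ ε * ((2 + L) * Real.exp (2 * K * T)) * |h| ∧
      ‖v₂ t (x + h) - v₂ t x - h * β₂ t‖ ≤ ε * ((2 + L) * Real.exp (2 * K * T)) * |h| := by
    intro ε hε
    have i₁ := (hasDerivAt_iff_isLittleO_nhds_zero.1 h₁).bound hε
    have i₂ := (hasDerivAt_iff_isLittleO_nhds_zero.1 h₂).bound hε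
    filter_upwards [i₁, i₂, eventually_forall_norm_sub_sub_le ha hac' T x hε,
      eventually_forall_norm_sub_sub_le hb hbc' T x hε,
      eventually_forall_norm_sub_sub_le hc hcc' T x hε,
      eventually_forall_norm_sub_sub_le hd hdc' T x hε,
      eventually_forall_norm_sub_le hac T x (lt_min hε one_pos),
      eventually_forall_norm_sub_le hbc T x (lt_min hε one_pos),
      eventually_forall_norm_sub_le hcc T x (lt_min hε one_pos),
      eventually_forall_norm_sub_le hdc T x (lt_min hε one_pos)]
      with h j₁ j₂ ea eb ec ed fa fb fc fd
    simp only [Complex.real_smul, Real.norm_eq_abs] at j₁ j₂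
    have hη : 0 ≤ ε * |h| * L := by positivity
    have bd : ∀ (A A₀ A' B B₀ B' V₁ V₂ b₁ b₂ W₁ W₂ : ℂ) (KA KB : ℝ), 0 ≤ KA → 0 ≤ KB →
        KA + 1 ≤ K → KB + 1 ≤ K → ‖A₀‖ ≤ KA → ‖B₀‖ ≤ KB →
        ‖V₁‖ ≤ L₁ → ‖V₂‖ ≤ L₂ → ‖b₁‖ ≤ L₃ → ‖b₂‖ ≤ L₄ →
        ‖A - A₀ - h * A'‖ ≤ ε * |h| → ‖B - B₀ - h * B'‖ ≤ ε * |h| →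
        ‖A - A₀‖ ≤ min ε 1 → ‖B - B₀‖ ≤ min ε 1 →
        ‖A * W₁ + B * W₂ + ((A - A₀ - h * A') * V₁ + (B - B₀ - h * B') * V₂
          + (h * ((A - A₀) * b₁) + h * ((B - B₀) * b₂)))‖
          ≤ K * (‖W₁‖ + ‖W₂‖) + ε * |h| * L := by
      intro A A₀ A' B B₀ B' V₁ V₂ b₁ b₂ W₁ W₂ KA KB _ _ hA hB hA₀ hB₀ hV₁ hV₂ hb₁ hb₂ hA' hB' hA'' hB''
      have nA : ‖A‖ ≤ K := by
        have := norm_le_norm_add_norm_sub' A A₀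
        linarith [min_le_right ε 1]
      have nB : ‖B‖ ≤ K := by
        have := norm_le_norm_add_norm_sub' B B₀
        linarith [min_le_right ε 1]
      have nA'' := hA''.trans (min_le_left _ _)
      have nB'' := hB''.trans (min_le_left _ _)
      have s1 : ‖A * W₁ + B * W₂‖ ≤ K * (‖W₁‖ + ‖W₂‖) := by
        refine (norm_add_le _ _).trans ?_
        rw [norm_mul, norm_mul, mul_add]
        gcongr
      have s2 : ‖(A - A₀ - h * A') * V₁ + (B - B₀ - h * B') * V₂‖ ≤ ε * |h| * L₁ + ε * |h| * L₂ := by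
        refine (norm_add_le _ _).trans ?_
        rw [norm_mul, norm_mul]
        gcongr
      have s3 : ‖h * ((A - A₀) * b₁) + h * ((B - B₀) * b₂)‖ ≤ |h| * (ε * L₃) + |h| * (ε * L₄) := by
        refine (norm_add_le _ _).trans ?_
        rw [norm_mul, norm_mul, norm_mul, norm_mul, Complex.norm_real, Real.norm_eq_abs]
        gcongr
      have s4 := norm_add_le (A * W₁ + B * W₂) ((A - A₀ - h * A') * V₁ + (B - B₀ - h * B') * V₂
          + (h * ((A - A₀) * b₁) + h * ((B - B₀) * b₂)))
      have s5 := norm_add_le ((A - A₀ - h * A') * V₁ + (B - B₀ - h * B') * V₂)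
          (h * ((A - A₀) * b₁) + h * ((B - B₀) * b₂))
      have : ε * |h| * L = ε * |h| * L₁ + ε * |h| * L₂ + (|h| * (ε * L₃) + |h| * (ε * L₄)) := by
        rw [hL]; ring
      linarith
    have G := norm_pair_le_of_hasDerivAt_le (T := T) (K := K) (η := ε * |h| * L) (t := t)
      (w₁ := fun s => v₁ s (x + h) - v₁ s x - h * β₁ s)
      (w₂ := fun s => v₂ s (x + h) - v₂ s x - h * β₂ s)
      (fun s => ((hv₁ s (x + h)).sub (hv₁ s x)).sub ((hβ₁ s).const_mul (h : ℂ)))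
      (fun s => ((hv₂ s (x + h)).sub (hv₂ s x)).sub ((hβ₂ s).const_mul (h : ℂ)))
      (by linarith) hη
      (fun s hs => by
        have := bd (a s (x + h)) (a s x) (a' s x) (b s (x + h)) (b s x) (b' s x) (v₁ s x) (v₂ s x)
          (β₁ s) (β₂ s) (v₁ s (x + h) - v₁ s x - h * β₁ s) (v₂ s (x + h) - v₂ s x - h * β₂ s) Ka Kb
          hKa0 hKb0 (by linarith) (by linarith) (hKa s hs) (hKb s hs) (hL₁ s hs) (hL₂ s hs)
          (hL₃ s hs) (hL₄ s hs) (ea s hs) (eb s hs) (fa s hs) (fb s hs)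
        refine le_trans (le_of_eq ?_) this
        congr 1
        ring)
      (fun s hs => by
        have := bd (c s (x + h)) (c s x) (c' s x) (d s (x + h)) (d s x) (d' s x) (v₁ s x) (v₂ s x)
          (β₁ s) (β₂ s) (v₁ s (x + h) - v₁ s x - h * β₁ s) (v₂ s (x + h) - v₂ s x - h * β₂ s) Kc Kd
          hKc0 hKd0 (by linarith) (by linarith) (hKc s hs) (hKd s hs) (hL₁ s hs) (hL₂ s hs)
          (hL₃ s hs) (hL₄ s hs) (ec s hs) (ed s hs) (fc s hs) (fd s hs)
        refine le_trans (le_of_eq ?_) this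
        congr 1
        ring)
      (le_refl T)
    have fin : (‖v₁ 0 (x + h) - v₁ 0 x - h * β₁ 0‖ + ‖v₂ 0 (x + h) - v₂ 0 x - h * β₂ 0‖
        + ε * |h| * L) * Real.exp (2 * K * T) ≤ ε * ((2 + L) * Real.exp (2 * K * T)) * |h| := by
      have : ε * ((2 + L) * Real.exp (2 * K * T)) * |h|
          = (ε * |h| + ε * |h| + ε * |h| * L) * Real.exp (2 * K * T) := by ring
      rw [this]
      gcongr
    exact ⟨G.1.trans fin, G.2.trans fin⟩
  have hpos : 0 < (2 + L) * Real.exp (2 * K * T) := by positivity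
  constructor
  · rw [hasDerivAt_iff_isLittleO_nhds_zero, Asymptotics.isLittleO_iff]
    intro ε hε
    filter_upwards [key (ε / ((2 + L) * Real.exp (2 * K * T))) (by positivity)] with h hh
    rw [div_mul_cancel₀ _ hpos.ne'] at hh
    simpa using hh.1
  · rw [hasDerivAt_iff_isLittleO_nhds_zero, Asymptotics.isLittleO_iff]
    intro ε hε
    filter_upwards [key (ε / ((2 + L) * Real.exp (2 * K * T))) (by positivity)] with h hh
    rw [div_mul_cancel₀ _ hpos.ne'] at hh
    simpa using hh.2

/-! ### Evolution of the Jost functions -/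

lemma ContinuousInC0.neg {f : ℝ → ℝ → ℂ} (hf : ContinuousInC0 f) :
    ContinuousInC0 fun t x => -f t x := by
  refine ⟨fun t => (hf.continuous t).neg, fun t => by simpa using (hf.tendsto_zero t).neg,
    fun t₀ => ?_⟩
  have := hf.uniform t₀
  rw [Metric.tendstoUniformly_iff] at this ⊢
  simpa only [dist_neg_neg] using this

lemma ContinuousInC0.conj_reflect {f : ℝ → ℝ → ℂ} (hf : ContinuousInC0 f) :
    ContinuousInC0 fun t x => conj (f (-t) (-x)) := by
  refine ⟨fun t => Complex.continuous_conj.comp ((hf.continuous _).comp continuous_neg),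
    fun t => ?_, fun t₀ => ?_⟩
  · have h1 : Tendsto (fun x : ℝ => f (-t) (-x)) (cocompact ℝ) (𝓝 0) :=
      (hf.tendsto_zero (-t)).comp (Homeomorph.neg ℝ).isClosedEmbedding.tendsto_cocompact
    simpa [Function.comp_def] using (Complex.continuous_conj.tendsto 0).comp h1
  · have h1 := Metric.tendstoUniformly_iff.1 (hf.uniform (-t₀))
    rw [Metric.tendstoUniformly_iff]
    intro ε hε
    filter_upwards [(continuous_neg.tendsto t₀).eventually (h1 ε hε)] with t ht x
    have := ht (-x)
    rwa [← Complex.dist_conj_conj] at this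

lemma ContinuousInL2.neg {f : ℝ → ℝ → ℂ} (hf : ContinuousInL2 f) :
    ContinuousInL2 fun t x => -f t x := by
  refine ⟨fun t => (hf.memLp t).neg, fun t₀ => (hf.tendsto t₀).congr fun t => ?_⟩
  rw [← eLpNorm_neg]
  congr 1
  ext x
  simp
  ring

lemma ContinuousInL2.conj_reflect {f : ℝ → ℝ → ℂ} (hf : ContinuousInL2 f) :
    ContinuousInL2 fun t x => conj (f (-t) (-x)) := by
  have hneg := Measure.measurePreserving_neg (volume : Measure ℝ)
  refine ⟨fun t => ?_, fun t₀ => ?_⟩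
  · have := (hf.memLp (-t)).comp_measurePreserving hneg
    exact this.star
  · refine ((hf.tendsto (-t₀)).comp (continuous_neg.tendsto t₀)).congr fun t => ?_
    simp only [Function.comp]
    rw [← eLpNorm_comp_measurePreserving ((hf.memLp (-t)).1.sub (hf.memLp (-t₀)).1) hneg]
    refine eLpNorm_congr_norm_ae (ae_of_all _ fun x => ?_)
    simp only [Function.comp, Pi.sub_apply, ← map_sub, RCLike.norm_conj]

namespace RegularSolution

variable {q q' q'' : ℝ → ℝ → ℂ}

/-- `-q̄(-t,-x)` is a solution if `q` is. -/
lemma reflect (hq : RegularSolution q q' q'') :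
    RegularSolution (fun t x => -conj (q (-t) (-x))) (fun t x => conj (q' (-t) (-x)))
      (fun t x => -conj (q'' (-t) (-x))) := by
  refine ⟨fun t x => ?_, fun t x => ?_, hq.c0.conj_reflect.neg, hq.c0'.conj_reflect,
    hq.c0''.conj_reflect.neg, hq.l2.conj_reflect.neg, hq.l2'.conj_reflect,
    hq.l2''.conj_reflect.neg, fun t x => ?_⟩
  · refine (hasDerivAt_conj ((hq.hasDerivAt (-t) (-x)).scomp x (hasDerivAt_neg x))).neg.congr_deriv ?_
    simp
  · refine (hasDerivAt_conj ((hq.hasDerivAt' (-t) (-x)).scomp x (hasDerivAt_neg x))).congr_deriv ?_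
    simp
  · refine (hasDerivAt_conj ((hq.time (-t) (-x)).scomp t (hasDerivAt_neg t))).neg.congr_deriv ?_
    simp [map_ofNat]
    ring

lemma deriv_eq (hq : RegularSolution q q' q'') (t x : ℝ) : deriv (q t) x = q' t x :=
  (hq.hasDerivAt t x).deriv

/-- β = Uφ satisfies β_t = A_xφ + Aβ exactly because of zero curvature, that is, because q solves
the cubic equation. Differentiability of φ in x at later times is a conclusion. -/
lemma hasDerivAt_space_of_solvesLaxTime (hq : RegularSolution q q' q'') {φ₁ φ₂ : ℝ → ℝ → ℂ}
    (h : SolvesLaxTime q φ₁ φ₂) (h₁ : ∀ x, HasDerivAt (φ₁ 0) (q 0 x * φ₂ 0 x) x)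
    (h₂ : ∀ x, HasDerivAt (φ₂ 0) (-conj (q 0 x) * φ₁ 0 x - φ₂ 0 x) x) (t x : ℝ) :
    HasDerivAt (φ₁ t) (q t x * φ₂ t x) x ∧
      HasDerivAt (φ₂ t) (-conj (q t x) * φ₁ t x - φ₂ t x) x := by
  have cq := hq.c0.continuous_uncurry
  have cq' := hq.c0'.continuous_uncurry
  have cq'' := hq.c0''.continuous_uncurry
  have ccq := Complex.continuous_conj.comp cq
  have ccq' := Complex.continuous_conj.comp cq'
  have ccq'' := Complex.continuous_conj.comp cq''
  have e₁ : ∀ s y, HasDerivAt (fun s => φ₁ s y)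
      (Complex.I * (1 / 2 + q s y * conj (q s y)) * φ₁ s y
        + Complex.I * (q' s y + q s y) * φ₂ s y) s := fun s y => by
    refine (h.hasDerivAt_fst s y).congr_deriv ?_
    rw [hq.deriv_eq, mul_conj_eq_norm]
    ring
  have e₂ : ∀ s y, HasDerivAt (fun s => φ₂ s y)
      (Complex.I * (conj (q' s y) - conj (q s y)) * φ₁ s y
        + -(Complex.I * (1 / 2 + q s y * conj (q s y))) * φ₂ s y) s := fun s y => by
    refine (h.hasDerivAt_snd s y).congr_deriv ?_
    rw [hq.deriv_eq, mul_conj_eq_norm]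
    ring
  have dq := hq.hasDerivAt
  have dq' := hq.hasDerivAt'
  have da : ∀ s y, HasDerivAt (fun y => Complex.I * (1 / 2 + q s y * conj (q s y)))
      (Complex.I * (q' s y * conj (q s y) + q s y * conj (q' s y))) y := fun s y =>
    (((dq s y).mul (hasDerivAt_conj (dq s y))).const_add _).const_mul _
  refine hasDerivAt_space_of_time (x := x)
    (a := fun s y => Complex.I * (1 / 2 + q s y * conj (q s y)))
    (b := fun s y => Complex.I * (q' s y + q s y))
    (c := fun s y => Complex.I * (conj (q' s y) - conj (q s y)))
    (d := fun s y => -(Complex.I * (1 / 2 + q s y * conj (q s y))))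
    (a' := fun s y => Complex.I * (q' s y * conj (q s y) + q s y * conj (q' s y)))
    (b' := fun s y => Complex.I * (q'' s y + q' s y))
    (c' := fun s y => Complex.I * (conj (q'' s y) - conj (q' s y)))
    (d' := fun s y => -(Complex.I * (q' s y * conj (q s y) + q s y * conj (q' s y))))
    (β₁ := fun s => q s x * φ₂ s x) (β₂ := fun s => -conj (q s x) * φ₁ s x - φ₂ s x)
    (continuous_const.mul (continuous_const.add (cq.mul ccq)))
    (continuous_const.mul (cq'.add cq)) (continuous_const.mul (ccq'.sub ccq))
    (continuous_const.mul (continuous_const.add (cq.mul ccq))).neg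
    (continuous_const.mul ((cq'.mul ccq).add (cq.mul ccq')))
    (continuous_const.mul (cq''.add cq')) (continuous_const.mul (ccq''.sub ccq'))
    (continuous_const.mul ((cq'.mul ccq).add (cq.mul ccq'))).neg
    da (fun s y => ((dq' s y).add (dq s y)).const_mul _)
    (fun s y => ((hasDerivAt_conj (dq' s y)).sub (hasDerivAt_conj (dq s y))).const_mul _)
    (fun s y => (da s y).neg) e₁ e₂ (fun s => ?_) (fun s => ?_) (h₁ x) (h₂ x) t
  · refine ((hq.time s x).mul (e₂ s x)).congr_deriv ?_
    rw [← mul_conj_eq_norm]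
    ring
  · refine (((hasDerivAt_conj (hq.time s x)).neg.mul (e₁ s x)).sub (e₂ s x)).congr_deriv ?_
    simp only [Pi.neg_apply, map_mul, map_add, Complex.conj_I, Complex.conj_ofReal, map_pow,
      map_ofNat]
    rw [← mul_conj_eq_norm]
    ring

lemma exists_lax_bound (hq : RegularSolution q q' q'') (T : ℝ) :
    ∃ K, 1 ≤ K ∧ ∀ s, |s| ≤ T → ∀ x,
      ‖(1 / 2 + (‖q s x‖ : ℂ) ^ 2)‖ ≤ K ∧ ‖q' s x + q s x‖ ≤ K ∧
      ‖conj (q' s x) - conj (q s x)‖ ≤ K := by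
  obtain ⟨K, hK0, hK⟩ := hq.c0.exists_bound T
  obtain ⟨K', hK0', hK'⟩ := hq.c0'.exists_bound T
  refine ⟨1 + K ^ 2 + K + K', by nlinarith, fun s hs x => ⟨?_, ?_, ?_⟩⟩
  · refine (norm_add_le _ _).trans ?_
    rw [norm_pow, Complex.norm_real, norm_norm]
    have := pow_le_pow_left₀ (norm_nonneg _) (hK s hs x) 2
    norm_num
    linarith
  · have := norm_add_le (q' s x) (q s x)
    nlinarith [hK s hs x, hK' s hs x]
  · have := norm_sub_le (conj (q' s x)) (conj (q s x))
    rw [RCLike.norm_conj, RCLike.norm_conj] at this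
    nlinarith [hK s hs x, hK' s hs x]

lemma exists_growth_bound (hq : RegularSolution q q' q'') {φ₁ φ₂ : ℝ → ℝ → ℂ}
    (h : SolvesLaxTime q φ₁ φ₂) (t : ℝ) :
    ∃ C, ∀ x, ‖φ₁ t x‖ ≤ (‖φ₁ 0 x‖ + ‖φ₂ 0 x‖) * C ∧ ‖φ₂ t x‖ ≤ (‖φ₁ 0 x‖ + ‖φ₂ 0 x‖) * C := by
  obtain ⟨K, hK1, hK⟩ := hq.exists_lax_bound |t|
  refine ⟨Real.exp (2 * K * |t|), fun x => ?_⟩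
  have := norm_pair_le_of_hasDerivAt_le (fun s => h.hasDerivAt_fst s x)
    (fun s => h.hasDerivAt_snd s x) hK1 (le_refl 0) (T := |t|) (fun s hs => ?_) (fun s hs => ?_)
    (le_refl |t|)
  · simpa using this
  · obtain ⟨k1, k2, -⟩ := hK s hs x
    rw [norm_mul, Complex.norm_I, one_mul, add_zero, mul_add, hq.deriv_eq]
    refine (norm_add_le _ _).trans ?_
    rw [norm_mul, norm_mul]
    gcongr
  · obtain ⟨k1, -, k3⟩ := hK s hs x
    rw [norm_mul, Complex.norm_I, one_mul, add_zero, mul_add, hq.deriv_eq]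
    refine (_root_.norm_sub_le _ _).trans ?_
    rw [norm_mul, norm_mul]
    gcongr

/-- As x → ∞ the coefficients q and q' tend to 0 uniformly for |s| ≤ |t|; the time system decouples,
and φ₁ rotates like e^{is/2}. -/
lemma tendsto_atTop_of_solvesLaxTime (hq : RegularSolution q q' q'') {φ₁ φ₂ : ℝ → ℝ → ℂ}
    (h : SolvesLaxTime q φ₁ φ₂) (h₁ : Tendsto (φ₁ 0) atTop (𝓝 1))
    (h₂ : Tendsto (φ₂ 0) atTop (𝓝 0)) (t : ℝ) :
    Tendsto (φ₁ t) atTop (𝓝 (Complex.exp (Complex.I * t / 2))) := by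
  obtain ⟨K, hK1, hK⟩ := hq.exists_lax_bound |t|
  have hexp : ∀ s : ℝ, ‖Complex.exp (Complex.I * s / 2)‖ = 1 := fun s => by
    have : Complex.I * s / 2 = ((s / 2 : ℝ) : ℂ) * Complex.I := by push_cast; ring
    rw [this, Complex.norm_exp_ofReal_mul_I]
  have hder : ∀ s : ℝ, HasDerivAt (fun s : ℝ => Complex.exp (Complex.I * s / 2))
      (Complex.I / 2 * Complex.exp (Complex.I * s / 2)) s := fun s => by
    have h1 : HasDerivAt (fun s : ℝ => Complex.I * (s : ℂ) / 2) (Complex.I / 2) s := by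
      have := (((hasDerivAt_id s).ofReal_comp).const_mul Complex.I).div_const 2
      simpa using this
    refine h1.cexp.congr_deriv (by ring)
  set C := Real.exp (2 * K * |t|) with hC
  -- Grönwall for (φ₁ - e^{is/2}, φ₂): initial values contribute 2ε and the forcing 2ε. The bound
  -- |q|² ≤ ε² ≤ ε uses ε ≤ 1.
  have key : ∀ ε > 0, ε ≤ 1 → ∀ᶠ x in atTop,
      ‖φ₁ t x - Complex.exp (Complex.I * t / 2)‖ ≤ (4 * ε) * C := by
    intro ε hε hε1
    obtain ⟨R, hR⟩ := hq.c0.exists_forall_norm_le |t| hε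
    obtain ⟨R', hR'⟩ := hq.c0'.exists_forall_norm_le |t| hε
    have l₁ : ∀ᶠ x in atTop, ‖φ₁ 0 x - 1‖ < ε := by
      have := (h₁.sub_const 1).norm
      rw [sub_self, norm_zero] at this
      exact this.eventually (gt_mem_nhds hε)
    have l₂ : ∀ᶠ x in atTop, ‖φ₂ 0 x‖ < ε := by
      have := h₂.norm
      rw [norm_zero] at this
      exact this.eventually (gt_mem_nhds hε)
    filter_upwards [l₁, l₂, eventually_ge_atTop R, eventually_ge_atTop R'] with x x₁ x₂ x₃ x₄
    have := norm_pair_le_of_hasDerivAt_le (fun s => (h.hasDerivAt_fst s x).sub (hder s))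
      (fun s => h.hasDerivAt_snd s x) hK1 (by positivity : 0 ≤ 2 * ε) (T := |t|)
      (fun s hs => ?_) (fun s hs => ?_) (le_refl |t|)
    · refine this.1.trans ?_
      simp only [Pi.sub_apply, Complex.ofReal_zero, mul_zero, zero_div, Complex.exp_zero]
      gcongr
      linarith
    · obtain ⟨k1, k2, -⟩ := hK s hs x
      have b := hR s hs x (x₃.trans (le_abs_self x))
      set E := Complex.exp (Complex.I * s / 2) with hE
      have : Complex.I * ((1 / 2 + (‖q s x‖ : ℂ) ^ 2) * φ₁ s x + (deriv (q s) x + q s x) * φ₂ s x)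
          - Complex.I / 2 * E
          = Complex.I * ((1 / 2 + (‖q s x‖ : ℂ) ^ 2) * (φ₁ s x - E) + (q' s x + q s x) * φ₂ s x
            + (‖q s x‖ : ℂ) ^ 2 * E) := by
        rw [hq.deriv_eq]; ring
      rw [this, norm_mul, Complex.norm_I, one_mul]
      refine (norm_add_le _ _).trans (add_le_add ((norm_add_le _ _).trans ?_) ?_)
      · rw [norm_mul, norm_mul, mul_add]
        simp only [Pi.sub_apply]
        gcongr
      · rw [norm_mul, hexp, mul_one, norm_pow, Complex.norm_real, norm_norm]
        nlinarith [norm_nonneg (q s x)]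
    · obtain ⟨k1, -, k3⟩ := hK s hs x
      have b := hR s hs x (x₃.trans (le_abs_self x))
      have b' := hR' s hs x (x₄.trans (le_abs_self x))
      set E := Complex.exp (Complex.I * s / 2) with hE
      have : Complex.I * ((conj (deriv (q s) x) - conj (q s x)) * φ₁ s x
            - (1 / 2 + (‖q s x‖ : ℂ) ^ 2) * φ₂ s x)
          = Complex.I * ((conj (q' s x) - conj (q s x)) * (φ₁ s x - E)
            - (1 / 2 + (‖q s x‖ : ℂ) ^ 2) * φ₂ s x + (conj (q' s x) - conj (q s x)) * E) := by
        rw [hq.deriv_eq]; ring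
      rw [this, norm_mul, Complex.norm_I, one_mul]
      refine (norm_add_le _ _).trans (add_le_add ((_root_.norm_sub_le _ _).trans ?_) ?_)
      · rw [norm_mul, norm_mul, mul_add]
        simp only [Pi.sub_apply]
        gcongr
      · rw [norm_mul, hexp, mul_one]
        refine (_root_.norm_sub_le _ _).trans ?_
        rw [RCLike.norm_conj, RCLike.norm_conj]
        linarith
  rw [tendsto_iff_norm_sub_tendsto_zero, Metric.tendsto_nhds]
  intro ε hε
  have hC0 : 0 < C := Real.exp_pos _
  filter_upwards [key (min 1 (ε / (8 * C))) (lt_min one_pos (by positivity)) (min_le_left _ _)]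
    with x hx
  rw [dist_zero_right, norm_norm]
  refine hx.trans_lt ?_
  have : min 1 (ε / (8 * C)) ≤ ε / (8 * C) := min_le_right _ _
  have h2 : 4 * min 1 (ε / (8 * C)) * C ≤ 4 * (ε / (8 * C)) * C := by gcongr
  have h3 : 4 * (ε / (8 * C)) * C = ε / 2 := by field_simp; norm_num
  linarith

variable {δ : ℝ}

/-- The phase restores the limit 1 at +∞. The condition at -∞ survives because φ₂(t) stays bounded
in x, by Grönwall from its bounded initial values. -/
lemma isJostPhi (hq : RegularSolution q q' q'') (hδ : HasL2Bound (q 0) δ) (hδ1 : δ ^ 2 ≤ 1 / 8)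
    {φ₁ φ₂ : ℝ → ℝ → ℂ} (h0 : IsJostPhi (q 0) (φ₁ 0) (φ₂ 0)) (h : SolvesLaxTime q φ₁ φ₂) (t : ℝ) :
    IsJostPhi (q t) (fun x => Complex.exp (-(Complex.I * t / 2)) * φ₁ t x)
      (fun x => Complex.exp (-(Complex.I * t / 2)) * φ₂ t x) := by
  have hs := hq.hasDerivAt_space_of_solvesLaxTime h h0.hasDerivAt_fst h0.hasDerivAt_snd t
  refine ⟨fun x => ?_, fun x => ?_, ?_, ?_⟩
  · exact ((hs x).1.const_mul _).congr_deriv (by ring)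
  · exact ((hs x).2.const_mul _).congr_deriv (by ring)
  · have := (hq.tendsto_atTop_of_solvesLaxTime h h0.tendsto_fst
      (h0.tendsto_snd_atTop hδ hδ1) t).const_mul (Complex.exp (-(Complex.I * t / 2)))
    rwa [← Complex.exp_add, neg_add_cancel, Complex.exp_zero] at this
  · obtain ⟨C, hC⟩ := hq.exists_growth_bound h t
    have hb : ∀ x, ‖φ₂ t x‖ ≤ (4 + 8 * δ) * |C| := fun x => by
      refine (hC x).2.trans ?_
      have h1 := h0.norm_fst_le hδ hδ1 x
      have h2 := h0.norm_snd_le hδ hδ1 x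
      have h3 : ‖φ₁ 0 x‖ + ‖φ₂ 0 x‖ ≤ 4 + 8 * δ := add_le_add h1 h2
      calc (‖φ₁ 0 x‖ + ‖φ₂ 0 x‖) * C ≤ (‖φ₁ 0 x‖ + ‖φ₂ 0 x‖) * |C| := by
            gcongr
            exact le_abs_self C
        _ ≤ _ := by gcongr
    rw [tendsto_zero_iff_norm_tendsto_zero]
    have hlim := (Real.tendsto_exp_atBot).mul_const
      (‖Complex.exp (-(Complex.I * t / 2))‖ * ((4 + 8 * δ) * |C|))
    rw [zero_mul] at hlim
    refine squeeze_zero (fun x => norm_nonneg _) (fun x => ?_) hlim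
    rw [norm_mul, norm_mul, Complex.norm_real, Real.norm_eq_abs, Real.abs_exp]
    have := hb x
    gcongr

/-- Reflection in x and t reduces this to φ for the solution -q̄(-t,-x). Time reversal is forced by
the conjugation, and it turns the phase e^{-it/2} into e^{it/2}. -/
lemma isJostChi (hq : RegularSolution q q' q'') (hδ : HasL2Bound (q 0) δ) (hδ1 : δ ^ 2 ≤ 1 / 8)
    {χ₁ χ₂ : ℝ → ℝ → ℂ} (h0 : IsJostChi (q 0) (χ₁ 0) (χ₂ 0)) (h : SolvesLaxTime q χ₁ χ₂) (t : ℝ) :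
    IsJostChi (q t) (fun x => Complex.exp (Complex.I * t / 2) * χ₁ t x)
      (fun x => Complex.exp (Complex.I * t / 2) * χ₂ t x) := by
  have hr := hq.reflect
  have hl : SolvesLaxTime (fun t x => -conj (q (-t) (-x))) (fun t x => -χ₂ (-t) (-x))
      (fun t x => χ₁ (-t) (-x)) := by
    refine ⟨fun s x => ?_, fun s x => ?_⟩
    · refine (((h.hasDerivAt_snd (-s) (-x)).scomp s (hasDerivAt_neg s)).neg).congr_deriv ?_
      rw [hr.deriv_eq, hq.deriv_eq]
      simp
      ring
    · refine ((h.hasDerivAt_fst (-s) (-x)).scomp s (hasDerivAt_neg s)).congr_deriv ?_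
      rw [hr.deriv_eq, hq.deriv_eq]
      simp
      ring
  have := hr.isJostPhi (φ₁ := fun t x => -χ₂ (-t) (-x)) (φ₂ := fun t x => χ₁ (-t) (-x))
    (δ := δ) (by simpa using hδ.reflect.neg) hδ1
    (by simpa using h0.isJostPhi_reflect) hl (-t)
  apply IsJostPhi.isJostChi_reflect
  simpa [neg_div] using this

end RegularSolution

/-! ### The Bäcklund transform of a solution of the Lax pair -/

/-- The differential equations for `p = ψ₁ ψ̄₂ / |ψ|²` and `k = (|ψ₁|² - |ψ₂|²) / |ψ|²` when `ψ` solves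
both equations of the Lax pair of `q`. -/
structure IsDarboux (q q' p k : ℝ → ℝ → ℂ) : Prop where
  space_p : ∀ t x, HasDerivAt (p t) (-(k t x * (q t x + p t x))) x
  space_k : ∀ t x, HasDerivAt (k t) (4 * (p t x * conj (p t x))
    + 2 * (conj (q t x) * p t x + q t x * conj (p t x))) x
  time_p : ∀ t x, HasDerivAt (fun s => p s x)
    (Complex.I * ((1 + 2 * (q t x * conj (q t x))) * p t x + q t x - q' t x * k t x
      + 2 * p t x * (conj (q t x) * p t x - q t x * conj (p t x)))) t
  continuous_k : ∀ x, Continuous fun t => k t x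
  conj_k : ∀ t x, conj (k t x) = k t x
  sq_k : ∀ t x, k t x ^ 2 = 1 - 4 * (p t x * conj (p t x))

/-- p and k are quotients of quadratic forms, homogeneous of degree zero in ψ, which is why the
equations close. The relation for k² is (|ψ₁|² - |ψ₂|²)² + 4|ψ₁|²|ψ₂|² = |ψ|⁴. -/
lemma isDarboux_of_lax {q q' q'' ψ₁ ψ₂ : ℝ → ℝ → ℂ} (hq : RegularSolution q q' q'')
    (hψ₁ : ∀ t x, HasDerivAt (ψ₁ t) (1 / 2 * ψ₁ t x + q t x * ψ₂ t x) x)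
    (hψ₂ : ∀ t x, HasDerivAt (ψ₂ t) (-conj (q t x) * ψ₁ t x - 1 / 2 * ψ₂ t x) x)
    (hψ : SolvesLaxTime q ψ₁ ψ₂) (hN : ∀ t x, ‖ψ₁ t x‖ ^ 2 + ‖ψ₂ t x‖ ^ 2 ≠ 0) :
    IsDarboux q q'
      (fun t x => ψ₁ t x * conj (ψ₂ t x) / (ψ₁ t x * conj (ψ₁ t x) + ψ₂ t x * conj (ψ₂ t x)))
      (fun t x => (ψ₁ t x * conj (ψ₁ t x) - ψ₂ t x * conj (ψ₂ t x))
        / (ψ₁ t x * conj (ψ₁ t x) + ψ₂ t x * conj (ψ₂ t x))) := by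
  have hN' : ∀ t x, ψ₁ t x * conj (ψ₁ t x) + ψ₂ t x * conj (ψ₂ t x) ≠ 0 := fun t x h => by
    rw [mul_conj_eq_norm, mul_conj_eq_norm] at h
    exact hN t x (by exact_mod_cast h)
  have c₁ : ∀ t x, HasDerivAt (fun y => conj (ψ₁ t y))
      (1 / 2 * conj (ψ₁ t x) + conj (q t x) * conj (ψ₂ t x)) x := fun t x => by
    refine (hasDerivAt_conj (hψ₁ t x)).congr_deriv ?_
    simp [map_ofNat]
  have c₂ : ∀ t x, HasDerivAt (fun y => conj (ψ₂ t y))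
      (-q t x * conj (ψ₁ t x) - 1 / 2 * conj (ψ₂ t x)) x := fun t x => by
    refine (hasDerivAt_conj (hψ₂ t x)).congr_deriv ?_
    simp [map_ofNat]
  have t₁ : ∀ t x, HasDerivAt (fun s => ψ₁ s x) (Complex.I * ((1 / 2 + q t x * conj (q t x))
      * ψ₁ t x + (q' t x + q t x) * ψ₂ t x)) t := fun t x => by
    refine (hψ.hasDerivAt_fst t x).congr_deriv ?_
    rw [hq.deriv_eq, mul_conj_eq_norm]
  have t₂ : ∀ t x, HasDerivAt (fun s => ψ₂ s x) (Complex.I * ((conj (q' t x) - conj (q t x))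
      * ψ₁ t x - (1 / 2 + q t x * conj (q t x)) * ψ₂ t x)) t := fun t x => by
    refine (hψ.hasDerivAt_snd t x).congr_deriv ?_
    rw [hq.deriv_eq, mul_conj_eq_norm]
  have u₁ : ∀ t x, HasDerivAt (fun s => conj (ψ₁ s x)) (-Complex.I * ((1 / 2 + q t x * conj (q t x))
      * conj (ψ₁ t x) + (conj (q' t x) + conj (q t x)) * conj (ψ₂ t x))) t := fun t x => by
    refine (hasDerivAt_conj (t₁ t x)).congr_deriv ?_
    simp only [map_mul, map_add, map_div₀, map_one, map_ofNat, Complex.conj_I, Complex.conj_conj]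
    ring
  have u₂ : ∀ t x, HasDerivAt (fun s => conj (ψ₂ s x)) (-Complex.I * ((q' t x - q t x)
      * conj (ψ₁ t x) - (1 / 2 + q t x * conj (q t x)) * conj (ψ₂ t x))) t := fun t x => by
    refine (hasDerivAt_conj (t₂ t x)).congr_deriv ?_
    simp only [map_mul, map_add, map_sub, map_div₀, map_one, map_ofNat, Complex.conj_I,
      Complex.conj_conj]
    ring
  refine ⟨fun t x => ?_, fun t x => ?_, fun t x => ?_, fun x => ?_, fun t x => ?_, fun t x => ?_⟩
  · have h := hN' t x
    refine (((hψ₁ t x).mul (c₂ t x)).div (((hψ₁ t x).mul (c₁ t x)).add ((hψ₂ t x).mul (c₂ t x)))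
      h).congr_deriv ?_
    simp only [Pi.mul_apply, Pi.add_apply]
    field_simp
    ring
  · have h := hN' t x
    refine ((((hψ₁ t x).mul (c₁ t x)).sub ((hψ₂ t x).mul (c₂ t x))).div
      (((hψ₁ t x).mul (c₁ t x)).add ((hψ₂ t x).mul (c₂ t x))) h).congr_deriv ?_
    simp only [Pi.mul_apply, Pi.add_apply, Pi.sub_apply, map_div₀, map_mul, map_add,
      Complex.conj_conj]
    -- Conjugating the denominator permutes its factors; `field_simp` needs the nonvanishing in this
    -- order as well.
    have h' : conj (ψ₁ t x) * ψ₁ t x + conj (ψ₂ t x) * ψ₂ t x ≠ 0 := by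
      rwa [mul_comm, mul_comm (conj (ψ₂ t x))]
    field_simp
    ring
  · have h := hN' t x
    refine (((t₁ t x).mul (u₂ t x)).div (((t₁ t x).mul (u₁ t x)).add ((t₂ t x).mul (u₂ t x)))
      h).congr_deriv ?_
    simp only [Pi.mul_apply, Pi.add_apply, map_div₀, map_mul, map_add, Complex.conj_conj]
    have h' : conj (ψ₁ t x) * ψ₁ t x + conj (ψ₂ t x) * ψ₂ t x ≠ 0 := by
      rwa [mul_comm, mul_comm (conj (ψ₂ t x))]
    field_simp
    ring
  · have cont : ∀ {f f' : ℝ → ℂ}, (∀ s, HasDerivAt f (f' s) s) → Continuous f := fun h =>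
      continuous_iff_continuousAt.2 fun s => (h s).continuousAt
    have k₁ := cont fun s => t₁ s x
    have k₂ := cont fun s => t₂ s x
    have k₃ := cont fun s => u₁ s x
    have k₄ := cont fun s => u₂ s x
    exact ((k₁.mul k₃).sub (k₂.mul k₄)).div ((k₁.mul k₃).add (k₂.mul k₄)) fun t => hN' t x
  · simp only [map_div₀, map_mul, map_add, map_sub, Complex.conj_conj, mul_comm]
  · have h := hN' t x
    have h' : conj (ψ₁ t x) * ψ₁ t x + conj (ψ₂ t x) * ψ₂ t x ≠ 0 := by
      rwa [mul_comm, mul_comm (conj (ψ₂ t x))]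
    simp only [map_div₀, map_mul, map_add, Complex.conj_conj]
    field_simp
    ring

namespace IsDarboux

variable {q q' q'' p k : ℝ → ℝ → ℂ}

lemma norm_sq_add (h : IsDarboux q q' p k) (t x : ℝ) : ‖k t x‖ ^ 2 + 4 * ‖p t x‖ ^ 2 = 1 := by
  have h1 := h.sq_k t x
  have h2 : k t x ^ 2 = (‖k t x‖ : ℂ) ^ 2 := by
    rw [← mul_conj_eq_norm, h.conj_k, sq]
  rw [h2, mul_conj_eq_norm] at h1
  have : ‖k t x‖ ^ 2 = 1 - 4 * ‖p t x‖ ^ 2 := by exact_mod_cast h1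
  linarith

lemma norm_k_le (h : IsDarboux q q' p k) (t x : ℝ) : ‖k t x‖ ≤ 1 := by
  nlinarith [h.norm_sq_add t x, norm_nonneg (k t x), norm_nonneg (p t x)]

lemma norm_p_le (h : IsDarboux q q' p k) (t x : ℝ) : ‖p t x‖ ≤ 1 := by
  nlinarith [h.norm_sq_add t x, norm_nonneg (k t x), norm_nonneg (p t x)]

end IsDarboux

/-- The derivative of `p` in `x`, for a Darboux pair `p`, `k`. -/
def darbouxP1 (q p k : ℝ → ℝ → ℂ) (t x : ℝ) : ℂ := -(k t x * (q t x + p t x))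

/-- The derivative of `k` in `x`, for a Darboux pair `p`, `k`. -/
def darbouxK1 (q p : ℝ → ℝ → ℂ) (t x : ℝ) : ℂ :=
  4 * (p t x * conj (p t x)) + 2 * (conj (q t x) * p t x + q t x * conj (p t x))

/-- The second derivative of `p` in `x`, for a Darboux pair `p`, `k`. -/
def darbouxP2 (q q' p k : ℝ → ℝ → ℂ) (t x : ℝ) : ℂ :=
  -(darbouxK1 q p t x * (q t x + p t x) + k t x * (q' t x + darbouxP1 q p k t x))

/-- The second derivative of `k` in `x`, for a Darboux pair `p`, `k`. -/
def darbouxK2 (q q' p k : ℝ → ℝ → ℂ) (t x : ℝ) : ℂ :=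
  4 * (darbouxP1 q p k t x * conj (p t x) + p t x * conj (darbouxP1 q p k t x))
    + 2 * ((conj (q' t x) * p t x + conj (q t x) * darbouxP1 q p k t x)
      + (q' t x * conj (p t x) + q t x * conj (darbouxP1 q p k t x)))

/-- The third derivative of `p` in `x`, for a Darboux pair `p`, `k`. -/
def darbouxP3 (q q' q'' p k : ℝ → ℝ → ℂ) (t x : ℝ) : ℂ :=
  -(darbouxK2 q q' p k t x * (q t x + p t x)
      + darbouxK1 q p t x * (q' t x + darbouxP1 q p k t x)
    + (darbouxK1 q p t x * (q' t x + darbouxP1 q p k t x)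
      + k t x * (q'' t x + darbouxP2 q q' p k t x)))

namespace IsDarboux

variable {q q' q'' p k : ℝ → ℝ → ℂ}

lemma hasDerivAt_p (h : IsDarboux q q' p k) (t x : ℝ) :
    HasDerivAt (p t) (darbouxP1 q p k t x) x := h.space_p t x

lemma hasDerivAt_k (h : IsDarboux q q' p k) (t x : ℝ) :
    HasDerivAt (k t) (darbouxK1 q p t x) x := h.space_k t x

lemma hasDerivAt_p1 (h : IsDarboux q q' p k) (hq : RegularSolution q q' q'') (t x : ℝ) :
    HasDerivAt (darbouxP1 q p k t) (darbouxP2 q q' p k t x) x :=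
  ((h.hasDerivAt_k t x).mul ((hq.hasDerivAt t x).add (h.hasDerivAt_p t x))).neg

lemma hasDerivAt_k1 (h : IsDarboux q q' p k) (hq : RegularSolution q q' q'') (t x : ℝ) :
    HasDerivAt (darbouxK1 q p t) (darbouxK2 q q' p k t x) x := by
  have h1 := h.hasDerivAt_p t x
  have h2 := hq.hasDerivAt t x
  exact ((h1.mul (hasDerivAt_conj h1)).const_mul 4).add
    ((((hasDerivAt_conj h2).mul h1).add (h2.mul (hasDerivAt_conj h1))).const_mul 2)

lemma hasDerivAt_p2 (h : IsDarboux q q' p k) (hq : RegularSolution q q' q'') (t x : ℝ) :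
    HasDerivAt (darbouxP2 q q' p k t) (darbouxP3 q q' q'' p k t x) x :=
  (((h.hasDerivAt_k1 hq t x).mul ((hq.hasDerivAt t x).add (h.hasDerivAt_p t x))).add
    ((h.hasDerivAt_k t x).mul ((hq.hasDerivAt' t x).add (h.hasDerivAt_p1 hq t x)))).neg

/-- After inserting the Darboux system all terms cancel except (q + p) times a combination of k² and
|p|², which the relation k² = 1 - 4|p|² removes. -/
lemma equation (h : IsDarboux q q' p k) (hq : RegularSolution q q' q'') (t x : ℝ) :
    let Q : ℝ → ℝ → ℂ := fun t x => -q t x - 2 * p t x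
    DifferentiableAt ℝ (fun s => Q s x) t ∧
    Complex.I * deriv (fun s => Q s x) t + deriv (deriv (Q t)) x
      + 2 * (‖Q t x‖ : ℂ) ^ 2 * Q t x = 0 := by
  intro Q
  have d1 : deriv (Q t) = fun y => -q' t y - 2 * darbouxP1 q p k t y := funext fun y =>
    ((hq.hasDerivAt t y).neg.sub ((h.hasDerivAt_p t y).const_mul 2)).deriv
  have d2 : deriv (deriv (Q t)) x = -q'' t x - 2 * darbouxP2 q q' p k t x := by
    rw [d1]
    exact ((hq.hasDerivAt' t x).neg.sub ((h.hasDerivAt_p1 hq t x).const_mul 2)).deriv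
  have dt := (hq.time t x).neg.sub ((h.time_p t x).const_mul 2)
  refine ⟨dt.differentiableAt, ?_⟩
  have dt' : deriv (fun s => Q s x) t = _ := dt.deriv
  rw [dt', d2, ← mul_conj_eq_norm, ← mul_conj_eq_norm]
  simp only [Q, darbouxP2, darbouxP1, darbouxK1, map_sub, map_neg, map_mul, map_ofNat]
  have hk := h.sq_k t x
  linear_combination (-q'' t x - 2 * (q t x * conj (q t x)) * q t x
    - 2 * ((1 + 2 * (q t x * conj (q t x))) * p t x + q t x - q' t x * k t x
      + 2 * p t x * (conj (q t x) * p t x - q t x * conj (p t x)))) * Complex.I_sq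
    - 2 * (q t x + p t x) * hk

end IsDarboux

/-! ### Bounded coefficients acting on curves in `L²(ℝ)` -/

/-- `k` is continuous in each variable and bounded, locally uniformly in time. -/
structure IsBoundedCoeff (k : ℝ → ℝ → ℂ) : Prop where
  space : ∀ t, Continuous (k t)
  time : ∀ x, Continuous fun t => k t x
  bound : ∀ T, ∃ K, 0 ≤ K ∧ ∀ t, |t| ≤ T → ∀ x, ‖k t x‖ ≤ K

namespace IsBoundedCoeff

variable {f g : ℝ → ℝ → ℂ}

lemma const (c : ℂ) : IsBoundedCoeff fun _ _ => c :=
  ⟨fun _ => continuous_const, fun _ => continuous_const, fun _ => ⟨‖c‖, norm_nonneg _, by simp⟩⟩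

lemma add (hf : IsBoundedCoeff f) (hg : IsBoundedCoeff g) :
    IsBoundedCoeff fun t x => f t x + g t x := by
  refine ⟨fun t => (hf.space t).add (hg.space t), fun x => (hf.time x).add (hg.time x), fun T => ?_⟩
  obtain ⟨K, h0, hK⟩ := hf.bound T
  obtain ⟨K', h0', hK'⟩ := hg.bound T
  exact ⟨K + K', by positivity, fun t ht x =>
    (norm_add_le _ _).trans (add_le_add (hK t ht x) (hK' t ht x))⟩

lemma mul (hf : IsBoundedCoeff f) (hg : IsBoundedCoeff g) :
    IsBoundedCoeff fun t x => f t x * g t x := by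
  refine ⟨fun t => (hf.space t).mul (hg.space t), fun x => (hf.time x).mul (hg.time x), fun T => ?_⟩
  obtain ⟨K, h0, hK⟩ := hf.bound T
  obtain ⟨K', h0', hK'⟩ := hg.bound T
  exact ⟨K * K', by positivity, fun t ht x =>
    (norm_mul_le _ _).trans (mul_le_mul (hK t ht x) (hK' t ht x) (norm_nonneg _) h0)⟩

lemma neg (hf : IsBoundedCoeff f) : IsBoundedCoeff fun t x => -f t x := by
  refine ⟨fun t => (hf.space t).neg, fun x => (hf.time x).neg, fun T => ?_⟩
  simpa only [norm_neg] using hf.bound T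

lemma star (hf : IsBoundedCoeff f) : IsBoundedCoeff fun t x => conj (f t x) := by
  refine ⟨fun t => Complex.continuous_conj.comp (hf.space t),
    fun x => Complex.continuous_conj.comp (hf.time x), fun T => ?_⟩
  simpa only [RCLike.norm_conj] using hf.bound T

end IsBoundedCoeff

lemma ContinuousInC0.isBoundedCoeff {f : ℝ → ℝ → ℂ} (hf : ContinuousInC0 f) : IsBoundedCoeff f :=
  ⟨hf.continuous, fun x =>
    hf.continuous_uncurry.comp (by fun_prop : Continuous fun t : ℝ => (t, x)), hf.exists_bound⟩

lemma eLpNorm_two_sq (f : ℝ → ℂ) (μ : Measure ℝ) : eLpNorm f 2 μ ^ 2 = ∫⁻ x, ‖f x‖ₑ ^ 2 ∂μ := by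
  rw [eLpNorm_eq_lintegral_rpow_enorm_toReal (by norm_num) (by norm_num), ← ENNReal.rpow_natCast,
    ← ENNReal.rpow_mul]
  simp

lemma tendsto_zero_of_sq_tendsto_zero {ι : Type*} {l : Filter ι} {u : ι → ENNReal}
    (h : Tendsto (fun i => u i ^ 2) l (𝓝 0)) : Tendsto u l (𝓝 0) := by
  have h2 := (ENNReal.continuous_rpow_const (y := (1 / 2 : ℝ))).tendsto 0
  rw [ENNReal.zero_rpow_of_pos (by norm_num)] at h2
  refine (h2.comp h).congr fun i => ?_
  rw [Function.comp, ← ENNReal.rpow_natCast, ← ENNReal.rpow_mul]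
  simp

namespace ContinuousInL2

variable {f g k : ℝ → ℝ → ℂ}

lemma add (hf : ContinuousInL2 f) (hg : ContinuousInL2 g) :
    ContinuousInL2 fun t x => f t x + g t x := by
  refine ⟨fun t => (hf.memLp t).add (hg.memLp t), fun t₀ => ?_⟩
  have h0 := (hf.tendsto t₀).add (hg.tendsto t₀)
  rw [add_zero] at h0
  refine tendsto_of_tendsto_of_tendsto_of_le_of_le tendsto_const_nhds h0 (fun _ => zero_le)
    fun t => ?_
  refine le_trans (le_of_eq ?_) (eLpNorm_add_le ((hf.memLp t).1.sub (hf.memLp t₀).1)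
    ((hg.memLp t).1.sub (hg.memLp t₀).1) (by norm_num))
  congr 1
  ext x
  simp only [Pi.sub_apply, Pi.add_apply]
  ring

/-- In k(t)(f(t) - f(t₀)) + (k(t) - k(t₀))f(t₀) the first term is small by boundedness of k, the
second by dominated convergence. Pointwise continuity of k in time is therefore enough. -/
lemma mul_left (hk : IsBoundedCoeff k) (hf : ContinuousInL2 f) :
    ContinuousInL2 fun t x => k t x * f t x := by
  have hm : ∀ t, AEStronglyMeasurable (k t) volume := fun t => (hk.space t).aestronglyMeasurable
  refine ⟨fun t => ?_, fun t₀ => ?_⟩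
  · obtain ⟨K, h0, hK⟩ := hk.bound |t|
    refine (hf.memLp t).of_le_mul (c := K) ((hm t).mul (hf.memLp t).1) (ae_of_all _ fun x => ?_)
    rw [norm_mul]
    exact mul_le_mul_of_nonneg_right (hK t le_rfl x) (norm_nonneg _)
  · obtain ⟨K, h0, hK⟩ := hk.bound (|t₀| + 1)
    have hnear : ∀ᶠ t in 𝓝 t₀, |t| ≤ |t₀| + 1 := by
      filter_upwards [continuous_abs.continuousAt.eventually
        (gt_mem_nhds (by linarith : |t₀| < |t₀| + 1))] with t ht using le_of_lt ht
    have h1 : Tendsto (fun t => ENNReal.ofReal K * eLpNorm (f t - f t₀) 2 volume) (𝓝 t₀) (𝓝 0) := by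
      simpa using ENNReal.Tendsto.const_mul (hf.tendsto t₀) (Or.inr ENNReal.ofReal_ne_top)
    have h2 : Tendsto (fun t => eLpNorm (fun x => (k t x - k t₀ x) * f t₀ x) 2 volume) (𝓝 t₀)
        (𝓝 0) := by
      refine tendsto_zero_of_sq_tendsto_zero ?_
      simp_rw [eLpNorm_two_sq]
      have hz : (0 : ENNReal) = ∫⁻ _ : ℝ, 0 := by simp
      rw [hz]
      refine tendsto_lintegral_filter_of_dominated_convergence'
        (fun x => (ENNReal.ofReal (2 * K) * ‖f t₀ x‖ₑ) ^ 2)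
        (Eventually.of_forall fun t => (((hm t).sub (hm t₀)).mul (hf.memLp t₀).1).enorm.pow_const 2)
        ?_ ?_ (ae_of_all _ fun x => ?_)
      · filter_upwards [hnear] with t ht
        refine ae_of_all _ fun x => ?_
        rw [enorm_mul]
        gcongr
        rw [← ofReal_norm]
        apply ENNReal.ofReal_le_ofReal
        refine (norm_sub_le _ _).trans ?_
        linarith [hK t ht x, hK t₀ (by linarith) x]
      · simp_rw [mul_pow]
        have hfin : ENNReal.ofReal (2 * K) ^ 2 ≠ ⊤ := ENNReal.pow_ne_top ENNReal.ofReal_ne_top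
        rw [lintegral_const_mul' _ _ hfin, ← eLpNorm_two_sq]
        exact ENNReal.mul_ne_top hfin (ENNReal.pow_ne_top (hf.memLp t₀).2.ne)
      · have : Tendsto (fun t => (k t x - k t₀ x) * f t₀ x) (𝓝 t₀) (𝓝 0) := by
          have := (((hk.time x).tendsto t₀).sub_const (k t₀ x)).mul_const (f t₀ x)
          rwa [sub_self, zero_mul] at this
        have h3 := (continuous_enorm.tendsto _).comp this
        simpa [Function.comp_def] using ((ENNReal.continuous_pow 2).tendsto _).comp h3
    have h3 := h1.add h2
    rw [add_zero] at h3
    refine tendsto_of_tendsto_of_tendsto_of_le_of_le' tendsto_const_nhds h3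
      (Eventually.of_forall fun _ => zero_le) ?_
    filter_upwards [hnear] with t ht
    have e : ((fun x => k t x * f t x) - fun x => k t₀ x * f t₀ x)
        = (fun x => k t x * (f t - f t₀) x) + fun x => (k t x - k t₀ x) * f t₀ x := by
      ext x
      simp only [Pi.sub_apply, Pi.add_apply]
      ring
    rw [e]
    refine (eLpNorm_add_le ((hm t).mul ((hf.memLp t).1.sub (hf.memLp t₀).1))
      (((hm t).sub (hm t₀)).mul (hf.memLp t₀).1) (by norm_num)).trans (add_le_add ?_ le_rfl)
    refine eLpNorm_le_mul_eLpNorm_of_ae_le_mul (ae_of_all _ fun x => ?_) 2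
    rw [Pi.mul_apply, norm_mul]
    exact mul_le_mul_of_nonneg_right (hK t ht x) (norm_nonneg _)

/-- A curve of functions whose time derivative is locally bounded in `L²` is continuous in `L²`. -/
lemma of_hasDerivAt_time {f' : ℝ → ℝ → ℂ} (hf : ∀ t, MemLp (f t) 2 volume)
    (h : ∀ t x, HasDerivAt (fun s => f s x) (f' t x) t) (ht : ∀ x, Continuous fun t => f' t x)
    (hx : ∀ t, Continuous (f' t))
    (hb : ∀ t₀, ∃ C : ENNReal, C ≠ ⊤ ∧ ∃ r > 0, ∀ s, |s - t₀| ≤ r → eLpNorm (f' s) 2 volume ≤ C) :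
    ContinuousInL2 f := by
  refine ⟨hf, fun t₀ => tendsto_zero_of_sq_tendsto_zero ?_⟩
  obtain ⟨C, hC, r, hr, hCr⟩ := hb t₀
  have hmeas : Measurable (Function.uncurry f') :=
    (measurable_uncurry_of_continuous_of_measurable (u := fun x t => f' t x) hx
      (fun x => (ht x).measurable)).comp measurable_swap
  -- Cauchy–Schwarz in time at each x, then Tonelli, bound the squared increment by C²|t - t₀|².
  have key : ∀ t, |t - t₀| ≤ r →
      eLpNorm (f t - f t₀) 2 volume ^ 2 ≤ ENNReal.ofReal |t - t₀| * (C ^ 2 * ENNReal.ofReal |t - t₀|) := by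
    intro t htr
    set μ := volume.restrict (Set.uIoc t₀ t) with hμ
    have hμ1 : μ Set.univ = ENNReal.ofReal |t - t₀| := by simp [hμ]
    have : IsFiniteMeasure μ := ⟨by rw [hμ1]; exact ENNReal.ofReal_lt_top⟩
    have h1 : ∀ x, ‖(f t - f t₀) x‖ₑ ^ 2 ≤ ENNReal.ofReal |t - t₀| * ∫⁻ s, ‖f' s x‖ₑ ^ 2 ∂μ := by
      intro x
      have e1 : (f t - f t₀) x = ∫ s in t₀..t, f' s x :=
        (intervalIntegral.integral_eq_sub_of_hasDerivAt (fun s _ => h s x)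
          ((ht x).intervalIntegrable _ _)).symm
      have e2 : ‖(f t - f t₀) x‖ₑ ≤ eLpNorm (fun s => f' s x) 1 μ := by
        rw [e1, eLpNorm_one_eq_lintegral_enorm, ← enorm_norm,
          intervalIntegral.norm_intervalIntegral_eq, enorm_norm]
        exact enorm_integral_le_lintegral_enorm _
      have e3 := eLpNorm_le_eLpNorm_mul_rpow_measure_univ (μ := μ) (f := fun s => f' s x)
        (p := 1) (q := 2) (by norm_num) (ht x).aestronglyMeasurable
      have e4 := pow_le_pow_left₀ zero_le (e2.trans e3) 2
      refine e4.trans (le_of_eq ?_)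
      rw [mul_pow, eLpNorm_two_sq, hμ1, ← ENNReal.rpow_natCast (_ ^ _), ← ENNReal.rpow_mul, mul_comm]
      norm_num
    calc eLpNorm (f t - f t₀) 2 volume ^ 2 = ∫⁻ x, ‖(f t - f t₀) x‖ₑ ^ 2 := eLpNorm_two_sq _ _
      _ ≤ ∫⁻ x, ENNReal.ofReal |t - t₀| * ∫⁻ s, ‖f' s x‖ₑ ^ 2 ∂μ := lintegral_mono h1
      _ = ENNReal.ofReal |t - t₀| * ∫⁻ x, ∫⁻ s, ‖f' s x‖ₑ ^ 2 ∂μ :=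
          lintegral_const_mul' _ _ ENNReal.ofReal_ne_top
      _ = ENNReal.ofReal |t - t₀| * ∫⁻ s, (∫⁻ x, ‖f' s x‖ₑ ^ 2) ∂μ := by
          rw [lintegral_lintegral_swap]
          exact ((hmeas.comp measurable_swap).enorm.pow_const 2).aemeasurable
      _ ≤ ENNReal.ofReal |t - t₀| * ∫⁻ _, C ^ 2 ∂μ := by
          gcongr ENNReal.ofReal |t - t₀| * ?_
          refine lintegral_mono_ae ((ae_restrict_iff' measurableSet_uIoc).2 (ae_of_all _ fun s hs => ?_))
          rw [← eLpNorm_two_sq]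
          have hs' : |s - t₀| ≤ r :=
            (Set.abs_sub_left_of_mem_uIcc (Set.uIoc_subset_uIcc hs)).trans htr
          gcongr
          exact hCr s hs'
      _ = _ := by rw [lintegral_const, hμ1]
  have hlim : Tendsto (fun t => ENNReal.ofReal |t - t₀| * (C ^ 2 * ENNReal.ofReal |t - t₀|)) (𝓝 t₀)
      (𝓝 0) := by
    have e : ∀ t, ENNReal.ofReal |t - t₀| * (C ^ 2 * ENNReal.ofReal |t - t₀|)
        = C ^ 2 * ENNReal.ofReal (|t - t₀| ^ 2) := fun t => by
      rw [ENNReal.ofReal_pow (abs_nonneg _)]; ring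
    simp_rw [e]
    have h0 : Tendsto (fun t => ENNReal.ofReal (|t - t₀| ^ 2)) (𝓝 t₀) (𝓝 0) := by
      have : Continuous fun t => ENNReal.ofReal (|t - t₀| ^ 2) :=
        ENNReal.continuous_ofReal.comp (by fun_prop)
      simpa using this.tendsto t₀
    simpa using ENNReal.Tendsto.const_mul h0 (Or.inr (ENNReal.pow_ne_top hC))
  refine tendsto_of_tendsto_of_tendsto_of_le_of_le' tendsto_const_nhds hlim
    (Eventually.of_forall fun _ => zero_le) ?_
  filter_upwards [Metric.closedBall_mem_nhds t₀ hr] with t ht'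
  exact key t (by simpa [Real.dist_eq] using ht')

lemma eventually_le (hf : ContinuousInL2 f) (t₀ : ℝ) :
    ∀ᶠ t in 𝓝 t₀, eLpNorm (f t) 2 volume ≤ 1 + eLpNorm (f t₀) 2 volume := by
  filter_upwards [(hf.tendsto t₀).eventually (gt_mem_nhds one_pos)] with t ht
  have := eLpNorm_add_le ((hf.memLp t).1.sub (hf.memLp t₀).1) (hf.memLp t₀).1
    (by norm_num : (1 : ENNReal) ≤ 2)
  rw [sub_add_cancel] at this
  exact this.trans (by gcongr)

end ContinuousInL2

/-! ### The Bäcklund transform is again a solution -/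

namespace IsDarboux

variable {q q' q'' p k : ℝ → ℝ → ℂ}

lemma isBoundedCoeff_p (h : IsDarboux q q' p k) : IsBoundedCoeff p :=
  ⟨fun t => continuous_iff_continuousAt.2 fun x => (h.space_p t x).continuousAt,
    fun x => continuous_iff_continuousAt.2 fun t => (h.time_p t x).continuousAt,
    fun _ => ⟨1, zero_le_one, fun t _ x => h.norm_p_le t x⟩⟩

lemma isBoundedCoeff_k (h : IsDarboux q q' p k) : IsBoundedCoeff k :=
  ⟨fun t => continuous_iff_continuousAt.2 fun x => (h.space_k t x).continuousAt, h.continuous_k,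
    fun _ => ⟨1, zero_le_one, fun t _ x => h.norm_k_le t x⟩⟩

/-- The time derivative of p is a bounded multiple of p, plus q, minus k q', up to the factor i; it
is locally bounded in L² once p is. -/
lemma continuousInL2_p (h : IsDarboux q q' p k) (hq : RegularSolution q q' q'')
    (hp : ∀ t, MemLp (p t) 2 volume) {M : ENNReal} (hM : M ≠ ⊤)
    (hpM : ∀ t, eLpNorm (p t) 2 volume ≤ M) : ContinuousInL2 p := by
  have bp := h.isBoundedCoeff_p
  have bk := h.isBoundedCoeff_k
  have bq := hq.c0.isBoundedCoeff
  have bq' := hq.c0'.isBoundedCoeff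
  have hcoef : IsBoundedCoeff fun t x => (1 + 2 * (q t x * conj (q t x)))
      + 2 * (conj (q t x) * p t x + -(q t x * conj (p t x))) :=
    ((IsBoundedCoeff.const 1).add ((IsBoundedCoeff.const 2).mul (bq.mul bq.star))).add
      ((IsBoundedCoeff.const 2).mul ((bq.star.mul bp).add (bq.mul bp.star).neg))
  have hall : IsBoundedCoeff fun t x => Complex.I * ((1 + 2 * (q t x * conj (q t x))) * p t x
      + q t x + -(q' t x * k t x)
      + 2 * p t x * (conj (q t x) * p t x + -(q t x * conj (p t x)))) :=
    (IsBoundedCoeff.const _).mul ((((((IsBoundedCoeff.const 1).add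
      ((IsBoundedCoeff.const 2).mul (bq.mul bq.star))).mul bp).add bq).add (bq'.mul bk).neg).add
      (((IsBoundedCoeff.const 2).mul bp).mul ((bq.star.mul bp).add (bq.mul bp.star).neg)))
  simp only [← sub_eq_add_neg] at hcoef hall
  refine .of_hasDerivAt_time hp h.time_p hall.time hall.space fun t₀ => ?_
  obtain ⟨K, hK0, hK⟩ := hcoef.bound (|t₀| + 1)
  obtain ⟨r₁, hr₁, H₁⟩ := Metric.eventually_nhds_iff.1 (hq.l2.eventually_le t₀)
  obtain ⟨r₂, hr₂, H₂⟩ := Metric.eventually_nhds_iff.1 (hq.l2'.eventually_le t₀)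
  refine ⟨ENNReal.ofReal K * M + (1 + eLpNorm (q t₀) 2 volume) + (1 + eLpNorm (q' t₀) 2 volume),
    ?_, min (min r₁ r₂ / 2) 1, by positivity, fun s hs => ?_⟩
  · have := (hq.l2.memLp t₀).2.ne
    have := (hq.l2'.memLp t₀).2.ne
    simp [ENNReal.mul_ne_top, *]
  · have hs1 : |s - t₀| ≤ 1 := hs.trans (min_le_right _ _)
    have hs2 : |s - t₀| < min r₁ r₂ :=
      (hs.trans (min_le_left _ _)).trans_lt (half_lt_self (lt_min hr₁ hr₂))
    have hs3 : |s| ≤ |t₀| + 1 := by linarith [abs_sub_abs_le_abs_sub s t₀]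
    have n1 := H₁ (y := s) (by rw [Real.dist_eq]; exact hs2.trans_le (min_le_left _ _))
    have n2 := H₂ (y := s) (by rw [Real.dist_eq]; exact hs2.trans_le (min_le_right _ _))
    have mq := (hq.l2.memLp s).1
    have mq' := (hq.l2'.memLp s).1
    have mp := (hp s).1
    refine (eLpNorm_mono_real (g := fun x => K * ‖p s x‖ + ‖q s x‖ + ‖q' s x‖) fun x => ?_).trans ?_
    · rw [norm_mul, Complex.norm_I, one_mul]
      have e : (1 + 2 * (q s x * conj (q s x))) * p s x + q s x - q' s x * k s x
          + 2 * p s x * (conj (q s x) * p s x - q s x * conj (p s x))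
          = ((1 + 2 * (q s x * conj (q s x)))
            + 2 * (conj (q s x) * p s x - q s x * conj (p s x))) * p s x
            + q s x - q' s x * k s x := by ring
      rw [e]
      refine (norm_sub_le _ _).trans (add_le_add ((norm_add_le _ _).trans (add_le_add ?_ le_rfl)) ?_)
      · rw [norm_mul]
        exact mul_le_mul_of_nonneg_right (hK s hs3 x) (norm_nonneg _)
      · rw [norm_mul]
        exact mul_le_of_le_one_right (norm_nonneg _) (h.norm_k_le s x)
    · refine (eLpNorm_add_le ((mp.norm.const_mul K).add mq.norm) mq'.norm (by norm_num)).trans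
        (add_le_add ((eLpNorm_add_le (mp.norm.const_mul K) mq.norm (by norm_num)).trans
          (add_le_add ?_ ?_)) ?_)
      · refine (eLpNorm_le_mul_eLpNorm_of_ae_le_mul (c := K) (g := p s)
          (ae_of_all _ fun x => ?_) 2).trans ?_
        · rw [norm_mul, norm_norm, Real.norm_eq_abs, abs_of_nonneg hK0]
        · gcongr
          exact hpM s
      · rwa [eLpNorm_norm]
      · rwa [eLpNorm_norm]

/-- In each derivative of p one factor is kept in L² and the others serve as bounded coefficients.
The third derivative of p involves q only up to q'', so q₃ enters only through q itself. -/
lemma isH3SolutionNLS (h : IsDarboux q q' p k) (hq : RegularSolution q q' q'') {q₃ : ℝ → ℝ → ℂ}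
    (hq₃ : ContinuousInL2 q₃) (hw : ∀ t, IsWeakDeriv (q'' t) (q₃ t)) (hp : ContinuousInL2 p) :
    IsH3SolutionNLS fun t x => -q t x - 2 * p t x := by
  have bp := h.isBoundedCoeff_p
  have bk := h.isBoundedCoeff_k
  have bq := hq.c0.isBoundedCoeff
  have bq' := hq.c0'.isBoundedCoeff
  have bq'' := hq.c0''.isBoundedCoeff
  have b2 := IsBoundedCoeff.const 2
  have b4 := IsBoundedCoeff.const 4
  have bp1 : IsBoundedCoeff (darbouxP1 q p k) := (bk.mul (bq.add bp)).neg
  have bk1 : IsBoundedCoeff (darbouxK1 q p) :=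
    (b4.mul (bp.mul bp.star)).add (b2.mul ((bq.star.mul bp).add (bq.mul bp.star)))
  have bp2 : IsBoundedCoeff (darbouxP2 q q' p k) :=
    ((bk1.mul (bq.add bp)).add (bk.mul (bq'.add bp1))).neg
  have bk2 : IsBoundedCoeff (darbouxK2 q q' p k) :=
    (b4.mul ((bp1.mul bp.star).add (bp.mul bp1.star))).add (b2.mul
      (((bq'.star.mul bp).add (bq.star.mul bp1)).add ((bq'.mul bp.star).add (bq.mul bp1.star))))
  have bp3 : IsBoundedCoeff (darbouxP3 q q' q'' p k) :=
    (((bk2.mul (bq.add bp)).add (bk1.mul (bq'.add bp1))).add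
      ((bk1.mul (bq'.add bp1)).add (bk.mul (bq''.add bp2)))).neg
  have l1 : ContinuousInL2 (darbouxP1 q p k) := (ContinuousInL2.mul_left bk (hq.l2.add hp)).neg
  have l2 : ContinuousInL2 (darbouxP2 q q' p k) :=
    ((ContinuousInL2.mul_left bk1 (hq.l2.add hp)).add
      (ContinuousInL2.mul_left bk (hq.l2'.add l1))).neg
  have l3 : ContinuousInL2 (darbouxP3 q q' q'' p k) :=
    (((ContinuousInL2.mul_left bk2 (hq.l2.add hp)).add
      (ContinuousInL2.mul_left bk1 (hq.l2'.add l1))).add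
      ((ContinuousInL2.mul_left bk1 (hq.l2'.add l1)).add
        (ContinuousInL2.mul_left bk (hq.l2''.add l2)))).neg
  have comb : ∀ {f g : ℝ → ℝ → ℂ}, ContinuousInL2 f → ContinuousInL2 g →
      ContinuousInL2 fun t x => -f t x - 2 * g t x := fun hf hg => by
    simpa only [sub_eq_add_neg] using hf.neg.add (ContinuousInL2.mul_left b2 hg).neg
  have weak : ∀ {f f' g g' : ℝ → ℂ}, IsWeakDeriv f f' → (∀ x, HasDerivAt g (g' x) x) →
      Continuous g' → IsWeakDeriv (fun x => -f x - 2 * g x) (fun x => -f' x - 2 * g' x) :=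
    fun hf hg hg' => hf.neg.sub
      (isWeakDeriv_of_hasDerivAt (fun x => (hg x).const_mul 2) (continuous_const.mul hg'))
  refine ⟨⟨fun t => (bq.space t).neg.sub (continuous_const.mul (bp.space t)), fun j => match j with
    | 0 => fun t x => -q t x - 2 * p t x
    | 1 => fun t x => -q' t x - 2 * darbouxP1 q p k t x
    | 2 => fun t x => -q'' t x - 2 * darbouxP2 q q' p k t x
    | _ => fun t x => -q₃ t x - 2 * darbouxP3 q q' q'' p k t x, rfl, ?_, ?_, ?_⟩,
    fun t x => (h.equation hq t x).1, fun t x => (h.equation hq t x).2⟩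
  · intro j hj t
    interval_cases j
    · exact weak (isWeakDeriv_of_hasDerivAt (hq.hasDerivAt t) (bq'.space t)) (h.hasDerivAt_p t)
        (bp1.space t)
    · exact weak (isWeakDeriv_of_hasDerivAt (hq.hasDerivAt' t) (bq''.space t))
        (h.hasDerivAt_p1 hq t) (bp2.space t)
    · exact weak (hw t) (h.hasDerivAt_p2 hq t) (bp3.space t)
  · intro j hj
    interval_cases j
    · exact (comb hq.l2 hp).memLp
    · exact (comb hq.l2' l1).memLp
    · exact (comb hq.l2'' l2).memLp
    · exact (comb hq₃ l3).memLp
  · intro j hj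
    interval_cases j
    · exact (comb hq.l2 hp).tendsto
    · exact (comb hq.l2' l1).tendsto
    · exact (comb hq.l2'' l2).tendsto
    · exact (comb hq₃ l3).tendsto

end IsDarboux

/-! ### Distance of the Bäcklund transform to the soliton -/

lemma norm_mul_conj_sub_one_le {z : ℂ} {η : ℝ} (hz : ‖z - 1‖ ≤ η) (hη : η ≤ 1) :
    ‖z * conj z - 1‖ ≤ 3 * η := by
  have e : z * conj z - 1 = (z - 1) * conj z + conj (z - 1) := by
    simp only [map_sub, map_one]; ring
  have h1 : ‖z‖ ≤ 2 := by
    have := norm_le_norm_add_norm_sub' z 1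
    rw [norm_one] at this
    linarith
  rw [e]
  refine (norm_add_le _ _).trans ?_
  rw [norm_mul, RCLike.norm_conj, RCLike.norm_conj]
  nlinarith [norm_nonneg (z - 1), norm_nonneg z]

/-- The linear combination `e^z f + e^{-z} c` for `z = (s + iα)/2`. -/
def expComb (s α : ℝ) (f c : ℂ) : ℂ :=
  Complex.exp ((s + Complex.I * α) / 2) * f + Complex.exp (-(s + Complex.I * α) / 2) * c

lemma conj_exp_half (s α : ℝ) : conj (Complex.exp ((s + Complex.I * α) / 2))
    = Complex.exp ((s - Complex.I * α) / 2) := by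
  rw [← Complex.exp_conj]
  congr 1
  simp only [map_div₀, map_add, map_mul, Complex.conj_ofReal, Complex.conj_I, map_ofNat]
  ring

lemma conj_exp_neg_half (s α : ℝ) : conj (Complex.exp (-(s + Complex.I * α) / 2))
    = Complex.exp (-(s - Complex.I * α) / 2) := by
  rw [← Complex.exp_conj]
  congr 1
  simp only [map_div₀, map_neg, map_add, map_mul, Complex.conj_ofReal, Complex.conj_I, map_ofNat]
  ring

/-- This separates the terms growing like e^{±s} from the cross terms, whose prefactors have modulus
one. The soliton comes from the cross term f c̄' with f near 1 and c' near -1. -/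
lemma expComb_mul_conj (s α : ℝ) (f c f' c' : ℂ) :
    expComb s α f c * conj (expComb s α f' c')
      = (Real.exp s : ℂ) * (f * conj f') + (Real.exp (-s) : ℂ) * (c * conj c')
        + Complex.exp (Complex.I * α) * (f * conj c')
        + Complex.exp (-(Complex.I * α)) * (c * conj f') := by
  have e1 : (Real.exp s : ℂ) = Complex.exp ((s + Complex.I * α) / 2)
      * Complex.exp ((s - Complex.I * α) / 2) := by
    rw [← Complex.exp_add, Complex.ofReal_exp]; congr 1; ring
  have e2 : (Real.exp (-s) : ℂ) = Complex.exp (-(s + Complex.I * α) / 2)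
      * Complex.exp (-(s - Complex.I * α) / 2) := by
    rw [← Complex.exp_add, Complex.ofReal_exp]; congr 1; push_cast; ring
  have e3 : Complex.exp (Complex.I * α) = Complex.exp ((s + Complex.I * α) / 2)
      * Complex.exp (-(s - Complex.I * α) / 2) := by
    rw [← Complex.exp_add]; congr 1; ring
  have e4 : Complex.exp (-(Complex.I * α)) = Complex.exp (-(s + Complex.I * α) / 2)
      * Complex.exp ((s - Complex.I * α) / 2) := by
    rw [← Complex.exp_add]; congr 1; ring
  rw [e1, e2, e3, e4]
  simp only [expComb, map_add, map_mul, conj_exp_half, conj_exp_neg_half]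
  ring

lemma norm_exp_I_mul (α : ℝ) : ‖Complex.exp (Complex.I * α)‖ = 1 := by
  rw [mul_comm, Complex.norm_exp_ofReal_mul_I]

lemma norm_exp_neg_I_mul (α : ℝ) : ‖Complex.exp (-(Complex.I * α))‖ = 1 := by
  have : -(Complex.I * α) = Complex.I * ((-α : ℝ) : ℂ) := by push_cast; ring
  rw [this, norm_exp_I_mul]

section Pointwise

variable {f₁ f₂ c₁ c₂ : ℂ} {δ s α : ℝ}

/-- The unperturbed value is e^s + e^{-s} = 2 cosh s. The diagonal errors carry this weight and give
2·27δ² and 2(|f₂| + |c₁|); the cross terms give 4(|f₂| + |c₁|), using 1 ≤ cosh s. -/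
lemma norm_normSq_sub_le (hδ : δ ≤ 1 / 1000) (hδ0 : 0 ≤ δ) (h₁ : ‖f₁ - 1‖ ≤ 9 * δ ^ 2)
    (h₂ : ‖f₂‖ ≤ 8 * δ) (h₃ : ‖c₁‖ ≤ 8 * δ) (h₄ : ‖c₂ + 1‖ ≤ 9 * δ ^ 2) :
    |‖expComb s α f₁ c₁‖ ^ 2 + ‖expComb s α f₂ c₂‖ ^ 2 - 2 * Real.cosh s|
      ≤ Real.cosh s * (54 * δ ^ 2 + 6 * (‖f₂‖ + ‖c₁‖)) := by
  have hη : 9 * δ ^ 2 ≤ 1 := by nlinarith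
  have hcosh : 2 * Real.cosh s = Real.exp s + Real.exp (-s) := by rw [Real.cosh_eq]; ring
  have h1c : 1 ≤ Real.cosh s := Real.one_le_cosh s
  set u := Real.exp s with hu
  set w := Real.exp (-s) with hw
  have hu0 : 0 < u := Real.exp_pos _
  have hw0 : 0 < w := Real.exp_pos _
  have n1 : ‖f₁‖ ≤ 2 := by
    have := norm_le_norm_add_norm_sub' f₁ 1
    rw [norm_one] at this
    linarith
  have n4 : ‖c₂‖ ≤ 2 := by
    have := norm_le_norm_add_norm_sub' c₂ (-1)
    rw [norm_neg, norm_one, sub_neg_eq_add] at this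
    linarith
  have m1 := norm_mul_conj_sub_one_le h₁ hη
  have m4 : ‖c₂ * conj c₂ - 1‖ ≤ 3 * (9 * δ ^ 2) := by
    have := norm_mul_conj_sub_one_le (z := -c₂) (η := 9 * δ ^ 2)
      (by rw [← norm_neg]; simpa [add_comm] using h₄) hη
    simpa using this
  have e : (((‖expComb s α f₁ c₁‖ ^ 2 + ‖expComb s α f₂ c₂‖ ^ 2 - 2 * Real.cosh s : ℝ)) : ℂ)
      = (u : ℂ) * ((f₁ * conj f₁ - 1) + f₂ * conj f₂) + (w : ℂ) * (c₁ * conj c₁ + (c₂ * conj c₂ - 1))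
        + (Complex.exp (Complex.I * α) * (f₁ * conj c₁ + f₂ * conj c₂)
        + Complex.exp (-(Complex.I * α)) * (c₁ * conj f₁ + c₂ * conj f₂)) := by
    rw [hcosh]
    push_cast
    rw [← mul_conj_eq_norm, ← mul_conj_eq_norm, expComb_mul_conj, expComb_mul_conj]
    ring
  rw [← Real.norm_eq_abs, ← Complex.norm_real, e]
  have t1 : ‖(u : ℂ) * ((f₁ * conj f₁ - 1) + f₂ * conj f₂)‖ ≤ u * (27 * δ ^ 2 + ‖f₂‖) := by
    rw [norm_mul, Complex.norm_real, Real.norm_eq_abs, abs_of_pos hu0]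
    refine mul_le_mul_of_nonneg_left ((norm_add_le _ _).trans ?_) hu0.le
    rw [norm_mul, RCLike.norm_conj]
    nlinarith [norm_nonneg f₂]
  have t2 : ‖(w : ℂ) * (c₁ * conj c₁ + (c₂ * conj c₂ - 1))‖ ≤ w * (27 * δ ^ 2 + ‖c₁‖) := by
    rw [norm_mul, Complex.norm_real, Real.norm_eq_abs, abs_of_pos hw0]
    refine mul_le_mul_of_nonneg_left ((norm_add_le _ _).trans ?_) hw0.le
    rw [norm_mul, RCLike.norm_conj]
    nlinarith [norm_nonneg c₁]
  have t3 : ‖Complex.exp (Complex.I * α) * (f₁ * conj c₁ + f₂ * conj c₂)‖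
      ≤ 2 * (‖f₂‖ + ‖c₁‖) := by
    rw [norm_mul, norm_exp_I_mul, one_mul]
    refine (norm_add_le _ _).trans ?_
    rw [norm_mul, norm_mul, RCLike.norm_conj, RCLike.norm_conj]
    nlinarith [norm_nonneg c₁, norm_nonneg f₂]
  have t4 : ‖Complex.exp (-(Complex.I * α)) * (c₁ * conj f₁ + c₂ * conj f₂)‖
      ≤ 2 * (‖f₂‖ + ‖c₁‖) := by
    rw [norm_mul, norm_exp_neg_I_mul, one_mul]
    refine (norm_add_le _ _).trans ?_
    rw [norm_mul, norm_mul, RCLike.norm_conj, RCLike.norm_conj]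
    nlinarith [norm_nonneg c₁, norm_nonneg f₂]
  refine (norm_add_le _ _).trans ((add_le_add ((norm_add_le _ _).trans (add_le_add t1 t2))
    ((norm_add_le _ _).trans (add_le_add t3 t4))).trans ?_)
  have hf := norm_nonneg f₂
  have hc := norm_nonneg c₁
  have k1 : (‖f₂‖ + ‖c₁‖) ≤ Real.cosh s * (‖f₂‖ + ‖c₁‖) := le_mul_of_one_le_left (by positivity) h1c
  have k2 : u * ‖f₂‖ ≤ (u + w) * ‖f₂‖ := by gcongr; linarith
  have k3 : w * ‖c₁‖ ≤ (u + w) * ‖c₁‖ := by gcongr; linarith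
  rw [← hcosh] at k2 k3
  have k4 : u * (27 * δ ^ 2) + w * (27 * δ ^ 2) = Real.cosh s * (54 * δ ^ 2) := by
    rw [← add_mul, ← hcosh]; ring
  linarith

/-- The relative error is at most 54δ² + 96δ ≤ 1 for δ ≤ 1/1000, so at least half of 2 cosh s
remains. -/
lemma cosh_le_normSq (hδ : δ ≤ 1 / 1000) (hδ0 : 0 ≤ δ) (h₁ : ‖f₁ - 1‖ ≤ 9 * δ ^ 2)
    (h₂ : ‖f₂‖ ≤ 8 * δ) (h₃ : ‖c₁‖ ≤ 8 * δ) (h₄ : ‖c₂ + 1‖ ≤ 9 * δ ^ 2) :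
    Real.cosh s ≤ ‖expComb s α f₁ c₁‖ ^ 2 + ‖expComb s α f₂ c₂‖ ^ 2 := by
  have h := (abs_le.1 (norm_normSq_sub_le (s := s) (α := α) hδ hδ0 h₁ h₂ h₃ h₄)).1
  have h1c : 1 ≤ Real.cosh s := Real.one_le_cosh s
  have h5 : 54 * δ ^ 2 + 6 * (‖f₂‖ + ‖c₁‖) ≤ 1 := by nlinarith
  have := mul_le_mul_of_nonneg_left h5 (by linarith : 0 ≤ Real.cosh s)
  linarith

/-- Terms of the numerator that grow with s contain f₂ or c₁, and division by |ψ|² ≥ cosh s cancels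
the growth. The other errors are O(δ²) and retain a factor sech s, so both kinds are square
integrable in x. -/
lemma norm_backlund_sub_soliton_le (hδ : δ ≤ 1 / 1000) (hδ0 : 0 ≤ δ) (h₁ : ‖f₁ - 1‖ ≤ 9 * δ ^ 2)
    (h₂ : ‖f₂‖ ≤ 8 * δ) (h₃ : ‖c₁‖ ≤ 8 * δ) (h₄ : ‖c₂ + 1‖ ≤ 9 * δ ^ 2) :
    ‖-(2 * (expComb s α f₁ c₁ * conj (expComb s α f₂ c₂)
        / ((‖expComb s α f₁ c₁‖ ^ 2 + ‖expComb s α f₂ c₂‖ ^ 2 : ℝ) : ℂ)))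
      - Complex.exp (Complex.I * α) * (sech s : ℂ)‖
      ≤ 16 * (‖f₂‖ + ‖c₁‖) + 108 * δ * sech s := by
  have hη : 9 * δ ^ 2 ≤ 1 := by nlinarith
  have hcosh : 2 * Real.cosh s = Real.exp s + Real.exp (-s) := by rw [Real.cosh_eq]; ring
  have h1c : 1 ≤ Real.cosh s := Real.one_le_cosh s
  have hn := cosh_le_normSq (s := s) (α := α) hδ hδ0 h₁ h₂ h₃ h₄
  have hd := norm_normSq_sub_le (s := s) (α := α) hδ hδ0 h₁ h₂ h₃ h₄
  set n := ‖expComb s α f₁ c₁‖ ^ 2 + ‖expComb s α f₂ c₂‖ ^ 2 with hndef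
  set ϑ := Complex.exp (Complex.I * α) with hϑ
  set C := Real.cosh s with hC
  have hu0 : 0 < Real.exp s := Real.exp_pos _
  have hw0 : 0 < Real.exp (-s) := Real.exp_pos _
  have hC0 : 0 < C := by linarith
  have hn0 : 0 < n := by linarith
  have hf := norm_nonneg f₂
  have hc := norm_nonneg c₁
  have n1 : ‖f₁‖ ≤ 2 := by
    have := norm_le_norm_add_norm_sub' f₁ 1
    rw [norm_one] at this
    linarith
  have n4 : ‖c₂‖ ≤ 2 := by
    have := norm_le_norm_add_norm_sub' c₂ (-1)
    rw [norm_neg, norm_one, sub_neg_eq_add] at this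
    linarith
  have num : ‖expComb s α f₁ c₁ * conj (expComb s α f₂ c₂) + ϑ‖
      ≤ 5 * C * (‖f₂‖ + ‖c₁‖) + 27 * δ ^ 2 := by
    rw [expComb_mul_conj]
    have e : (Real.exp s : ℂ) * (f₁ * conj f₂) + (Real.exp (-s) : ℂ) * (c₁ * conj c₂)
        + ϑ * (f₁ * conj c₂) + Complex.exp (-(Complex.I * α)) * (c₁ * conj f₂) + ϑ
        = ((Real.exp s : ℂ) * (f₁ * conj f₂) + (Real.exp (-s) : ℂ) * (c₁ * conj c₂))
        + (ϑ * ((f₁ - 1) * conj c₂ + conj (c₂ + 1))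
          + Complex.exp (-(Complex.I * α)) * (c₁ * conj f₂)) := by
      simp only [map_add, map_one]
      ring
    rw [e]
    have t1 : ‖(Real.exp s : ℂ) * (f₁ * conj f₂)‖ ≤ Real.exp s * (2 * ‖f₂‖) := by
      rw [norm_mul, Complex.norm_real, Real.norm_eq_abs, abs_of_pos hu0, norm_mul, RCLike.norm_conj]
      gcongr
    have t2 : ‖(Real.exp (-s) : ℂ) * (c₁ * conj c₂)‖ ≤ Real.exp (-s) * (2 * ‖c₁‖) := by
      rw [norm_mul, Complex.norm_real, Real.norm_eq_abs, abs_of_pos hw0, norm_mul, RCLike.norm_conj,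
        mul_comm ‖c₁‖]
      gcongr
    have t3 : ‖ϑ * ((f₁ - 1) * conj c₂ + conj (c₂ + 1))‖ ≤ 27 * δ ^ 2 := by
      rw [norm_mul, hϑ, norm_exp_I_mul, one_mul]
      refine (norm_add_le _ _).trans ?_
      rw [norm_mul, RCLike.norm_conj, RCLike.norm_conj]
      nlinarith [norm_nonneg (f₁ - 1), norm_nonneg c₂]
    have t4 : ‖Complex.exp (-(Complex.I * α)) * (c₁ * conj f₂)‖ ≤ ‖f₂‖ := by
      rw [norm_mul, norm_exp_neg_I_mul, one_mul, norm_mul, RCLike.norm_conj]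
      exact mul_le_of_le_one_left hf (by linarith)
    refine (norm_add_le _ _).trans ((add_le_add ((norm_add_le _ _).trans (add_le_add t1 t2))
      ((norm_add_le _ _).trans (add_le_add t3 t4))).trans ?_)
    have k1 : ‖f₂‖ ≤ C * ‖f₂‖ := le_mul_of_one_le_left hf h1c
    have k2 : Real.exp s * (2 * ‖f₂‖) ≤ (2 * C) * (2 * ‖f₂‖) := by gcongr; linarith
    have k3 : Real.exp (-s) * (2 * ‖c₁‖) ≤ (2 * C) * (2 * ‖c₁‖) := by gcongr; linarith
    have k4 : 0 ≤ C * ‖c₁‖ := by positivity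
    linarith
  set P := expComb s α f₁ c₁ * conj (expComb s α f₂ c₂) with hP
  have hnC : (n : ℂ) ≠ 0 := by exact_mod_cast hn0.ne'
  have hCC : (C : ℂ) ≠ 0 := by exact_mod_cast hC0.ne'
  -- The error is split into that of the numerator, P + ϑ, and that of the denominator, n - 2C. They
  -- contribute 10 + 6 to the constant 16 and 54 + 54 to the constant 108.
  have e : -(2 * (P / (n : ℂ))) - ϑ * (sech s : ℂ)
      = -(2 * ((P + ϑ) / (n : ℂ))) - ϑ * ((n - 2 * C : ℝ) / ((n * C : ℝ) : ℂ)) := by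
    simp only [sech, ← hC]
    push_cast
    field_simp
    ring
  rw [e]
  refine (norm_sub_le _ _).trans ?_
  have b1 : ‖-(2 * ((P + ϑ) / (n : ℂ)))‖ ≤ 2 * ((5 * C * (‖f₂‖ + ‖c₁‖) + 27 * δ ^ 2) / C) := by
    rw [norm_neg, norm_mul, norm_div, Complex.norm_real, Real.norm_eq_abs, abs_of_pos hn0,
      Complex.norm_ofNat]
    gcongr
  have b2 : ‖ϑ * ((n - 2 * C : ℝ) / ((n * C : ℝ) : ℂ))‖
      ≤ C * (54 * δ ^ 2 + 6 * (‖f₂‖ + ‖c₁‖)) / (C * C) := by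
    rw [norm_mul, hϑ, norm_exp_I_mul, one_mul, norm_div, Complex.norm_real, Complex.norm_real,
      Real.norm_eq_abs, Real.norm_eq_abs, abs_of_pos (mul_pos hn0 hC0)]
    gcongr
  refine (add_le_add b1 b2).trans ?_
  have e2 : 2 * ((5 * C * (‖f₂‖ + ‖c₁‖) + 27 * δ ^ 2) / C)
      + C * (54 * δ ^ 2 + 6 * (‖f₂‖ + ‖c₁‖)) / (C * C)
      = 10 * (‖f₂‖ + ‖c₁‖) + 6 * (‖f₂‖ + ‖c₁‖) * sech s + 108 * δ ^ 2 * sech s := by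
    simp only [sech, ← hC]
    field_simp
    ring
  rw [e2]
  have hs1 : sech s ≤ 1 := by
    rw [sech, ← hC]
    exact (div_le_one hC0).2 h1c
  have hs0 : 0 ≤ sech s := by
    rw [sech, ← hC]
    positivity
  have k1 : 6 * (‖f₂‖ + ‖c₁‖) * sech s ≤ 6 * (‖f₂‖ + ‖c₁‖) :=
    mul_le_of_le_one_right (by positivity) hs1
  have k2 : 108 * δ ^ 2 * sech s ≤ 108 * δ * sech s := by
    gcongr
    nlinarith
  linarith

end Pointwise

/-! ### Square integrability of the soliton -/

lemma sech_nonneg (x : ℝ) : 0 ≤ sech x := by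
  have := Real.cosh_pos x
  rw [sech]
  positivity

lemma continuous_sech : Continuous sech :=
  continuous_const.div Real.continuous_cosh fun x => (Real.cosh_pos x).ne'

lemma memLp_sech : MemLp sech 2 volume := by
  rw [memLp_two_iff_integrable_sq continuous_sech.aestronglyMeasurable]
  refine integrable_inv_one_add_sq.mono' (continuous_sech.pow 2).aestronglyMeasurable
    (ae_of_all _ fun x => ?_)
  rw [Real.norm_of_nonneg (sq_nonneg _), sech, div_pow, one_pow, one_div, Real.cosh_sq']
  have h : x ^ 2 ≤ Real.sinh x ^ 2 := by
    rw [sq_le_sq, Real.abs_sinh]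
    exact Real.self_le_sinh_iff.2 (abs_nonneg x)
  gcongr

lemma eLpNorm_sech_add (γ : ℝ) :
    eLpNorm (fun x => sech (x + γ)) 2 volume = eLpNorm sech 2 volume :=
  eLpNorm_comp_measurePreserving continuous_sech.aestronglyMeasurable
    (measurePreserving_add_right volume γ)

/-! ### L² norms and the conserved bound on the potential -/

lemma eLpNorm_two_sq_eq_ofReal {f : ℝ → ℂ} (hf : MemLp f 2 volume) :
    eLpNorm f 2 volume ^ 2 = ENNReal.ofReal (∫ x, ‖f x‖ ^ 2) := by
  rw [eLpNorm_two_sq, ofReal_integral_eq_lintegral_ofReal (integrable_normSq hf)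
    (ae_of_all _ fun x => by positivity)]
  refine lintegral_congr fun x => ?_
  rw [ENNReal.ofReal_pow (norm_nonneg _), ofReal_norm]

lemma HasL2Bound.eLpNorm_le {f : ℝ → ℂ} {δ : ℝ} (h : HasL2Bound f δ) :
    eLpNorm f 2 volume ≤ ENNReal.ofReal δ := by
  have h1 : eLpNorm f 2 volume ^ 2 ≤ ENNReal.ofReal δ ^ 2 := by
    rw [eLpNorm_two_sq_eq_ofReal h.memLp, ← ENNReal.ofReal_pow h.nonneg]
    exact ENNReal.ofReal_le_ofReal h.integral_le
  exact (ENNReal.pow_le_pow_left_iff two_ne_zero).1 h1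

/-- Conservation of mass: the same δ serves at all times, which makes the final estimate uniform in
t. -/
lemma RegularSolution.hasL2Bound {q q' q'' : ℝ → ℝ → ℂ} (hq : RegularSolution q q' q'') (t : ℝ) :
    HasL2Bound (q t) (eLpNorm (q 0) 2 volume).toReal := by
  refine ⟨hq.c0.continuous t, ENNReal.toReal_nonneg, integrable_normSq (hq.l2.memLp t), ?_⟩
  rw [hq.integral_normSq_eq, ← ENNReal.toReal_pow, eLpNorm_two_sq_eq_ofReal (hq.l2.memLp 0),
    ENNReal.toReal_ofReal (integral_nonneg fun x => by positivity)]

/-! ### Bounds for χ by reflection -/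

section Chi

variable {q χ₁ χ₂ : ℝ → ℂ} {δ : ℝ}

lemma IsJostChi.norm_fst_le (h : IsJostChi q χ₁ χ₂) (hq : HasL2Bound q δ) (hδ : δ ^ 2 ≤ 1 / 8)
    (x : ℝ) : ‖χ₁ x‖ ≤ 8 * δ := by
  simpa using h.isJostPhi_reflect.norm_snd_le hq.reflect.neg hδ (-x)

lemma IsJostChi.norm_snd_add_one_le (h : IsJostChi q χ₁ χ₂) (hq : HasL2Bound q δ)
    (hδ : δ ^ 2 ≤ 1 / 8) (x : ℝ) : ‖χ₂ x + 1‖ ≤ 9 * δ ^ 2 := by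
  have := h.isJostPhi_reflect.norm_fst_sub_one_le hq.reflect.neg hδ (-x)
  rw [← norm_neg] at this
  simpa [add_comm] using this

lemma IsJostChi.hasL2Bound_fst (h : IsJostChi q χ₁ χ₂) (hq : HasL2Bound q δ)
    (hδ : δ ^ 2 ≤ 1 / 8) : HasL2Bound χ₁ (9 * δ) := by
  have := (h.isJostPhi_reflect.hasL2Bound_snd hq.reflect.neg hδ).reflect
  simp only [neg_neg] at this
  refine ⟨?_, this.nonneg, ?_, ?_⟩
  · simpa [Function.comp_def] using Complex.continuous_conj.comp this.continuous
  · simpa only [RCLike.norm_conj] using this.integrable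
  · simpa only [RCLike.norm_conj] using this.integral_le

end Chi

/-! ### From the pointwise estimate to L² -/

lemma eLpNorm_le_of_norm_le {D f c : ℝ → ℂ} {δ A γ : ℝ} (hf : HasL2Bound f (9 * δ))
    (hc : HasL2Bound c (9 * δ)) (hA : 0 ≤ A)
    (hD : ∀ x, ‖D x‖ ≤ 16 * (‖f x‖ + ‖c x‖) + A * sech (x + γ)) :
    eLpNorm D 2 volume ≤ ENNReal.ofReal (288 * δ) + ENNReal.ofReal A * eLpNorm sech 2 volume := by
  have hδ : 0 ≤ δ := by linarith [hf.nonneg]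
  have mf := hf.continuous.aestronglyMeasurable (μ := volume)
  have mc := hc.continuous.aestronglyMeasurable (μ := volume)
  have ms : AEStronglyMeasurable (fun x => A * sech (x + γ)) volume :=
    (continuous_const.mul (continuous_sech.comp (continuous_add_const γ))).aestronglyMeasurable
  refine (eLpNorm_mono_real hD).trans ?_
  refine (eLpNorm_add_le ((mf.norm.add mc.norm).const_mul 16) ms (by norm_num)).trans
    (add_le_add ?_ ?_)
  · refine (eLpNorm_le_mul_eLpNorm_of_ae_le_mul (c := 16) (g := fun x => ‖f x‖ + ‖c x‖)
      (ae_of_all _ fun x => ?_) 2).trans ?_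
    · rw [norm_mul]
      simp
    · refine (mul_le_mul_right ((eLpNorm_add_le mf.norm mc.norm (by norm_num)).trans
        (add_le_add (b := ENNReal.ofReal (9 * δ)) (d := ENNReal.ofReal (9 * δ)) ?_ ?_)) _).trans
        (le_of_eq ?_)
      · rw [eLpNorm_norm]; exact hf.eLpNorm_le
      · rw [eLpNorm_norm]; exact hc.eLpNorm_le
      · rw [← ENNReal.ofReal_add hf.nonneg hf.nonneg, ← ENNReal.ofReal_mul (by norm_num)]
        congr 1
        ring
  · rw [← eLpNorm_sech_add γ]
    refine eLpNorm_le_mul_eLpNorm_of_ae_le_mul (ae_of_all _ fun x => ?_) 2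
    rw [norm_mul, Real.norm_of_nonneg hA]

/-! ### The superposition of the two Jost functions -/

/-- The phases that normalise φ(t) and χ(t) are compensated in the exponent, which becomes ((x + γ)
+ i(t + θ))/2; the soliton's position and phase are read off from it. -/
lemma superpose_eq (a : ℂ) (γ θ : ℝ) (φ χ : ℝ → ℝ → ℂ) (t x : ℝ) :
    superpose a γ θ φ χ t x = a * expComb (x + γ) (t + θ)
      (Complex.exp (-(Complex.I * t / 2)) * φ t x) (Complex.exp (Complex.I * t / 2) * χ t x) := by
  have e1 : Complex.exp (((x + γ : ℝ) + Complex.I * (t + θ : ℝ)) / 2)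
      * Complex.exp (-(Complex.I * t / 2))
      = Complex.exp ((γ + Complex.I * θ) / 2) * Complex.exp ((x / 2 : ℝ)) := by
    rw [← Complex.exp_add, ← Complex.exp_add]
    congr 1
    push_cast
    ring
  have e2 : Complex.exp (-((x + γ : ℝ) + Complex.I * (t + θ : ℝ)) / 2)
      * Complex.exp (Complex.I * t / 2)
      = Complex.exp (-(γ + Complex.I * θ) / 2) * Complex.exp ((-x / 2 : ℝ)) := by
    rw [← Complex.exp_add, ← Complex.exp_add]
    congr 1
    push_cast
    ring
  rw [superpose, expComb, ← mul_assoc (Complex.exp _) (Complex.exp _), e1,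
    ← mul_assoc (Complex.exp _) (Complex.exp _), e2, Complex.ofReal_exp, Complex.ofReal_exp]
  ring

lemma hasDerivAt_of_const_mul {c d : ℂ} {f : ℝ → ℂ} {x : ℝ} (hc : c ≠ 0)
    (h : HasDerivAt (fun y => c * f y) (c * d) x) : HasDerivAt f d x := by
  have := h.const_mul c⁻¹
  simpa [← mul_assoc, inv_mul_cancel₀ hc] using this

section Superpose

variable {q φ₁ φ₂ χ₁ χ₂ : ℝ → ℝ → ℂ} (a : ℂ) (γ θ : ℝ)

lemma SolvesLaxTime.superpose (hφ : SolvesLaxTime q φ₁ φ₂) (hχ : SolvesLaxTime q χ₁ χ₂) :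
    SolvesLaxTime q (superpose a γ θ φ₁ χ₁) (superpose a γ θ φ₂ χ₂) := by
  refine ⟨fun t x => ?_, fun t x => ?_⟩
  · refine (((hφ.hasDerivAt_fst t x).const_mul _).add
      ((hχ.hasDerivAt_fst t x).const_mul _)).congr_deriv ?_
    simp only [BacklundNLS.superpose]
    ring
  · refine (((hφ.hasDerivAt_snd t x).const_mul _).add
      ((hχ.hasDerivAt_snd t x).const_mul _)).congr_deriv ?_
    simp only [BacklundNLS.superpose]
    ring

lemma hasDerivAt_exp_half (x : ℝ) :
    HasDerivAt (fun y : ℝ => (Real.exp (y / 2) : ℂ)) (1 / 2 * (Real.exp (x / 2) : ℂ)) x := by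
  have := (((hasDerivAt_id x).div_const 2).exp).ofReal_comp
  refine this.congr_deriv ?_
  push_cast
  simp only [id]
  ring

lemma hasDerivAt_exp_neg_half (x : ℝ) :
    HasDerivAt (fun y : ℝ => (Real.exp (-y / 2) : ℂ)) (-(1 / 2) * (Real.exp (-x / 2) : ℂ)) x := by
  have := (((hasDerivAt_neg x).div_const 2).exp).ofReal_comp
  refine this.congr_deriv ?_
  push_cast
  ring

/-- The weights e^{x/2} and e^{-x/2} turn the two different systems of φ and χ into the same space
equation with diagonal ±1/2, so their combinations solve it. -/
lemma hasDerivAt_superpose {b₁ b₂ : ℂ} (t x : ℝ) (hb₁ : b₁ ≠ 0) (hb₂ : b₂ ≠ 0)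
    (hφ : IsJostPhi (q t) (fun x => b₁ * φ₁ t x) (fun x => b₁ * φ₂ t x))
    (hχ : IsJostChi (q t) (fun x => b₂ * χ₁ t x) (fun x => b₂ * χ₂ t x)) :
    HasDerivAt (superpose a γ θ φ₁ χ₁ t)
      (1 / 2 * superpose a γ θ φ₁ χ₁ t x + q t x * superpose a γ θ φ₂ χ₂ t x) x ∧
    HasDerivAt (superpose a γ θ φ₂ χ₂ t)
      (-conj (q t x) * superpose a γ θ φ₁ χ₁ t x - 1 / 2 * superpose a γ θ φ₂ χ₂ t x) x := by
  have p1 : HasDerivAt (φ₁ t) (q t x * φ₂ t x) x :=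
    hasDerivAt_of_const_mul hb₁ ((hφ.hasDerivAt_fst x).congr_deriv (by ring))
  have p2 : HasDerivAt (φ₂ t) (-conj (q t x) * φ₁ t x - φ₂ t x) x :=
    hasDerivAt_of_const_mul hb₁ ((hφ.hasDerivAt_snd x).congr_deriv (by ring))
  have c1 : HasDerivAt (χ₁ t) (χ₁ t x + q t x * χ₂ t x) x :=
    hasDerivAt_of_const_mul hb₂ ((hχ.hasDerivAt_fst x).congr_deriv (by ring))
  have c2 : HasDerivAt (χ₂ t) (-conj (q t x) * χ₁ t x) x :=
    hasDerivAt_of_const_mul hb₂ ((hχ.hasDerivAt_snd x).congr_deriv (by ring))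
  constructor
  · refine ((((hasDerivAt_exp_half x).const_mul _).mul p1).add
      (((hasDerivAt_exp_neg_half x).const_mul _).mul c1)).congr_deriv ?_
    simp only [BacklundNLS.superpose]
    ring
  · refine ((((hasDerivAt_exp_half x).const_mul _).mul p2).add
      (((hasDerivAt_exp_neg_half x).const_mul _).mul c2)).congr_deriv ?_
    simp only [BacklundNLS.superpose]
    ring

end Superpose

lemma mul_mul_conj_div_eq {a : ℂ} (ha : a ≠ 0) (g₁ g₂ : ℂ) :
    a * g₁ * conj (a * g₂) / (a * g₁ * conj (a * g₁) + a * g₂ * conj (a * g₂))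
      = g₁ * conj g₂ / ((‖g₁‖ ^ 2 + ‖g₂‖ ^ 2 : ℝ) : ℂ) := by
  have ha' : conj a ≠ 0 := (map_ne_zero _).2 ha
  have hn : ((‖g₁‖ ^ 2 + ‖g₂‖ ^ 2 : ℝ) : ℂ) = g₁ * conj g₁ + g₂ * conj g₂ := by
    push_cast
    rw [mul_conj_eq_norm, mul_conj_eq_norm]
  rw [hn]
  simp only [map_mul]
  rw [show a * g₁ * (conj a * conj g₂) = (a * conj a) * (g₁ * conj g₂) by ring,
    show a * g₁ * (conj a * conj g₁) + a * g₂ * (conj a * conj g₂)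
      = (a * conj a) * (g₁ * conj g₁ + g₂ * conj g₂) by ring,
    mul_div_mul_left _ _ (mul_ne_zero ha ha')]

lemma backlund_eq (q ψ₁ ψ₂ : ℝ → ℝ → ℂ) : backlund q ψ₁ ψ₂ = fun t x => -q t x
    - 2 * (ψ₁ t x * conj (ψ₂ t x) / (ψ₁ t x * conj (ψ₁ t x) + ψ₂ t x * conj (ψ₂ t x))) := by
  ext t x
  rw [backlund, mul_conj_eq_norm, mul_conj_eq_norm]
  push_cast
  ring

end BacklundNLS

end

/-! ### The theorem -/

open BacklundNLS in
theorem mainTheorem2 :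
    ∃ ε₀ : ℝ, 0 < ε₀ ∧ ∀ ε : ℝ, 0 < ε → ε < ε₀ → ∃ C : ℝ, 0 < C ∧
      ∀ (q φ₁ φ₂ χ₁ χ₂ : ℝ → ℝ → ℂ) (a : ℂ) (γ θ : ℝ),
        BacklundNLS.IsH3SolutionNLS q →
        eLpNorm (q 0) 2 volume < ENNReal.ofReal ε →
        BacklundNLS.IsJostPhi (q 0) (φ₁ 0) (φ₂ 0) →
        BacklundNLS.SolvesLaxTime q φ₁ φ₂ →
        BacklundNLS.IsJostChi (q 0) (χ₁ 0) (χ₂ 0) →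
        BacklundNLS.SolvesLaxTime q χ₁ χ₂ →
        a ≠ 0 →
        ∀ ψ₁ ψ₂ Q : ℝ → ℝ → ℂ,
          ψ₁ = BacklundNLS.superpose a γ θ φ₁ χ₁ →
          ψ₂ = BacklundNLS.superpose a γ θ φ₂ χ₂ →
          Q = BacklundNLS.backlund q ψ₁ ψ₂ →
          (∀ t x, ‖ψ₁ t x‖ ^ 2 + ‖ψ₂ t x‖ ^ 2 ≠ 0) ∧
          BacklundNLS.IsH3SolutionNLS Q ∧
          (⨆ t : ℝ, eLpNorm (fun x : ℝ => Q t x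
              - Complex.exp (Complex.I * (t + θ)) * (BacklundNLS.sech (x + γ) : ℂ)) 2 volume)
            ≤ ENNReal.ofReal C * eLpNorm (q 0) 2 volume := by
  have hS : eLpNorm sech 2 volume ≠ ⊤ := memLp_sech.2.ne
  -- In the constant, 289 = 1 + 16·(9 + 9): the 1 is the norm of q(t), and 9δ bounds the L² norm of
  -- φ₂ and of χ₁. The constant does not vary with ε.
  refine ⟨1 / 1000, by norm_num, fun ε hε hε₀ => ⟨289 + 108 * (eLpNorm sech 2 volume).toReal,
    by positivity, ?_⟩⟩
  rintro q φ₁ φ₂ χ₁ χ₂ a γ θ hq hqε hφ hφt hχ hχt ha ψ₁ ψ₂ Q rfl rfl rfl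
  obtain ⟨q', q'', q₃, hreg, hq₃, hw⟩ := hq.exists_regularSolution
  set δ := (eLpNorm (q 0) 2 volume).toReal with hδdef
  have hδ0 : 0 ≤ δ := ENNReal.toReal_nonneg
  have hqfin : eLpNorm (q 0) 2 volume ≠ ⊤ := hqε.ne_top
  have hδ : δ ≤ 1 / 1000 := by
    have := (ENNReal.lt_ofReal_iff_toReal_lt hqfin).1 hqε
    linarith
  have hδ8 : δ ^ 2 ≤ 1 / 8 := by nlinarith
  have hb : ∀ t, HasL2Bound (q t) δ := hreg.hasL2Bound
  have J₁ := hreg.isJostPhi (hb 0) hδ8 hφ hφt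
  have J₂ := hreg.isJostChi (hb 0) hδ8 hχ hχt
  have k₁ := fun t => (J₁ t).norm_fst_sub_one_le (hb t) hδ8
  have k₂ := fun t => (J₁ t).norm_snd_le (hb t) hδ8
  have k₃ := fun t => (J₂ t).norm_fst_le (hb t) hδ8
  have k₄ := fun t => (J₂ t).norm_snd_add_one_le (hb t) hδ8
  have L₁ := fun t => (J₁ t).hasL2Bound_snd (hb t) hδ8
  have L₂ := fun t => (J₂ t).hasL2Bound_fst (hb t) hδ8
  have hN : ∀ t x, ‖superpose a γ θ φ₁ χ₁ t x‖ ^ 2 + ‖superpose a γ θ φ₂ χ₂ t x‖ ^ 2 ≠ 0 := by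
    intro t x
    have h := cosh_le_normSq (s := x + γ) (α := t + θ) hδ hδ0 (k₁ t x) (k₂ t x) (k₃ t x) (k₄ t x)
    have h1 := Real.cosh_pos (x + γ)
    have ha' : 0 < ‖a‖ ^ 2 := by positivity
    rw [superpose_eq, superpose_eq, norm_mul, norm_mul, mul_pow, mul_pow, ← mul_add]
    exact (mul_pos ha' (h1.trans_le h)).ne'
  have hD := isDarboux_of_lax hreg
    (fun t x => (hasDerivAt_superpose a γ θ t x (Complex.exp_ne_zero _) (Complex.exp_ne_zero _)
      (J₁ t) (J₂ t)).1)
    (fun t x => (hasDerivAt_superpose a γ θ t x (Complex.exp_ne_zero _) (Complex.exp_ne_zero _)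
      (J₁ t) (J₂ t)).2) (hφt.superpose a γ θ hχt) hN
  rw [backlund_eq]
  set p : ℝ → ℝ → ℂ := fun t x => superpose a γ θ φ₁ χ₁ t x * conj (superpose a γ θ φ₂ χ₂ t x)
    / (superpose a γ θ φ₁ χ₁ t x * conj (superpose a γ θ φ₁ χ₁ t x)
      + superpose a γ θ φ₂ χ₂ t x * conj (superpose a γ θ φ₂ χ₂ t x)) with hp
  have hpt : ∀ t x : ℝ, ‖-(2 * p t x) - Complex.exp (Complex.I * (t + θ)) * (sech (x + γ) : ℂ)‖
      ≤ 16 * (‖Complex.exp (-(Complex.I * t / 2)) * φ₂ t x‖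
        + ‖Complex.exp (Complex.I * t / 2) * χ₁ t x‖) + 108 * δ * sech (x + γ) := by
    intro t x
    have h := norm_backlund_sub_soliton_le (s := x + γ) (α := t + θ) hδ hδ0 (k₁ t x) (k₂ t x)
      (k₃ t x) (k₄ t x)
    rw [← mul_mul_conj_div_eq ha, ← superpose_eq, ← superpose_eq, Complex.ofReal_add] at h
    exact h
  have hexp : ∀ t : ℝ, ‖Complex.exp (Complex.I * (t + θ))‖ = 1 := fun t => by
    have := norm_exp_I_mul (t + θ)
    rwa [Complex.ofReal_add] at this
  -- Closeness to the soliton already shows that p is in L², uniformly in t; the regularity of Q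
  -- depends on this. The extra 1 in 108δ + 1 is the soliton itself.
  have hpM : ∀ t, eLpNorm (p t) 2 volume ≤ ENNReal.ofReal (288 * δ)
      + ENNReal.ofReal (108 * δ + 1) * eLpNorm sech 2 volume := fun t => by
    refine eLpNorm_le_of_norm_le (γ := γ) (L₁ t) (L₂ t) (by positivity) fun x => ?_
    have h1 := hpt t x
    have h2 : ‖2 * p t x‖ ≤ ‖-(2 * p t x) - Complex.exp (Complex.I * (t + θ)) * (sech (x + γ) : ℂ)‖
        + ‖Complex.exp (Complex.I * (t + θ)) * (sech (x + γ) : ℂ)‖ := by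
      rw [← norm_neg (2 * p t x)]
      exact norm_le_norm_sub_add _ _
    rw [norm_mul, norm_mul, hexp, one_mul, Complex.norm_real,
      Real.norm_of_nonneg (sech_nonneg _), Complex.norm_ofNat] at h2
    linarith [norm_nonneg (p t x)]
  have hM : ENNReal.ofReal (288 * δ) + ENNReal.ofReal (108 * δ + 1) * eLpNorm sech 2 volume ≠ ⊤ :=
    ENNReal.add_ne_top.2 ⟨ENNReal.ofReal_ne_top, ENNReal.mul_ne_top ENNReal.ofReal_ne_top hS⟩
  have hpL : ∀ t, MemLp (p t) 2 volume := fun t =>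
    ⟨(hD.isBoundedCoeff_p.space t).aestronglyMeasurable, (hpM t).trans_lt hM.lt_top⟩
  refine ⟨hN, hD.isH3SolutionNLS hreg hq₃ hw (hD.continuousInL2_p hreg hpL hM hpM),
    iSup_le fun t => ?_⟩
  have e : (fun x : ℝ => -q t x - 2 * p t x
      - Complex.exp (Complex.I * (t + θ)) * (sech (x + γ) : ℂ))
      = (fun x => -q t x) + fun x : ℝ => -(2 * p t x)
        - Complex.exp (Complex.I * (t + θ)) * (sech (x + γ) : ℂ) := by
    ext x
    simp only [Pi.add_apply]
    ring
  have m2 : AEStronglyMeasurable (fun x : ℝ => -(2 * p t x)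
      - Complex.exp (Complex.I * (t + θ)) * (sech (x + γ) : ℂ)) volume := by
    refine Continuous.aestronglyMeasurable (Continuous.sub ?_ ?_)
    · exact (continuous_const.mul (hD.isBoundedCoeff_p.space t)).neg
    · exact continuous_const.mul (Complex.continuous_ofReal.comp
        (continuous_sech.comp (continuous_add_const γ)))
  rw [e]
  refine (eLpNorm_add_le (hb t).neg.memLp.1 m2 (by norm_num)).trans ?_
  refine (add_le_add (hb t).neg.eLpNorm_le
    (eLpNorm_le_of_norm_le (L₁ t) (L₂ t) (by positivity) (hpt t))).trans ?_
  rw [← ENNReal.ofReal_toReal hS, ← ENNReal.ofReal_toReal hqfin, ← hδdef,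
    ← ENNReal.ofReal_mul (by positivity), ← ENNReal.ofReal_add (by positivity) (by positivity),
    ← ENNReal.ofReal_add (by positivity) (by positivity), ← ENNReal.ofReal_mul (by positivity)]
  refine ENNReal.ofReal_le_ofReal (le_of_eq ?_)
  simp only [ENNReal.toReal_ofReal ENNReal.toReal_nonneg]
  ring
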